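/- Let $K$ be a field of characteristic $0$. An arrow diagram is a finite set of oriented chords (arrows) with distinct endpoints on an oriented line (the skeleton), up to isomorphism; its degree is the number of arrows. Let $\mathcal A^w(\uparrow)$ be the space of formal $K$-linear combinations of arrow diagrams modulo the following relations. TC (Tails Commute): two adjacent arrow tails on the skeleton may be interchanged. 6T: $[a_{ij},a_{ik}]+[a_{ij},a_{jk}]+[a_{ik},a_{jk}]=0$, where $i,j,k$ are three disjoint pieces of the skeleton, in any order along it, $a_{xy}$ is an arrow from piece $x$ to piece $y$, and any further arrows may be present outside these pieces. It is a graded bialgebra: the product is juxtaposition, and the coproduct of a diagram is the sum of all ways of dividing its arrows between a left and a right cofactor. A w-Jacobi diagram consists of the oriented skeleton line and directed edges (arrows), each of whose ends is a trivalent skeleton vertex (where one arrow starts or ends) or a trivalent internal vertex; at an internal vertex two arrows end, one marked left and one marked right, and one arrow begins; the whole graph is connected. Let $\mathcal A^{wt}(\uparrow)$ be the space of formal $K$-linear combinations of w-Jacobi diagrams modulo TC and the relations $\overrightarrow{STU}$. In the latter, let $v$ be an internal vertex with left incoming arrow $a$, right incoming arrow $b$ and outgoing arrow $c$, and write $x_e$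 and $\varphi_e$ for a head and a tail on the skeleton of the arrow $e$. If $c$ ends on the skeleton, then $v$ and this end may be replaced by $x_ax_b-x_bx_a$; if $b$ starts on the skeleton, then $v$ and this start may be replaced by $\varphi_cx_a-x_a\varphi_c$; if $a$ starts on the skeleton, then $v$ and this start may be replaced by $x_b\varphi_c-\varphi_cx_b$ (products are read along the skeleton). The inclusion of arrow diagrams into w-Jacobi diagrams induces a linear isomorphism $\mathcal A^w(\uparrow)\cong\mathcal A^{wt}(\uparrow)$, by which the two spaces are identified. Let $D_L$ and $D_R$ be the diagrams with a single arrow, pointing against, respectively along, the direction of the skeleton. For $k\ge1$ let $w_k$ be the $k$-wheel: a directed cycle of $k$ arrows through $k$ internal vertices, each of which also receives one arrow (a spoke) that starts on the skeleton, the spoke being the left and the arrow of the cycle the right incoming arrow. **Theorem.** The graded bialgebra $\mathcal A^w(\uparrow)$ is the bialgebra of polynomials in $D_L$, $D_R$ and $w_k$ $(k\ge 1)$, where $\deg D_L=\deg D_R=1$, $\deg w_k=k$ and all these generators are primitive, subject to the one relation $w_1=D_L-D_R$. That is, there is an isomorphism of graded bialgebras from $K[D_L,D_R,w_1,w_2,\dots]/(w_1-D_L+D_R)$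 to $\mathcal A^w(\uparrow)$ that takes each generator to the diagram of the same name. Thus $\mathcal A^w(\uparrow)$ is a polynomial algebra freely generated by $D_L$, $D_R$ and $w_k$ $(k\ge2)$, with two generators in degree $1$ and one generator in every degree greater than $1$. -/

import Mathlib

open scoped TensorProduct

/-!
Arrow diagrams and w-Jacobi diagrams on one long oriented skeleton line, the bialgebra `Aw` of
arrow diagrams modulo 6T and TC, the space `Awt` of w-Jacobi diagrams modulo STU and TC, and the
bialgebra of polynomials in `D_L`, `D_R` and the wheels.

Every arrow of a diagram carries a name (a natural number); diagrams are taken up to renaming.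
The skeleton line is recorded as the list of its vertices, in the order of its orientation.
-/

namespace WKnot

universe u

/-- A skeleton vertex: the place where the arrow called `e` starts (`tail e`) or ends (`head e`). -/
inductive Letter : Type
  | tail : ℕ → Letter
  | head : ℕ → Letter

open Letter

namespace Letter

def name : Letter → ℕ
  | tail e => e
  | head e => e

def map (f : ℕ → ℕ) : Letter → Letter
  | tail e => tail (f e)
  | head e => head (f e)

def tail? : Letter → Option ℕ
  | tail e => some e
  | head _ => none

def head? : Letter → Option ℕ
  | tail _ => none
  | head e => some e

end Letter

/-- The names of the arrows that start on the skeleton, in order. -/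
def tails (w : List Letter) : List ℕ := w.filterMap Letter.tail?

/-- The names of the arrows that end on the skeleton, in order. -/
def heads (w : List Letter) : List ℕ := w.filterMap Letter.head?

/-- The word `w` describes an arrow diagram: each name that occurs in it is the name of exactly
one tail and of exactly one head. -/
def Valid (w : List Letter) : Prop := (tails w).Nodup ∧ (tails w).Perm (heads w)

def rename (f : ℕ → ℕ) (w : List Letter) : List Letter := w.map (Letter.map f)

/-! ### Elementary facts on words -/

@[simp] theorem tails_nil : tails [] = [] := rfl
@[simp] theorem heads_nil : heads [] = [] := rfl
@[simp] theorem tails_cons_tail (e : ℕ) (w : List Letter) : tails (tail e :: w) = e :: tails w := rfl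
@[simp] theorem tails_cons_head (e : ℕ) (w : List Letter) : tails (head e :: w) = tails w := rfl
@[simp] theorem heads_cons_tail (e : ℕ) (w : List Letter) : heads (tail e :: w) = heads w := rfl
@[simp] theorem heads_cons_head (e : ℕ) (w : List Letter) : heads (head e :: w) = e :: heads w := rfl

@[simp] theorem tails_append (u v : List Letter) : tails (u ++ v) = tails u ++ tails v := by
  simp [tails]

@[simp] theorem heads_append (u v : List Letter) : heads (u ++ v) = heads u ++ heads v := by
  simp [heads]

theorem tails_perm {u v : List Letter} (h : u.Perm v) : (tails u).Perm (tails v) :=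
  h.filterMap _

theorem heads_perm {u v : List Letter} (h : u.Perm v) : (heads u).Perm (heads v) :=
  h.filterMap _

theorem Valid.of_perm {u v : List Letter} (h : u.Perm v) (hu : Valid u) : Valid v :=
  ⟨(tails_perm h).nodup_iff.1 hu.1, (tails_perm h).symm.trans (hu.2.trans (heads_perm h))⟩

@[simp] theorem tails_rename (f : ℕ → ℕ) (w : List Letter) :
    tails (rename f w) = (tails w).map f := by
  induction w with
  | nil => rfl
  | cons a w ih =>
    cases a <;> simp_all [rename, Letter.map]

@[simp] theorem heads_rename (f : ℕ → ℕ) (w : List Letter) :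
    heads (rename f w) = (heads w).map f := by
  induction w with
  | nil => rfl
  | cons a w ih =>
    cases a <;> simp_all [rename, Letter.map]

theorem rename_rename (f g : ℕ → ℕ) (w : List Letter) :
    rename f (rename g w) = rename (fun n => f (g n)) w := by
  simp only [rename, List.map_map]
  congr 1
  funext a
  cases a <;> rfl

theorem rename_append (f : ℕ → ℕ) (u v : List Letter) :
    rename f (u ++ v) = rename f u ++ rename f v := by
  simp [rename]

theorem rename_id (w : List Letter) : rename (fun n => n) w = w := by
  induction w with
  | nil => rfl
  | cons a w ih => cases a <;> simp_all [rename, Letter.map]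

@[simp] theorem name_tail (e : ℕ) : (tail e).name = e := rfl
@[simp] theorem name_head (e : ℕ) : (head e).name = e := rfl

theorem mem_names_iff {w : List Letter} {n : ℕ} :
    (∃ a ∈ w, a.name = n) ↔ n ∈ tails w ∨ n ∈ heads w := by
  induction w with
  | nil => simp
  | cons a w ih =>
    cases a <;> simp only [List.mem_cons, exists_eq_or_imp, ih, name_tail, name_head,
      tails_cons_tail, tails_cons_head, heads_cons_tail, heads_cons_head] <;> grind

theorem Valid.name_mem {w : List Letter} (h : Valid w) {a : Letter} (ha : a ∈ w) :
    a.name ∈ tails w := by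
  rcases mem_names_iff.1 ⟨a, ha, rfl⟩ with h1 | h1
  · exact h1
  · exact h.2.mem_iff.2 h1

theorem rename_congr {f g : ℕ → ℕ} {w : List Letter} (h : ∀ a ∈ w, f a.name = g a.name) :
    rename f w = rename g w := by
  apply List.map_congr_left
  intro a ha
  have := h a ha
  cases a <;> simp_all [Letter.map, Letter.name]

theorem rename_eq_self {f : ℕ → ℕ} {w : List Letter} (h : ∀ a ∈ w, f a.name = a.name) :
    rename f w = w := by
  rw [rename_congr (g := fun n => n) h, rename_id]

theorem of_rename_eq_self {f : ℕ → ℕ} {w : List Letter} (h : rename f w = w) :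
    ∀ n ∈ tails w, f n = n := by
  have h2 : (tails w).map f = tails w := by rw [← tails_rename, h]
  intro n hn
  have h3 : (tails w).map f = (tails w).map id := by simpa using h2
  exact (List.map_inj_left.1 h3) n hn

theorem Valid.rename {f : ℕ → ℕ} {w : List Letter} (h : Valid w)
    (hf : ∀ m ∈ tails w, ∀ n ∈ tails w, f m = f n → m = n) : Valid (rename f w) := by
  refine ⟨?_, ?_⟩
  · rw [tails_rename]
    exact List.Nodup.map_on hf h.1
  · rw [tails_rename, heads_rename]
    exact h.2.map f

theorem Valid.append {u v : List Letter} (hu : Valid u) (hv : Valid v)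
    (h : ∀ n ∈ tails u, n ∉ tails v) : Valid (u ++ v) := by
  refine ⟨?_, ?_⟩
  · rw [tails_append, List.nodup_append]
    exact ⟨hu.1, hv.1, fun a ha b hb hab => h a ha (hab ▸ hb)⟩
  · rw [tails_append, heads_append]
    exact hu.2.append hv.2

/-- The part of a diagram made of the arrows whose name satisfies `p`. -/
def restrict (p : ℕ → Prop) [DecidablePred p] (w : List Letter) : List Letter :=
  w.filter fun a => p a.name

theorem tails_restrict (p : ℕ → Prop) [DecidablePred p] (w : List Letter) :
    tails (restrict p w) = (tails w).filter fun n => p n := by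
  induction w with
  | nil => rfl
  | cons a w ih =>
    rcases a with e | e <;> by_cases hp : p e <;> simp_all [restrict]

theorem heads_restrict (p : ℕ → Prop) [DecidablePred p] (w : List Letter) :
    heads (restrict p w) = (heads w).filter fun n => p n := by
  induction w with
  | nil => rfl
  | cons a w ih =>
    rcases a with e | e <;> by_cases hp : p e <;> simp_all [restrict]

theorem Valid.restrict {w : List Letter} (h : Valid w) (p : ℕ → Prop) [DecidablePred p] :
    Valid (restrict p w) := by
  refine ⟨?_, ?_⟩
  · rw [tails_restrict]
    exact h.1.filter _
  · rw [tails_restrict, heads_restrict]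
    exact h.2.filter _

theorem restrict_append (p : ℕ → Prop) [DecidablePred p] (u v : List Letter) :
    restrict p (u ++ v) = restrict p u ++ restrict p v := by
  simp [restrict]

theorem restrict_rename (p : ℕ → Prop) [DecidablePred p] (f : ℕ → ℕ) (w : List Letter) :
    restrict p (rename f w) = rename f (restrict (fun n => p (f n)) w) := by
  induction w with
  | nil => rfl
  | cons a w ih =>
    rcases a with e | e <;> by_cases hp : p (f e) <;>
      simp_all [WKnot.restrict, WKnot.rename, Letter.map]

theorem restrict_congr {p q : ℕ → Prop} [DecidablePred p] [DecidablePred q] {w : List Letter}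
    (h : ∀ a ∈ w, p a.name ↔ q a.name) : restrict p w = restrict q w := by
  apply List.filter_congr
  intro a ha
  simp [h a ha]

theorem restrict_restrict (p q : ℕ → Prop) [DecidablePred p] [DecidablePred q]
    (w : List Letter) : restrict p (restrict q w) = restrict (fun n => p n ∧ q n) w := by
  simp [restrict, List.filter_filter]

/-! ### Arrow diagrams -/

/-- Two words differ by a renaming of the arrows that is injective on the names in use. -/
def Renamed (u v : List Letter) : Prop := ∃ f g : ℕ → ℕ, v = rename f u ∧ u = rename g v

theorem Renamed.symm {u v : List Letter} : Renamed u v → Renamed v u :=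
  fun ⟨f, g, h1, h2⟩ => ⟨g, f, h2, h1⟩

theorem Renamed.valid {u v : List Letter} (h : Renamed u v) (hu : Valid u) : Valid v := by
  obtain ⟨f, g, h1, h2⟩ := h
  rw [h1]
  have h3 : rename (fun n => g (f n)) u = u := by rw [← rename_rename, ← h1, ← h2]
  have h4 := of_rename_eq_self h3
  refine hu.rename fun m hm n hn hmn => ?_
  rw [← h4 m hm, ← h4 n hn, hmn]

/-- Words that describe arrow diagrams. -/
def ArrowWord : Type := {w : List Letter // Valid w}

instance ArrowWord.setoid : Setoid ArrowWord where
  r u v := Renamed u.1 v.1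
  iseqv :=
    { refl := fun u => ⟨fun n => n, fun n => n, (rename_id _).symm, (rename_id _).symm⟩
      symm := Renamed.symm
      trans := by
        rintro u v w ⟨f, g, h1, h2⟩ ⟨f', g', h3, h4⟩
        exact ⟨fun n => f' (f n), fun n => g (g' n), by rw [← rename_rename, ← h1, h3],
          by rw [← rename_rename, ← h4, h2]⟩ }

/-- Arrow diagrams on a long line. -/
def ArrowDiagram : Type := Quotient ArrowWord.setoid

namespace ArrowDiagram

def mk (w : List Letter) (h : Valid w) : ArrowDiagram := Quotient.mk _ ⟨w, h⟩

theorem mk_eq {u v : List Letter} (hu : Valid u) (hv : Valid v) (h : Renamed u v) :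
    mk u hu = mk v hv := Quotient.sound h

theorem ind {P : ArrowDiagram → Prop} (h : ∀ w hw, P (mk w hw)) (D : ArrowDiagram) : P D :=
  Quotient.ind (fun u => h u.1 u.2) D

/-- The number of arrows. -/
def degree : ArrowDiagram → ℕ :=
  Quotient.lift (fun u => (tails u.1).length) (by
    rintro u v ⟨f, g, h1, h2⟩
    simp only [h1, tails_rename, List.length_map])

/-- Juxtaposition of words, the names being first made disjoint. -/
def juxtapose (u v : List Letter) : List Letter :=
  rename (fun n => 2 * n) u ++ rename (fun n => 2 * n + 1) v

theorem juxtapose_valid {u v : List Letter} (hu : Valid u) (hv : Valid v) :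
    Valid (juxtapose u v) := by
  refine Valid.append (hu.rename ?_) (hv.rename ?_) ?_
  · intros; omega
  · intros; omega
  · intro n hn hn'
    simp only [tails_rename, List.mem_map] at hn hn'
    obtain ⟨a, -, ha⟩ := hn
    obtain ⟨b, -, hb⟩ := hn'
    omega

theorem juxtapose_renamed {u v : List Letter} (hu : Valid u) (hv : Valid v)
    (h : ∀ n ∈ tails u, n ∉ tails v) : Renamed (juxtapose u v) (u ++ v) := by
  refine ⟨fun n => n / 2, fun n => if n ∈ tails u then 2 * n else 2 * n + 1, ?_, ?_⟩
  · rw [juxtapose, rename_append, rename_rename, rename_rename]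
    congr 1
    · refine (rename_eq_self fun a _ => ?_).symm
      omega
    · refine (rename_eq_self fun a _ => ?_).symm
      omega
  · rw [juxtapose, rename_append]
    congr 1
    · refine rename_congr fun a ha => ?_
      rw [if_pos (hu.name_mem ha)]
    · refine rename_congr fun a ha => ?_
      rw [if_neg fun h' => h _ h' (hv.name_mem ha)]

/-- Arrow diagrams form a monoid under juxtaposition. -/
instance : Monoid ArrowDiagram where
  one := mk [] ⟨List.nodup_nil, List.Perm.nil⟩
  mul := Quotient.map₂ (fun u v => ⟨juxtapose u.1 v.1, juxtapose_valid u.2 v.2⟩) (by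
    rintro u u' ⟨f, g, h1, h2⟩ v v' ⟨f', g', h3, h4⟩
    refine ⟨fun n => if n % 2 = 0 then 2 * f (n / 2) else 2 * f' (n / 2) + 1,
      fun n => if n % 2 = 0 then 2 * g (n / 2) else 2 * g' (n / 2) + 1, ?_, ?_⟩
    · change juxtapose u'.1 v'.1 = rename _ (juxtapose u.1 v.1)
      rw [juxtapose, juxtapose, rename_append, rename_rename, rename_rename, h1, h3,
        rename_rename, rename_rename]
      congr 1
      · refine rename_congr fun a _ => ?_
        simp
      · refine rename_congr fun a _ => ?_
        rw [if_neg (by omega), show (2 * a.name + 1) / 2 = a.name by omega]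
    · change juxtapose u.1 v.1 = rename _ (juxtapose u'.1 v'.1)
      rw [juxtapose, juxtapose, rename_append, rename_rename, rename_rename]
      conv_lhs => rw [h2, h4]
      rw [rename_rename, rename_rename]
      congr 1
      · refine rename_congr fun a _ => ?_
        simp
      · refine rename_congr fun a _ => ?_
        rw [if_neg (by omega), show (2 * a.name + 1) / 2 = a.name by omega])
  mul_assoc := by
    refine fun a b c => Quotient.inductionOn₃ a b c fun u v w => Quotient.sound ?_
    refine ⟨fun n => if n % 4 = 0 then n / 2 else if n % 4 = 2 then n - 1 else 2 * n + 1,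
      fun n => if n % 2 = 0 then 2 * n else if n % 4 = 1 then n + 1 else n / 2, ?_, ?_⟩
    · change juxtapose u.1 (juxtapose v.1 w.1) = rename _ (juxtapose (juxtapose u.1 v.1) w.1)
      simp only [juxtapose, rename_append, rename_rename, List.append_assoc]
      congr 1
      · exact rename_congr fun a _ => by grind
      · congr 1
        · exact rename_congr fun a _ => by grind
        · exact rename_congr fun a _ => by grind
    · change juxtapose (juxtapose u.1 v.1) w.1 = rename _ (juxtapose u.1 (juxtapose v.1 w.1))
      simp only [juxtapose, rename_append, rename_rename, List.append_assoc]
      congr 1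
      · exact rename_congr fun a _ => by grind
      · congr 1
        · exact rename_congr fun a _ => by grind
        · exact rename_congr fun a _ => by grind
  one_mul := by
    refine fun a => Quotient.inductionOn a fun u => Quotient.sound ?_
    exact juxtapose_renamed (u := []) ⟨List.nodup_nil, List.Perm.nil⟩ u.2 (by simp)
  mul_one := by
    refine fun a => Quotient.inductionOn a fun u => Quotient.sound ?_
    have := juxtapose_renamed (v := []) u.2 ⟨List.nodup_nil, List.Perm.nil⟩ (by simp)
    rw [List.append_nil] at this
    exact this

theorem one_def : (1 : ArrowDiagram) = mk [] ⟨List.nodup_nil, List.Perm.nil⟩ := rfl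

theorem mk_mul_mk {u v : List Letter} (hu : Valid u) (hv : Valid v) :
    mk u hu * mk v hv = mk (juxtapose u v) (juxtapose_valid hu hv) := rfl

theorem mk_mul_mk_of_disjoint {u v : List Letter} (hu : Valid u) (hv : Valid v)
    (h : ∀ n ∈ tails u, n ∉ tails v) : mk u hu * mk v hv = mk (u ++ v) (hu.append hv h) :=
  mk_eq _ _ (juxtapose_renamed hu hv h)

/-- The left-going arrow. -/
def dL : ArrowDiagram := mk [head 0, tail 0] ⟨by simp, by simp⟩

/-- The right-going arrow. -/
def dR : ArrowDiagram := mk [tail 0, head 0] ⟨by simp, by simp⟩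

end ArrowDiagram

/-! ### The algebra of arrow diagrams -/

instance (w : List Letter) : Decidable (Valid w) := inferInstanceAs (Decidable (_ ∧ _))

section Aw

variable (K : Type u) [Field K]

/-- Formal linear combinations of arrow diagrams, an algebra under juxtaposition. -/
abbrev Dv : Type u := MonoidAlgebra K ArrowDiagram

/-- The arrow diagram described by a word (and `0` if the word describes none). -/
noncomputable def dia (w : List Letter) : Dv K :=
  if h : Valid w then MonoidAlgebra.of K ArrowDiagram (ArrowDiagram.mk w h) else 0

/-- Three pieces `c 0`, `c 1`, `c 2` of the skeleton placed along the long line in the order given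
by `σ`, with the further skeleton vertices `S` before, between and after them. -/
def place (S : Fin 4 → List Letter) (σ : Equiv.Perm (Fin 3)) (c : Fin 3 → List Letter) :
    List Letter :=
  S 0 ++ (c (σ 0) ++ (S 1 ++ (c (σ 1) ++ (S 2 ++ (c (σ 2) ++ S 3)))))

/-- The relations among arrow diagrams. `tc` is Tails Commute. `sixT` is the 6T relation
`[a_ij, a_ik] + [a_ij, a_jk] + [a_ik, a_jk] = 0`, where `i, j, k` are the pieces `0, 1, 2` of the
skeleton, `a_xy` is an arrow from piece `x` to piece `y`, and in each of the three commutators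
`p` names the first arrow and `q` the second. -/
inductive Rel : Dv K → Dv K → Prop
  | tc (S₁ S₂ : List Letter) (p q : ℕ) (h : Valid (S₁ ++ [tail p, tail q] ++ S₂)) :
      Rel (dia K (S₁ ++ [tail p, tail q] ++ S₂)) (dia K (S₁ ++ [tail q, tail p] ++ S₂))
  | sixT (S : Fin 4 → List Letter) (σ : Equiv.Perm (Fin 3)) (p q : ℕ)
      (h : Valid (place S σ ![[tail p, tail q], [head p], [head q]])) :
      Rel
        ((dia K (place S σ ![[tail p, tail q], [head p], [head q]])
          - dia K (place S σ ![[tail q, tail p], [head p], [head q]]))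
        + (dia K (place S σ ![[tail p], [head p, tail q], [head q]])
          - dia K (place S σ ![[tail p], [tail q, head p], [head q]]))
        + (dia K (place S σ ![[tail p], [tail q], [head p, head q]])
          - dia K (place S σ ![[tail p], [tail q], [head q, head p]]))) 0

/-- Arrow diagrams on a long line modulo 6T and TC. -/
def Aw : Type u := RingQuot (Rel K)

noncomputable instance : Ring (Aw K) := inferInstanceAs (Ring (RingQuot (Rel K)))
noncomputable instance : Algebra K (Aw K) := inferInstanceAs (Algebra K (RingQuot (Rel K)))

namespace Aw

noncomputable def proj : Dv K →ₐ[K] Aw K := RingQuot.mkAlgHom K (Rel K)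

/-- The class of an arrow diagram. -/
noncomputable def of (D : ArrowDiagram) : Aw K := proj K (MonoidAlgebra.of K ArrowDiagram D)

/-- The degree `n` part: the span of the arrow diagrams with `n` arrows. -/
noncomputable def grade (n : ℕ) : Submodule K (Aw K) :=
  Submodule.span K (of K '' {D | D.degree = n})

/-- The class of the arrow diagram described by a word. -/
noncomputable def mk (w : List Letter) : Aw K := proj K (dia K w)

theorem mk_of_valid {w : List Letter} (h : Valid w) : mk K w = of K (ArrowDiagram.mk w h) := by
  rw [mk, dia, dif_pos h, of]

theorem mk_renamed {u v : List Letter} (h : Renamed u v) : mk K u = mk K v := by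
  by_cases hu : Valid u
  · rw [mk_of_valid K hu, mk_of_valid K (h.valid hu), ArrowDiagram.mk_eq hu (h.valid hu) h]
  · rw [mk, mk, dia, dia, dif_neg hu, dif_neg fun hv => hu (h.symm.valid hv)]

theorem mk_mul {u v : List Letter} (hu : Valid u) (hv : Valid v)
    (h : ∀ n ∈ tails u, n ∉ tails v) : mk K u * mk K v = mk K (u ++ v) := by
  rw [mk_of_valid K hu, mk_of_valid K hv, mk_of_valid K (hu.append hv h), of, of, of,
    ← ArrowDiagram.mk_mul_mk_of_disjoint hu hv h, map_mul, map_mul]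

theorem mk_nil : mk K [] = 1 := by
  have h : Valid [] := ⟨List.nodup_nil, List.Perm.nil⟩
  rw [mk_of_valid K h, of, ← ArrowDiagram.one_def, map_one, map_one]

theorem mk_tc {S₁ S₂ : List Letter} {p q : ℕ} (h : Valid (S₁ ++ [tail p, tail q] ++ S₂)) :
    mk K (S₁ ++ [tail p, tail q] ++ S₂) = mk K (S₁ ++ [tail q, tail p] ++ S₂) :=
  RingQuot.mkAlgHom_rel K (Rel.tc (K := K) S₁ S₂ p q h)

theorem mk_tc' {S₁ S₂ : List Letter} {p q : ℕ} (h : Valid (S₁ ++ tail p :: tail q :: S₂)) :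
    mk K (S₁ ++ tail p :: tail q :: S₂) = mk K (S₁ ++ tail q :: tail p :: S₂) := by
  simpa using mk_tc K (S₁ := S₁) (S₂ := S₂) (p := p) (q := q) (by simpa using h)

theorem mk_sixT {S : Fin 4 → List Letter} {σ : Equiv.Perm (Fin 3)} {p q : ℕ}
    (h : Valid (place S σ ![[tail p, tail q], [head p], [head q]])) :
    (mk K (place S σ ![[tail p, tail q], [head p], [head q]])
      - mk K (place S σ ![[tail q, tail p], [head p], [head q]]))
    + (mk K (place S σ ![[tail p], [head p, tail q], [head q]])
      - mk K (place S σ ![[tail p], [tail q, head p], [head q]]))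
    + (mk K (place S σ ![[tail p], [tail q], [head p, head q]])
      - mk K (place S σ ![[tail p], [tail q], [head q, head p]])) = 0 := by
  have := RingQuot.mkAlgHom_rel K (Rel.sixT (K := K) S σ p q h)
  simp only [map_add, map_sub, map_zero] at this
  exact this

/-! ### The coproduct -/

/-- The sum of all ways of dividing the arrows between a left and a right cofactor. -/
noncomputable def comulWord (w : List Letter) : Aw K ⊗[K] Aw K :=
  ∑ A ∈ (tails w).toFinset.powerset,
    mk K (restrict (fun n => n ∈ A) w) ⊗ₜ[K] mk K (restrict (fun n => n ∉ A) w)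

theorem comulWord_renamed {u v : List Letter} (hu : Valid u) (h : Renamed u v) :
    comulWord K v = comulWord K u := by
  have hv := h.valid hu
  obtain ⟨f, g, h1, h2⟩ := h
  have hgf : ∀ n ∈ tails u, g (f n) = n :=
    of_rename_eq_self (f := fun n => g (f n)) (by rw [← rename_rename, ← h1, ← h2])
  have hfg : ∀ n ∈ tails v, f (g n) = n :=
    of_rename_eq_self (f := fun n => f (g n)) (by rw [← rename_rename, ← h2, ← h1])
  have hf : ∀ n ∈ tails u, f n ∈ tails v := fun n hn => by
    rw [h1, tails_rename]; exact List.mem_map_of_mem hn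
  have hg : ∀ n ∈ tails v, g n ∈ tails u := fun n hn => by
    rw [h2, tails_rename]; exact List.mem_map_of_mem hn
  have key : ∀ p q : ℕ → Prop, ∀ _ : DecidablePred p, ∀ _ : DecidablePred q,
      (∀ n ∈ tails u, p (f n) ↔ q n) → mk K (restrict p v) = mk K (restrict q u) := by
    intro p q _ _ hpq
    have e1 : restrict p v = rename f (restrict q u) := by
      rw [h1, restrict_rename]
      congr 1
      exact restrict_congr fun a ha => hpq _ (hu.name_mem ha)
    refine (mk_renamed K ⟨f, g, e1, ?_⟩).symm
    rw [e1, rename_rename]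
    refine (rename_eq_self fun a ha => ?_).symm
    exact hgf _ (hu.name_mem (List.mem_of_mem_filter ha))
  refine Finset.sum_nbij' (fun A => A.image g) (fun A => A.image f) ?_ ?_ ?_ ?_ ?_
  · intro A hA
    simp only [Finset.mem_powerset, Finset.subset_iff, List.mem_toFinset, Finset.mem_image] at *
    rintro _ ⟨n, hn, rfl⟩
    exact hg _ (hA hn)
  · intro A hA
    simp only [Finset.mem_powerset, Finset.subset_iff, List.mem_toFinset, Finset.mem_image] at *
    rintro _ ⟨n, hn, rfl⟩
    exact hf _ (hA hn)
  · intro A hA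
    simp only [Finset.mem_powerset, Finset.subset_iff, List.mem_toFinset] at hA
    rw [Finset.image_image]
    refine (Finset.image_congr fun n hn => ?_).trans Finset.image_id
    exact hfg _ (hA hn)
  · intro A hA
    simp only [Finset.mem_powerset, Finset.subset_iff, List.mem_toFinset] at hA
    rw [Finset.image_image]
    refine (Finset.image_congr fun n hn => ?_).trans Finset.image_id
    exact hgf _ (hA hn)
  · intro A hA
    simp only [Finset.mem_powerset, Finset.subset_iff, List.mem_toFinset] at hA
    have hiff : ∀ n ∈ tails u, f n ∈ A ↔ n ∈ A.image g := by
      intro n hn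
      rw [Finset.mem_image]
      constructor
      · exact fun h => ⟨_, h, hgf n hn⟩
      · rintro ⟨m, hm, rfl⟩
        rwa [hfg m (hA hm)]
    rw [key _ _ _ _ hiff, key _ _ _ _ fun n hn => not_congr (hiff n hn)]

theorem comulWord_append {u v : List Letter} (hu : Valid u) (hv : Valid v)
    (h : ∀ n ∈ tails u, n ∉ tails v) :
    comulWord K (u ++ v) = comulWord K u * comulWord K v := by
  have key : ∀ p : ℕ → Prop, ∀ _ : DecidablePred p,
      mk K (restrict p (u ++ v)) = mk K (restrict p u) * mk K (restrict p v) := by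
    intro p _
    rw [restrict_append, mk_mul K (hu.restrict p) (hv.restrict p)]
    intro n hn hn'
    rw [tails_restrict] at hn hn'
    exact h n (List.mem_of_mem_filter hn) (List.mem_of_mem_filter hn')
  rw [comulWord, comulWord, comulWord, Finset.sum_mul_sum, ← Finset.sum_product']
  refine Finset.sum_nbij' (fun C => (C ∩ (tails u).toFinset, C ∩ (tails v).toFinset))
    (fun C => C.1 ∪ C.2) ?_ ?_ ?_ ?_ ?_
  · intro C _
    simp
  · intro C hC
    simp only [Finset.mem_product, Finset.mem_powerset] at hC
    simp only [tails_append, List.toFinset_append, Finset.mem_powerset]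
    exact Finset.union_subset_union hC.1 hC.2
  · intro C hC
    simp only [tails_append, List.toFinset_append, Finset.mem_powerset] at hC
    simp only [← Finset.inter_union_distrib_left]
    exact Finset.inter_eq_left.2 hC
  · rintro ⟨A, B⟩ hC
    simp only [Finset.mem_product, Finset.mem_powerset, Finset.subset_iff,
      List.mem_toFinset] at hC
    ext n <;> simp only [Finset.mem_inter, Finset.mem_union, List.mem_toFinset] <;>
      have := h n <;> have := @hC.1 n <;> have := @hC.2 n <;> tauto
  · intro C _
    have e1 : ∀ a ∈ u, a.name ∈ C ↔ a.name ∈ C ∩ (tails u).toFinset := fun a ha => by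
      simp [hu.name_mem ha]
    have e2 : ∀ a ∈ v, a.name ∈ C ↔ a.name ∈ C ∩ (tails v).toFinset := fun a ha => by
      simp [hv.name_mem ha]
    rw [key, key, Algebra.TensorProduct.tmul_mul_tmul, restrict_congr e1, restrict_congr e2,
      restrict_congr (p := fun n => n ∉ C) (q := fun n => n ∉ C ∩ (tails u).toFinset)
        fun a ha => not_congr (e1 a ha),
      restrict_congr (p := fun n => n ∉ C) (q := fun n => n ∉ C ∩ (tails v).toFinset)
        fun a ha => not_congr (e2 a ha)]

theorem comulWord_nil : comulWord K [] = 1 := by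
  simp [comulWord, restrict, mk_nil, Algebra.TensorProduct.one_def]

/-- The coproduct of an arrow diagram. -/
noncomputable def comulDiagram : ArrowDiagram →* Aw K ⊗[K] Aw K where
  toFun := Quotient.lift (fun u => comulWord K u.1)
    fun u _ h => (comulWord_renamed K u.2 h).symm
  map_one' := comulWord_nil K
  map_mul' a b := by
    refine Quotient.inductionOn₂ a b fun u v => ?_
    change comulWord K (ArrowDiagram.juxtapose u.1 v.1) = comulWord K u.1 * comulWord K v.1
    have hu := u.2.rename (f := fun n => 2 * n) (by intros; omega)
    have hv := v.2.rename (f := fun n => 2 * n + 1) (by intros; omega)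
    rw [ArrowDiagram.juxtapose, comulWord_append K hu hv]
    · have r1 : Renamed u.1 (rename (fun n => 2 * n) u.1) := by
        refine ⟨fun n => 2 * n, fun n => n / 2, rfl, ?_⟩
        rw [rename_rename]
        exact (rename_eq_self fun a _ => by omega).symm
      have r2 : Renamed v.1 (rename (fun n => 2 * n + 1) v.1) := by
        refine ⟨fun n => 2 * n + 1, fun n => n / 2, rfl, ?_⟩
        rw [rename_rename]
        exact (rename_eq_self fun a _ => by omega).symm
      rw [comulWord_renamed K u.2 r1, comulWord_renamed K v.2 r2]
    · intro n hn hn'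
      simp only [tails_rename, List.mem_map] at hn hn'
      obtain ⟨a, -, ha⟩ := hn
      obtain ⟨b, -, hb⟩ := hn'
      omega

noncomputable def comulDv : Dv K →ₐ[K] Aw K ⊗[K] Aw K :=
  MonoidAlgebra.lift K _ ArrowDiagram (comulDiagram K)

theorem comulDv_dia {w : List Letter} (h : Valid w) : comulDv K (dia K w) = comulWord K w := by
  rw [dia, dif_pos h, comulDv, MonoidAlgebra.lift_of]
  rfl

end Aw

theorem place_perm (S : Fin 4 → List Letter) (σ : Equiv.Perm (Fin 3)) (a b c a' b' c' : List Letter)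
    (h : (a ++ b ++ c).Perm (a' ++ b' ++ c')) :
    (place S σ ![a, b, c]).Perm (place S σ ![a', b', c']) := by
  have key : ∀ d : Fin 3 → List Letter, ((place S σ d : List Letter) : Multiset Letter) =
      ((S 0 : Multiset Letter) + S 1 + S 2 + S 3) + ((d 0 : Multiset Letter) + d 1 + d 2) := by
    intro d
    have e := Equiv.sum_comp σ fun i => (d i : Multiset Letter)
    rw [Fin.sum_univ_three, Fin.sum_univ_three] at e
    rw [← e]
    simp only [place, ← Multiset.coe_add]
    abel
  have h' : (a : Multiset Letter) + b + c = (a' : Multiset Letter) + b' + c' := by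
    simpa only [Multiset.coe_add] using Multiset.coe_eq_coe.2 h
  rw [← Multiset.coe_eq_coe, key, key]
  exact congrArg (fun m => _ + m) h'

theorem perm_four_swap (a b c d : Letter) :
    ([a, b] ++ [c] ++ [d]).Perm ([b, a] ++ [c] ++ [d]) := List.Perm.swap _ _ _

theorem perm_four_mid (a b c d : Letter) :
    ([a, b] ++ [c] ++ [d]).Perm ([a] ++ [c, b] ++ [d]) := (List.Perm.swap _ _ _).cons _

theorem perm_four_last (a b c d : Letter) :
    ([a, b] ++ [c] ++ [d]).Perm ([a] ++ [b] ++ [d, c]) :=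
  ((List.Perm.swap _ _ _).cons _).cons _

theorem restrict_place (p : ℕ → Prop) [DecidablePred p] (S : Fin 4 → List Letter)
    (σ : Equiv.Perm (Fin 3)) (a b c : List Letter) :
    restrict p (place S σ ![a, b, c]) =
      place (fun i => restrict p (S i)) σ ![restrict p a, restrict p b, restrict p c] := by
  have e : ∀ i : Fin 3, restrict p (![a, b, c] i) =
      ![restrict p a, restrict p b, restrict p c] i := by
    intro i; fin_cases i <;> rfl
  simp only [place, restrict_append, e]

namespace Aw

theorem comulWord_sixT {S : Fin 4 → List Letter} {σ : Equiv.Perm (Fin 3)} {p q : ℕ}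
    (h : Valid (place S σ ![[tail p, tail q], [head p], [head q]])) :
    (comulWord K (place S σ ![[tail p, tail q], [head p], [head q]])
      - comulWord K (place S σ ![[tail q, tail p], [head p], [head q]]))
    + (comulWord K (place S σ ![[tail p], [head p, tail q], [head q]])
      - comulWord K (place S σ ![[tail p], [tail q, head p], [head q]]))
    + (comulWord K (place S σ ![[tail p], [tail q], [head p, head q]])
      - comulWord K (place S σ ![[tail p], [tail q], [head q, head p]])) = 0 := by
  have key : ∀ a b c : List Letter, ([tail p, tail q] ++ [head p] ++ [head q]).Perm (a ++ b ++ c) →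
      comulWord K (place S σ ![a, b, c]) =
        ∑ A ∈ (tails (place S σ ![[tail p, tail q], [head p], [head q]])).toFinset.powerset,
          mk K (place (fun i => restrict (fun n => n ∈ A) (S i)) σ
            ![restrict (fun n => n ∈ A) a, restrict (fun n => n ∈ A) b,
              restrict (fun n => n ∈ A) c]) ⊗ₜ[K]
          mk K (place (fun i => restrict (fun n => n ∉ A) (S i)) σ
            ![restrict (fun n => n ∉ A) a, restrict (fun n => n ∉ A) b,
              restrict (fun n => n ∉ A) c]) := by
    intro a b c hp
    rw [comulWord, List.toFinset_eq_of_perm _ _ (tails_perm (place_perm S σ _ _ _ _ _ _ hp))]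
    simp only [restrict_place]
  rw [key _ _ _ (List.Perm.refl _), key _ _ _ (perm_four_swap _ _ _ _),
    key _ _ _ (perm_four_mid _ _ _ _), key [tail p] [tail q, head p] [head q] (List.Perm.refl _),
    key [tail p] [tail q] [head p, head q] (List.Perm.refl _), key _ _ _ (perm_four_last _ _ _ _)]
  rw [← Finset.sum_sub_distrib, ← Finset.sum_sub_distrib, ← Finset.sum_sub_distrib,
    ← Finset.sum_add_distrib, ← Finset.sum_add_distrib]
  refine Finset.sum_eq_zero fun A _ => ?_
  have h1 := h.restrict fun n => n ∈ A
  have h2 := h.restrict fun n => n ∉ A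
  rw [restrict_place] at h1 h2
  by_cases hp : p ∈ A <;> by_cases hq : q ∈ A <;>
    simp [restrict, hp, hq] at h1 h2 ⊢
  · simp only [← TensorProduct.sub_tmul, ← TensorProduct.add_tmul]
    rw [mk_sixT K h1, TensorProduct.zero_tmul]
  · simp only [← TensorProduct.tmul_sub, ← TensorProduct.tmul_add]
    rw [mk_sixT K h2, TensorProduct.tmul_zero]

theorem comulDv_rel {x y : Dv K} (h : Rel K x y) : comulDv K x = comulDv K y := by
  induction h with
  | tc S₁ S₂ p q h =>
    have hP : (S₁ ++ [tail p, tail q] ++ S₂).Perm (S₁ ++ [tail q, tail p] ++ S₂) :=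
      ((List.Perm.swap _ _ _).append_left S₁).append_right S₂
    rw [comulDv_dia K h, comulDv_dia K (h.of_perm hP), comulWord, comulWord,
      List.toFinset_eq_of_perm _ _ (tails_perm hP)]
    refine Finset.sum_congr rfl fun A _ => ?_
    have h1 := h.restrict fun n => n ∈ A
    have h2 := h.restrict fun n => n ∉ A
    by_cases hp : p ∈ A <;> by_cases hq : q ∈ A <;>
      simp [restrict, hp, hq] at h1 h2 ⊢
    · rw [mk_tc' K h1]
    · rw [mk_tc' K h2]
  | sixT S σ p q h =>
    simp only [map_add, map_sub, map_zero]
    rw [comulDv_dia, comulDv_dia, comulDv_dia, comulDv_dia, comulDv_dia, comulDv_dia]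
    · exact comulWord_sixT K h
    · exact h.of_perm (place_perm S σ _ _ _ _ _ _ (perm_four_last _ _ _ _))
    · exact h.of_perm (place_perm S σ [tail p, tail q] [head p] [head q] [tail p] [tail q] [head p, head q]
        (List.Perm.refl _))
    · exact h.of_perm (place_perm S σ [tail p, tail q] [head p] [head q] [tail p] [tail q, head p] [head q]
        (List.Perm.refl _))
    · exact h.of_perm (place_perm S σ _ _ _ _ _ _ (perm_four_mid _ _ _ _))
    · exact h.of_perm (place_perm S σ _ _ _ _ _ _ (perm_four_swap _ _ _ _))
    · exact h

/-- The coproduct, as an algebra homomorphism. -/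
noncomputable def comulHom : Aw K →ₐ[K] Aw K ⊗[K] Aw K :=
  RingQuot.liftAlgHom K ⟨comulDv K, fun _ _ h => comulDv_rel K h⟩

theorem comulHom_proj (x : Dv K) : comulHom K (proj K x) = comulDv K x :=
  RingQuot.liftAlgHom_mkAlgHom_apply K _ _ _

theorem comulHom_mk {w : List Letter} (h : Valid w) : comulHom K (mk K w) = comulWord K w := by
  rw [mk, comulHom_proj, comulDv_dia K h]

/-! ### The counit -/

/-- The counit sends the diagram without arrows to `1` and all the others to `0`. -/
noncomputable def counitDiagram : ArrowDiagram →* K where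
  toFun := Quotient.lift (fun u => if u.1 = [] then (1 : K) else 0) (by
    rintro u v ⟨f, g, h1, h2⟩
    have e : u.1 = [] ↔ v.1 = [] := by
      rw [h1, rename, List.map_eq_nil_iff]
    simp only [e])
  map_one' := if_pos rfl
  map_mul' a b := by
    refine Quotient.inductionOn₂ a b fun u v => ?_
    change (if ArrowDiagram.juxtapose u.1 v.1 = [] then (1 : K) else 0) =
      (if u.1 = [] then (1 : K) else 0) * (if v.1 = [] then (1 : K) else 0)
    by_cases h1 : u.1 = [] <;> by_cases h2 : v.1 = [] <;>
      simp [ArrowDiagram.juxtapose, rename, h1, h2]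

noncomputable def counitDv : Dv K →ₐ[K] K :=
  MonoidAlgebra.lift K _ ArrowDiagram (counitDiagram K)

theorem counitDv_dia {w : List Letter} (h : w ≠ []) : counitDv K (dia K w) = 0 := by
  by_cases hw : Valid w
  · rw [dia, dif_pos hw, counitDv, MonoidAlgebra.lift_of]
    exact if_neg h
  · rw [dia, dif_neg hw, map_zero]

theorem counitDv_rel {x y : Dv K} (h : Rel K x y) : counitDv K x = counitDv K y := by
  induction h with
  | tc S₁ S₂ p q h => rw [counitDv_dia, counitDv_dia] <;> simp
  | sixT S σ p q h =>
    have key : ∀ a b c : List Letter, ([tail p, tail q] ++ [head p] ++ [head q]).Perm (a ++ b ++ c) →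
        counitDv K (dia K (place S σ ![a, b, c])) = 0 := by
      intro a b c hp
      refine counitDv_dia K fun h0 => ?_
      have h2 := (place_perm S σ _ _ _ _ _ _ hp)
      rw [h0] at h2
      have h3 := h2.eq_nil
      have h5 : ∀ i, ![[tail p, tail q], [head p], [head q]] (σ i) = [] := by
        simp only [place, List.append_eq_nil_iff] at h3
        intro i
        fin_cases i <;> simp_all
      have h6 := h5 (σ.symm 0)
      simp at h6
    simp only [map_add, map_sub, map_zero]
    rw [key [tail p, tail q] [head p] [head q] (List.Perm.refl _),
      key _ _ _ (perm_four_swap _ _ _ _), key _ _ _ (perm_four_mid _ _ _ _),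
      key [tail p] [tail q, head p] [head q] (List.Perm.refl _),
      key [tail p] [tail q] [head p, head q] (List.Perm.refl _),
      key _ _ _ (perm_four_last _ _ _ _)]
    simp

/-- The counit, as an algebra homomorphism. -/
noncomputable def counitHom : Aw K →ₐ[K] K :=
  RingQuot.liftAlgHom K ⟨counitDv K, fun _ _ h => counitDv_rel K h⟩

theorem counitHom_proj (x : Dv K) : counitHom K (proj K x) = counitDv K x :=
  RingQuot.liftAlgHom_mkAlgHom_apply K _ _ _

theorem counitHom_mk {w : List Letter} (h : Valid w) :
    counitHom K (mk K w) = if w = [] then 1 else 0 := by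
  rw [mk, counitHom_proj, dia, dif_pos h, counitDv, MonoidAlgebra.lift_of]
  rfl

/-! ### The bialgebra -/

theorem algHom_ext {B : Type*} [Semiring B] [Algebra K B] {f g : Aw K →ₐ[K] B}
    (h : ∀ w, Valid w → f (mk K w) = g (mk K w)) : f = g := by
  have e : f.comp (proj K) = g.comp (proj K) := by
    refine MonoidAlgebra.algHom_ext (fun D => ?_) (by ext)
    induction D using ArrowDiagram.ind with | h w hw => ?_
    have := h w hw
    rwa [mk_of_valid K hw] at this
  exact RingQuot.ringQuot_ext' K _ _ e

theorem restrict_eq_nil {w : List Letter} (h : Valid w) (p : ℕ → Prop) [DecidablePred p] :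
    restrict p w = [] ↔ ∀ n ∈ tails w, ¬ p n := by
  constructor
  · intro h0 n hn hp
    have : n ∈ tails (restrict p w) := by
      rw [tails_restrict]; exact List.mem_filter.2 ⟨hn, by simpa using hp⟩
    rw [h0] at this
    simp at this
  · intro h0
    refine List.filter_eq_nil_iff.2 fun a ha => ?_
    simpa using h0 _ (h.name_mem ha)

theorem restrict_eq_self {w : List Letter} (h : Valid w) (p : ℕ → Prop) [DecidablePred p]
    (hp : ∀ n ∈ tails w, p n) : restrict p w = w := by
  refine List.filter_eq_self.2 fun a ha => ?_
  simpa using hp _ (h.name_mem ha)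

theorem comul_counit_left {w : List Letter} (h : Valid w) :
    Algebra.TensorProduct.map (counitHom K) (AlgHom.id K (Aw K)) (comulWord K w) =
      1 ⊗ₜ[K] mk K w := by
  rw [comulWord, map_sum, Finset.sum_eq_single ∅]
  · rw [Algebra.TensorProduct.map_tmul, counitHom_mk K (h.restrict _),
      if_pos ((restrict_eq_nil h _).2 (by simp)), restrict_eq_self h _ (by simp)]
    rfl
  · intro A hA hA'
    obtain ⟨n, hn⟩ := Finset.nonempty_iff_ne_empty.2 hA'
    rw [Algebra.TensorProduct.map_tmul, counitHom_mk K (h.restrict _), if_neg,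
      TensorProduct.zero_tmul]
    rw [restrict_eq_nil h]
    intro h0
    exact h0 n (by simpa using Finset.mem_powerset.1 hA hn) hn
  · intro h0
    simp at h0

theorem comul_counit_right {w : List Letter} (h : Valid w) :
    Algebra.TensorProduct.map (AlgHom.id K (Aw K)) (counitHom K) (comulWord K w) =
      mk K w ⊗ₜ[K] 1 := by
  rw [comulWord, map_sum, Finset.sum_eq_single (tails w).toFinset]
  · rw [Algebra.TensorProduct.map_tmul, counitHom_mk K (h.restrict _),
      if_pos ((restrict_eq_nil h _).2 (by simp)), restrict_eq_self h _ (by simp)]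
    rfl
  · intro A hA hA'
    have hA := Finset.mem_powerset.1 hA
    rw [Algebra.TensorProduct.map_tmul, counitHom_mk K (h.restrict _), if_neg,
      TensorProduct.tmul_zero]
    rw [restrict_eq_nil h]
    intro h0
    refine hA' (Finset.Subset.antisymm hA fun n hn => ?_)
    simpa using h0 n (by simpa using hn)
  · intro h0
    simp at h0

theorem comul_coassoc {w : List Letter} (h : Valid w) :
    Algebra.TensorProduct.assoc K K K (Aw K) (Aw K) (Aw K)
      (Algebra.TensorProduct.map (comulHom K) (AlgHom.id K (Aw K)) (comulWord K w)) =
    Algebra.TensorProduct.map (AlgHom.id K (Aw K)) (comulHom K) (comulWord K w) := by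
  have hT : ∀ (p : ℕ → Prop) (_ : DecidablePred p) n,
      n ∈ (tails (restrict p w)).toFinset ↔ n ∈ tails w ∧ p n := by
    intro p _ n
    rw [tails_restrict]
    simp
  have hl : ∀ A ∈ (tails w).toFinset.powerset,
      Algebra.TensorProduct.assoc K K K (Aw K) (Aw K) (Aw K)
        (Algebra.TensorProduct.map (comulHom K) (AlgHom.id K (Aw K))
          (mk K (restrict (fun n => n ∈ A) w) ⊗ₜ[K] mk K (restrict (fun n => n ∉ A) w))) =
      ∑ B ∈ (tails (restrict (fun n => n ∈ A) w)).toFinset.powerset,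
        mk K (restrict (fun n => n ∈ B ∧ n ∈ A) w) ⊗ₜ[K]
          (mk K (restrict (fun n => n ∉ B ∧ n ∈ A) w) ⊗ₜ[K]
            mk K (restrict (fun n => n ∉ A) w)) := by
    intro A _
    rw [Algebra.TensorProduct.map_tmul, comulHom_mk K (h.restrict _), comulWord,
      TensorProduct.sum_tmul, map_sum]
    refine Finset.sum_congr rfl fun B _ => ?_
    rw [restrict_restrict, restrict_restrict]
    rfl
  have hr : ∀ A ∈ (tails w).toFinset.powerset,
      Algebra.TensorProduct.map (AlgHom.id K (Aw K)) (comulHom K)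
          (mk K (restrict (fun n => n ∈ A) w) ⊗ₜ[K] mk K (restrict (fun n => n ∉ A) w)) =
      ∑ B ∈ (tails (restrict (fun n => n ∉ A) w)).toFinset.powerset,
        mk K (restrict (fun n => n ∈ A) w) ⊗ₜ[K]
          (mk K (restrict (fun n => n ∈ B ∧ n ∉ A) w) ⊗ₜ[K]
            mk K (restrict (fun n => n ∉ B ∧ n ∉ A) w)) := by
    intro A _
    rw [Algebra.TensorProduct.map_tmul, comulHom_mk K (h.restrict _), comulWord,
      TensorProduct.tmul_sum]
    refine Finset.sum_congr rfl fun B _ => ?_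
    rw [restrict_restrict, restrict_restrict]
    rfl
  rw [comulWord, map_sum, map_sum, map_sum, Finset.sum_congr rfl hl, Finset.sum_congr rfl hr,
    Finset.sum_sigma', Finset.sum_sigma']
  refine Finset.sum_nbij' (fun C => ⟨C.2, C.1 \ C.2⟩) (fun C => ⟨C.1 ∪ C.2, C.1⟩) ?_ ?_ ?_ ?_ ?_
  · rintro ⟨A, B⟩ hC
    simp only [Finset.mem_sigma, Finset.mem_powerset, Finset.subset_iff, hT, List.mem_toFinset,
      Finset.mem_sdiff] at hC ⊢
    exact ⟨fun n hn => (hC.2 hn).1, fun n hn => ⟨hC.1 hn.1, hn.2⟩⟩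
  · rintro ⟨A, B⟩ hC
    simp only [Finset.mem_sigma, Finset.mem_powerset, Finset.subset_iff, hT, List.mem_toFinset,
      Finset.mem_union] at hC ⊢
    exact ⟨fun n hn => hn.elim (fun h => hC.1 h) fun h => (hC.2 h).1,
      fun n hn => ⟨hC.1 hn, Or.inl hn⟩⟩
  · rintro ⟨A, B⟩ hC
    simp only [Finset.mem_sigma, Finset.mem_powerset, Finset.subset_iff, hT,
      List.mem_toFinset] at hC
    have e : B ∪ A \ B = A := by
      rw [Finset.union_sdiff_of_subset fun n hn => (hC.2 hn).2]
    simp only [e]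
  · rintro ⟨A, B⟩ hC
    simp only [Finset.mem_sigma, Finset.mem_powerset, Finset.subset_iff, hT,
      List.mem_toFinset] at hC
    have e : (A ∪ B) \ A = B := by
      ext n
      have := @hC.2 n
      simp only [Finset.mem_sdiff, Finset.mem_union]
      tauto
    simp only [e]
  · rintro ⟨A, B⟩ hC
    simp only [Finset.mem_sigma, Finset.mem_powerset, Finset.subset_iff, hT,
      List.mem_toFinset] at hC
    have hBA := fun n => @hC.2 n
    dsimp only
    rw [restrict_congr (p := fun n => n ∈ B ∧ n ∈ A) (q := fun n => n ∈ B)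
        fun a _ => ⟨fun h => h.1, fun h => ⟨h, (hBA _ h).2⟩⟩,
      restrict_congr (p := fun n => n ∉ B ∧ n ∈ A) (q := fun n => n ∈ A \ B ∧ n ∉ B)
        fun a _ => by simp only [Finset.mem_sdiff]; tauto,
      restrict_congr (p := fun n => n ∉ A) (q := fun n => n ∉ A \ B ∧ n ∉ B)
        fun a _ => by simp only [Finset.mem_sdiff]; have := hBA a.name; tauto]

/-- The bialgebra of arrow diagrams modulo 6T and TC. The product is juxtaposition; the coproduct
of a diagram is the sum of all ways of dividing its arrows between the two cofactors. -/
noncomputable instance : Bialgebra K (Aw K) :=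
  Bialgebra.ofAlgHom (comulHom K) (counitHom K)
    (algHom_ext K fun w hw => by
      simp only [AlgHom.comp_apply, comulHom_mk K hw]
      exact comul_coassoc K hw)
    (algHom_ext K fun w hw => by
      simp only [AlgHom.comp_apply, comulHom_mk K hw]
      exact comul_counit_left K hw)
    (algHom_ext K fun w hw => by
      simp only [AlgHom.comp_apply, comulHom_mk K hw]
      exact comul_counit_right K hw)

theorem comul_mk {w : List Letter} (h : Valid w) :
    Coalgebra.comul (R := K) (mk K w) = comulWord K w := comulHom_mk K h

end Aw

end Aw

/-! ### w-Jacobi diagrams -/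

/-- An internal vertex: two arrows end in it, the left one and the right one, and one begins. The
three fields are the names of these arrows. -/
structure Vertex : Type where
  left : ℕ
  right : ℕ
  out : ℕ

def Vertex.map (f : ℕ → ℕ) (v : Vertex) : Vertex := ⟨f v.left, f v.right, f v.out⟩

/-- The skeleton, as the list of its vertices in order, and the internal vertices. -/
structure JWord : Type where
  skel : List Letter
  verts : Multiset Vertex

namespace JWord

/-- The names of the arrows, listed at the places where arrows begin. -/
def starts (D : JWord) : Multiset ℕ := (tails D.skel : Multiset ℕ) + D.verts.map Vertex.out

/-- The names of the arrows, listed at the places where arrows end. -/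
def ends (D : JWord) : Multiset ℕ :=
  (heads D.skel : Multiset ℕ) + D.verts.map Vertex.left + D.verts.map Vertex.right

/-- Each name that occurs begins at exactly one place and ends at exactly one place. -/
def Valid (D : JWord) : Prop := D.starts.Nodup ∧ D.starts = D.ends

/-- In a diagram every internal vertex is connected to the skeleton, so that connectedness need
not be required: a set of internal vertices all of whose incoming arrows come from the set itself
is empty. -/
theorem Valid.connected {D : JWord} (h : D.Valid) {T : Multiset Vertex} (hT : T ≤ D.verts)
    (hl : ∀ v ∈ T, ∃ v' ∈ T, v'.out = v.left) (hr : ∀ v ∈ T, ∃ v' ∈ T, v'.out = v.right) :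
    T = 0 := by
  have hn : (T.map Vertex.left + T.map Vertex.right).Nodup := by
    have h1 : D.ends.Nodup := h.2 ▸ h.1
    refine Multiset.nodup_of_le ?_ h1
    rw [ends, add_assoc]
    exact (add_le_add (Multiset.map_le_map hT) (Multiset.map_le_map hT)).trans
      (Multiset.le_add_left _ _)
  have hle : T.map Vertex.left + T.map Vertex.right ≤ T.map Vertex.out := by
    refine (Multiset.le_iff_subset hn).2 fun n hn => ?_
    rw [Multiset.mem_add, Multiset.mem_map, Multiset.mem_map] at hn
    rcases hn with ⟨v, hv, rfl⟩ | ⟨v, hv, rfl⟩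
    · exact Multiset.mem_map.2 (hl v hv)
    · exact Multiset.mem_map.2 (hr v hv)
  have hc := Multiset.card_le_card hle
  simp only [Multiset.card_add, Multiset.card_map] at hc
  exact Multiset.card_eq_zero.1 (by omega)

def rename (f : ℕ → ℕ) (D : JWord) : JWord := ⟨WKnot.rename f D.skel, D.verts.map (Vertex.map f)⟩

theorem rename_rename (f g : ℕ → ℕ) (D : JWord) :
    (D.rename g).rename f = D.rename fun n => f (g n) := by
  simp only [rename, WKnot.rename_rename, Multiset.map_map]
  rfl

theorem rename_id (D : JWord) : D.rename (fun n => n) = D := by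
  have e : (Vertex.map fun n => n) = id := rfl
  simp only [rename, WKnot.rename_id, e, Multiset.map_id]

end JWord

/-- Words that describe w-Jacobi diagrams. -/
def JacobiWord : Type := {D : JWord // D.Valid}

/-- Two words describe the same diagram if they differ by a renaming of the arrows that is
injective on the names in use. -/
instance JacobiWord.setoid : Setoid JacobiWord where
  r D E := ∃ f g : ℕ → ℕ, E.1 = D.1.rename f ∧ D.1 = E.1.rename g
  iseqv :=
    { refl := fun D => ⟨fun n => n, fun n => n, (JWord.rename_id _).symm, (JWord.rename_id _).symm⟩
      symm := fun ⟨f, g, h1, h2⟩ => ⟨g, f, h2, h1⟩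
      trans := by
        rintro D E F ⟨f, g, h1, h2⟩ ⟨f', g', h3, h4⟩
        exact ⟨fun n => f' (f n), fun n => g (g' n), by rw [← JWord.rename_rename, ← h1, h3],
          by rw [← JWord.rename_rename, ← h4, h2]⟩ }

/-- w-Jacobi diagrams on a long line skeleton. -/
def JacobiDiagram : Type := Quotient JacobiWord.setoid

theorem Valid.toJWord {w : List Letter} (h : Valid w) : JWord.Valid ⟨w, 0⟩ := by
  refine ⟨?_, ?_⟩
  · simpa [JWord.starts] using h.1
  · simpa [JWord.starts, JWord.ends] using h.2

/-- An arrow diagram is a w-Jacobi diagram without internal vertices. -/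
def ArrowDiagram.toJacobi : ArrowDiagram → JacobiDiagram :=
  Quotient.map (fun u => ⟨⟨u.1, 0⟩, u.2.toJWord⟩) (by
    rintro u v ⟨f, g, h1, h2⟩
    refine ⟨f, g, ?_, ?_⟩
    · simp only [JWord.rename, Multiset.map_zero, ← h1]
    · simp only [JWord.rename, Multiset.map_zero, ← h2])

/-- The `k`-wheel: a directed cycle of `k` arrows (named `2 i + 1`), whose internal vertices
receive `k` spokes (named `2 i`) from the skeleton. At each internal vertex the spoke is the left
and the arrow of the cycle is the right incoming arrow. -/
def wheelWord (k : ℕ) : JWord :=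
  ⟨(List.range k).map fun i => tail (2 * i),
    ((List.range k).map fun i => (⟨2 * i, 2 * i + 1, 2 * ((i + 1) % k) + 1⟩ : Vertex) :)⟩

theorem wheelWord_valid (k : ℕ) : (wheelWord k).Valid := by
  have ht : tails (wheelWord k).skel = (List.range k).map fun i => 2 * i := by
    simp only [wheelWord, tails, List.filterMap_map]
    exact congrFun (List.filterMap_eq_map (f := fun i => 2 * i)) _
  have hh : heads (wheelWord k).skel = [] := by
    simp only [wheelWord, heads, List.filterMap_map]
    exact List.filterMap_eq_nil_iff.2 fun _ _ => rfl
  have hperm : ((List.range k).map fun i => (i + 1) % k).Perm (List.range k) := by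
    refine (List.perm_ext_iff_of_nodup ?_ List.nodup_range).2 fun n => ?_
    · refine List.Nodup.map_on (fun i hi j hj hij => ?_) List.nodup_range
      rw [List.mem_range] at hi hj
      have h := Nat.ModEq.add_right_cancel' 1 (show i + 1 ≡ j + 1 [MOD k] from hij)
      rwa [Nat.ModEq, Nat.mod_eq_of_lt hi, Nat.mod_eq_of_lt hj] at h
    · simp only [List.mem_map, List.mem_range]
      constructor
      · rintro ⟨i, hi, rfl⟩
        exact Nat.mod_lt _ (by omega)
      · intro hn
        rcases Nat.eq_zero_or_pos n with rfl | h0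
        · exact ⟨k - 1, by omega, by rw [Nat.sub_add_cancel (by omega), Nat.mod_self]⟩
        · exact ⟨n - 1, by omega, by rw [Nat.sub_add_cancel h0, Nat.mod_eq_of_lt hn]⟩
  have hout : ((List.range k).map fun i => 2 * ((i + 1) % k) + 1).Perm
      ((List.range k).map fun i => 2 * i + 1) := by
    simpa only [List.map_map, Function.comp_def] using hperm.map fun i => 2 * i + 1
  have hs : (wheelWord k).starts =
      (((List.range k).map fun i => 2 * i : List ℕ) : Multiset ℕ) +
        ((List.range k).map fun i => 2 * i + 1 : List ℕ) := by
    rw [JWord.starts, ht, ← Multiset.coe_eq_coe.2 hout]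
    simp only [wheelWord, Multiset.map_coe, List.map_map, Function.comp_def]
  refine ⟨?_, ?_⟩
  · rw [hs, Multiset.coe_add, Multiset.coe_nodup, List.nodup_append]
    refine ⟨List.nodup_range.map fun i j h => ?_, List.nodup_range.map fun i j h => ?_, ?_⟩
    · omega
    · omega
    · intro a ha b hb
      simp only [List.mem_map] at ha hb
      omega
  · rw [hs, JWord.ends, hh]
    simp only [wheelWord, Multiset.map_coe, List.map_map, Function.comp_def,
      Multiset.coe_nil, zero_add]

namespace JacobiDiagram

def mk (D : JWord) (h : D.Valid) : JacobiDiagram := Quotient.mk _ ⟨D, h⟩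

/-- The `k`-wheel. -/
def wheel (k : ℕ+) : JacobiDiagram := mk (wheelWord k) (wheelWord_valid k)

end JacobiDiagram

section Awt

variable (K : Type u) [Field K]

/-- Formal linear combinations of w-Jacobi diagrams. -/
abbrev Dwt : Type u := JacobiDiagram →₀ K

open Classical in
/-- The w-Jacobi diagram described by a word (and `0` if the word describes none). -/
noncomputable def jdia (D : JWord) : Dwt K :=
  if h : D.Valid then Finsupp.single (JacobiDiagram.mk D h) 1 else 0

/-- The elements of `Dwt` that are set to zero: the STU relations and Tails Commute. In an STU
relation an arrow joining the skeleton to an internal vertex `v` is shrunk, and the two other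
arrows at `v` are attached to the skeleton, in both orders; in `stu₁` it is the outgoing arrow
of `v`, in `stu₂` its right, in `stu₂'` its left incoming arrow. These are the relations
`[x_a, x_b] = x_a x_b - x_b x_a` and `[φ_c, x_a] = φ_c x_a - x_a φ_c`, where heads on the skeleton
stand for `x` and tails for `φ`; exchanging left and right at `v` changes the sign. -/
inductive JRel : Dwt K → Prop
  | stu₁ (S₁ S₂ : List Letter) (V : Multiset Vertex) (a b c : ℕ)
      (h : JWord.Valid ⟨S₁ ++ [head c] ++ S₂, ⟨a, b, c⟩ ::ₘ V⟩) :
      JRel (jdia K ⟨S₁ ++ [head c] ++ S₂, ⟨a, b, c⟩ ::ₘ V⟩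
        - (jdia K ⟨S₁ ++ [head a, head b] ++ S₂, V⟩
          - jdia K ⟨S₁ ++ [head b, head a] ++ S₂, V⟩))
  | stu₂ (S₁ S₂ : List Letter) (V : Multiset Vertex) (a b c : ℕ)
      (h : JWord.Valid ⟨S₁ ++ [tail b] ++ S₂, ⟨a, b, c⟩ ::ₘ V⟩) :
      JRel (jdia K ⟨S₁ ++ [tail b] ++ S₂, ⟨a, b, c⟩ ::ₘ V⟩
        - (jdia K ⟨S₁ ++ [tail c, head a] ++ S₂, V⟩
          - jdia K ⟨S₁ ++ [head a, tail c] ++ S₂, V⟩))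
  | stu₂' (S₁ S₂ : List Letter) (V : Multiset Vertex) (a b c : ℕ)
      (h : JWord.Valid ⟨S₁ ++ [tail a] ++ S₂, ⟨a, b, c⟩ ::ₘ V⟩) :
      JRel (jdia K ⟨S₁ ++ [tail a] ++ S₂, ⟨a, b, c⟩ ::ₘ V⟩
        - (jdia K ⟨S₁ ++ [head b, tail c] ++ S₂, V⟩
          - jdia K ⟨S₁ ++ [tail c, head b] ++ S₂, V⟩))
  | tc (S₁ S₂ : List Letter) (V : Multiset Vertex) (p q : ℕ)
      (h : JWord.Valid ⟨S₁ ++ [tail p, tail q] ++ S₂, V⟩) :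
      JRel (jdia K ⟨S₁ ++ [tail p, tail q] ++ S₂, V⟩
        - jdia K ⟨S₁ ++ [tail q, tail p] ++ S₂, V⟩)

/-- w-Jacobi diagrams modulo STU and TC. -/
abbrev Awt : Type u := Dwt K ⧸ Submodule.span K {x | JRel K x}

/-- The class of a w-Jacobi diagram. -/
noncomputable def Awt.of (D : JacobiDiagram) : Awt K :=
  Submodule.Quotient.mk (Finsupp.single D 1)

end Awt

/-! ### The bialgebra of polynomials in `D_L`, `D_R` and the wheels -/

/-- The generators: `D_L`, `D_R`, and `w k` for `k ≥ 1`. -/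
inductive Gen : Type
  | dL : Gen
  | dR : Gen
  | w : ℕ+ → Gen

/-- `deg D_L = deg D_R = 1` and `deg w_k = k`. -/
def Gen.deg : Gen → ℕ
  | dL => 1
  | dR => 1
  | w k => k

section Poly

variable (K : Type u) [Field K]

open MvPolynomial

/-- The ideal generated by the one relation `w_1 = D_L - D_R`. -/
noncomputable def relIdeal : Ideal (MvPolynomial Gen K) :=
  Ideal.span {X (Gen.w 1) - (X Gen.dL - X Gen.dR)}

/-- Polynomials in `D_L`, `D_R` and `w_k` (`k ≥ 1`), subject to the one relation
`w_1 = D_L - D_R`. -/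
def WheelPoly : Type u := MvPolynomial Gen K ⧸ relIdeal K

namespace WheelPoly

noncomputable instance : CommRing (WheelPoly K) :=
  inferInstanceAs (CommRing (MvPolynomial Gen K ⧸ relIdeal K))
noncomputable instance : Algebra K (WheelPoly K) :=
  inferInstanceAs (Algebra K (MvPolynomial Gen K ⧸ relIdeal K))

noncomputable def proj : MvPolynomial Gen K →ₐ[K] WheelPoly K := Ideal.Quotient.mkₐ K (relIdeal K)

/-- The generators. -/
noncomputable def gen (g : Gen) : WheelPoly K := proj K (X g)

/-- The degree `n` part, for the degrees `Gen.deg` of the generators. -/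
noncomputable def grade (n : ℕ) : Submodule K (WheelPoly K) :=
  (weightedHomogeneousSubmodule K Gen.deg n).map (proj K).toLinearMap

theorem gen_w_one : gen K (Gen.w 1) = gen K Gen.dL - gen K Gen.dR := by
  rw [← sub_eq_zero, gen, gen, gen, ← map_sub, ← map_sub]
  exact Ideal.Quotient.eq_zero_iff_mem.2 (Ideal.subset_span rfl)

theorem algHom_ext {B : Type*} [Semiring B] [Algebra K B] {f g : WheelPoly K →ₐ[K] B}
    (h : ∀ x, f (gen K x) = g (gen K x)) : f = g := by
  have e : f.comp (proj K) = g.comp (proj K) := MvPolynomial.algHom_ext h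
  exact Ideal.Quotient.algHom_ext K e

/-- An algebra homomorphism from the values of the generators. -/
noncomputable def lift {B : Type*} [CommRing B] [Algebra K B] (v : Gen → B)
    (hv : v (Gen.w 1) = v Gen.dL - v Gen.dR) : WheelPoly K →ₐ[K] B :=
  Ideal.Quotient.liftₐ (relIdeal K) (aeval v) (by
    have h : relIdeal K ≤ RingHom.ker (aeval (R := K) v) := by
      rw [relIdeal, Ideal.span_le, Set.singleton_subset_iff]
      simp [RingHom.mem_ker, hv]
    exact fun a ha => h ha)

theorem lift_gen {B : Type*} [CommRing B] [Algebra K B] (v : Gen → B)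
    (hv : v (Gen.w 1) = v Gen.dL - v Gen.dR) (g : Gen) : lift K v hv (gen K g) = v g := by
  change aeval v (X g) = v g
  rw [aeval_X]

/-- The coproduct for which all the generators are primitive. -/
noncomputable def comulHom : WheelPoly K →ₐ[K] WheelPoly K ⊗[K] WheelPoly K :=
  lift K (fun g => gen K g ⊗ₜ[K] 1 + 1 ⊗ₜ[K] gen K g) (by
    simp only [gen_w_one, TensorProduct.sub_tmul, TensorProduct.tmul_sub]
    abel)

/-- The counit, which vanishes on all the generators. -/
noncomputable def counitHom : WheelPoly K →ₐ[K] K := lift K (fun _ => 0) (by simp)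

theorem comulHom_gen (g : Gen) :
    comulHom K (gen K g) = gen K g ⊗ₜ[K] 1 + 1 ⊗ₜ[K] gen K g := lift_gen K _ _ g

theorem counitHom_gen (g : Gen) : counitHom K (gen K g) = 0 := lift_gen K _ _ g

/-- The bialgebra structure for which all the generators are primitive. -/
noncomputable instance : Bialgebra K (WheelPoly K) :=
  Bialgebra.ofAlgHom (comulHom K) (counitHom K)
    (algHom_ext K fun g => by
      simp [comulHom_gen, Algebra.TensorProduct.one_def, TensorProduct.add_tmul,
        TensorProduct.tmul_add, add_assoc])
    (algHom_ext K fun g => by simp [comulHom_gen, counitHom_gen])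
    (algHom_ext K fun g => by simp [comulHom_gen, counitHom_gen])

end WheelPoly

end Poly

end WKnot

/-!
The algebra of arrow diagrams is handled through the free associative algebra `WordAlg` on the
vertices of the skeleton, which `ev` maps onto it. The proof has three parts.

*Wheels span.* Modulo TC, the relation 6T says that moving the head of `a` across the tail of `c`
costs the commutator of the heads of `a` and `c`, placed where `c` ends (`slides_hd`). The same
holds for an iterated commutator of heads, that is, for a tree of heads, in place of a single head
(`LTree.slides_eval`). Hence the first tree on the skeleton can be surrounded by the tails of its
own leaves, at the cost of diagrams with fewer trees, and what is gathered splits off as a factor: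
the algebra is generated by diagrams with a single tree (`TreeWord.ev_mem_of_single_tree`). A tree
with one leaf is `D_L` or `D_R`. A larger tree vanishes if all its tails stand to the left of it, by
antisymmetry, and carrying a tail across the tree costs a multiple of wheels, as every tree is a sum
of combs (`ev_single_tree_mem`). The wheels and `D_L`, `D_R` are central (`wheelSum_mem_center`,
`mk_dL_mem_center`, `mk_dR_mem_center`) and primitive (a commutator cannot be divided between two
cofactors, `divide_eval_eq_zero`), so that polynomials in these elements make sense, and those of
degree `n` give exactly the combinations of diagrams with `n` arrows (`map_genEval_eq_grade`).

*Arrow diagrams span the w-Jacobi diagrams.* The relation STU implies 6T (`Awt.mk_sixT`), which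
yields the map `toJacobi`. It is surjective, since some internal vertex always receives an arrow
from the skeleton and STU removes this vertex (`Awt.mk_mem_range`). Applied around a wheel, STU gives
the combination `wheelSum` of arrow diagrams (`toJacobi_wheelSum`).

*Independence.* A Lie algebra with structure constants `f`, acting through operators `x`, together
with commuting operators `φ` on which it acts by its coadjoint representation, gives a state sum on
w-Jacobi diagrams that respects STU and TC (`StateModel.stateAwt`). For the semidirect product of a
line with an abelian Lie algebra, on which the line acts by a matrix `M`, acting on polynomials with
a free scalar `t`, the wheel `w_k` has the value `tr (M ^ k)` and `D_R` has the value `t`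
(`lineModel`). Any finite list of traces is attained (`exists_trace_pow_eq`), so a polynomial in
`D_L`, `D_R` and the `w_k` with `k ≥ 2` that vanishes as a combination of diagrams is zero. As the
state sums are defined on w-Jacobi diagrams, this shows at once that the polynomial algebra maps
injectively to arrow diagrams and that `toJacobi` is injective.
-/

open scoped TensorProduct

namespace WKnot

universe u

open Letter

/-! ### The algebra of words -/

section Words

variable (K : Type u) [Field K]

/-- The free associative algebra on the skeleton vertices. A word stands for the part of a skeleton
that carries these vertices. -/
abbrev WordAlg : Type u := MonoidAlgebra K (FreeMonoid Letter)

/-- A word, as an element of the free algebra. -/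
noncomputable def wd (w : List Letter) : WordAlg K :=
  MonoidAlgebra.of K (FreeMonoid Letter) (FreeMonoid.ofList w)

theorem wd_nil : wd K [] = 1 := map_one _

theorem wd_append (u v : List Letter) : wd K (u ++ v) = wd K u * wd K v := by
  rw [wd, FreeMonoid.ofList_append, map_mul, wd, wd]

theorem wd_cons (l : Letter) (v : List Letter) : wd K (l :: v) = wd K [l] * wd K v :=
  wd_append K [l] v

variable {K}

theorem WordAlg.induction {P : WordAlg K → Prop} (hw : ∀ w, P (wd K w))
    (hadd : ∀ x y, P x → P y → P (x + y)) (hsmul : ∀ (r : K) x, P x → P (r • x))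
    (x : WordAlg K) : P x :=
  MonoidAlgebra.induction_on x (fun w => hw w.toList) hadd hsmul

variable {M : Type*} [AddCommGroup M] [Module K M]

/-- The linear map with prescribed values on words. -/
noncomputable def wordLift (f : List Letter → M) : WordAlg K →ₗ[K] M where
  toFun x := x.coeff.sum fun w r => r • f w.toList
  map_add' x y := by
    rw [MonoidAlgebra.coeff_add]
    exact Finsupp.sum_add_index' (by simp) (by simp [add_smul])
  map_smul' r x := by
    rw [MonoidAlgebra.coeff_smul, Finsupp.sum_smul_index' (by simp), Finsupp.smul_sum]
    simp [smul_smul]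

@[simp] theorem wordLift_wd (f : List Letter → M) (w : List Letter) :
    wordLift f (wd K w) = f w := by
  change (Finsupp.single (FreeMonoid.ofList w) (1 : K)).sum
    (fun w r => r • f (FreeMonoid.toList w)) = _
  rw [Finsupp.sum_single_index (by simp), one_smul, FreeMonoid.toList_ofList]

/-- The algebra homomorphism with prescribed values on letters. -/
noncomputable def letterLift {B : Type*} [Ring B] [Algebra K B] (f : Letter → B) :
    WordAlg K →ₐ[K] B :=
  MonoidAlgebra.lift K B (FreeMonoid Letter) (FreeMonoid.lift f)

@[simp] theorem letterLift_wd {B : Type*} [Ring B] [Algebra K B] (f : Letter → B)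
    (w : List Letter) : letterLift f (wd K w) = (w.map f).prod := by
  rw [letterLift, wd, MonoidAlgebra.lift_of, FreeMonoid.lift_apply]
  rfl

/-- A word as an element of the algebra of arrow diagrams; words that do not describe an arrow
diagram are sent to `0`. -/
noncomputable def ev : WordAlg K →ₗ[K] Aw K := wordLift fun w => Aw.mk K w

@[simp] theorem ev_wd (w : List Letter) : ev (wd K w) = Aw.mk K w := wordLift_wd _ _

theorem Aw.mk_of_not_valid {w : List Letter} (h : ¬ Valid w) : Aw.mk K w = 0 := by
  rw [Aw.mk, dia, dif_neg h, map_zero]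

/-- An identity between two linear maps of two variables can be checked on words. -/
theorem WordAlg.ext₂ {f g : WordAlg K → WordAlg K → M}
    (hf₁ : ∀ v, IsLinearMap K fun u => f u v) (hf₂ : ∀ u, IsLinearMap K fun v => f u v)
    (hg₁ : ∀ v, IsLinearMap K fun u => g u v) (hg₂ : ∀ u, IsLinearMap K fun v => g u v)
    (h : ∀ u v, f (wd K u) (wd K v) = g (wd K u) (wd K v)) (u v : WordAlg K) : f u v = g u v := by
  induction u using WordAlg.induction with
  | hw u =>
    induction v using WordAlg.induction with
    | hw v => exact h u v
    | hadd x y hx hy => rw [(hf₂ _).map_add, (hg₂ _).map_add, hx, hy]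
    | hsmul r x hx => rw [(hf₂ _).map_smul, (hg₂ _).map_smul, hx]
  | hadd x y hx hy => rw [(hf₁ _).map_add, (hg₁ _).map_add, hx, hy]
  | hsmul r x hx => rw [(hf₁ _).map_smul, (hg₁ _).map_smul, hx]

theorem ev_eq_of_words {y z : WordAlg K}
    (h : ∀ u v, ev (wd K u * y * wd K v) = ev (wd K u * z * wd K v)) (u v : WordAlg K) :
    ev (u * y * v) = ev (u * z * v) := by
  refine WordAlg.ext₂ (f := fun u v => ev (u * y * v)) (g := fun u v => ev (u * z * v))
    ?_ ?_ ?_ ?_ h u v <;> intro _ <;> constructor <;> intros <;> simp [add_mul, mul_add]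

/-- Tails commute. -/
theorem ev_tails (u v : WordAlg K) (p q : ℕ) :
    ev (u * (wd K [tail p] * wd K [tail q]) * v) = ev (u * (wd K [tail q] * wd K [tail p]) * v) := by
  refine ev_eq_of_words (fun u v => ?_) u v
  simp only [← wd_append, ev_wd, List.append_assoc]
  by_cases h : Valid (u ++ tail p :: tail q :: v)
  · simpa using Aw.mk_tc' K h
  · have hP : (u ++ tail p :: tail q :: v).Perm (u ++ tail q :: tail p :: v) :=
      (List.Perm.swap _ _ _).append_left u
    rw [Aw.mk_of_not_valid (by simpa using h), Aw.mk_of_not_valid]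
    exact fun h' => h (Valid.of_perm hP.symm (by simpa using h'))

theorem Aw.mk_tails (u v : List Letter) (p q : ℕ) :
    Aw.mk K (u ++ tail p :: tail q :: v) = Aw.mk K (u ++ tail q :: tail p :: v) := by
  have := ev_tails (K := K) (wd K u) (wd K v) p q
  simpa only [← wd_append, ev_wd, List.append_assoc, List.cons_append, List.nil_append] using this

theorem mk_place_tails (S : Fin 4 → List Letter) (σ : Equiv.Perm (Fin 3)) (p q : ℕ)
    (b c : List Letter) :
    Aw.mk K (place S σ ![[tail p, tail q], b, c]) =
      Aw.mk K (place S σ ![[tail q, tail p], b, c]) := by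
  have hne : ∀ i, i ≠ 0 → ![[tail p, tail q], b, c] i = ![[tail q, tail p], b, c] i := by
    intro i hi
    fin_cases i <;> simp_all
  obtain ⟨i, hi⟩ := σ.surjective 0
  have hσ : ∀ j, j ≠ i → σ j ≠ 0 := fun j hj h => hj (σ.injective (h.trans hi.symm))
  fin_cases i
  · simp only [place, hne _ (hσ 1 (by decide)), hne _ (hσ 2 (by decide))]
    simp only [Fin.zero_eta] at hi
    simpa [hi] using Aw.mk_tails (K := K) (S 0) _ p q
  · simp only [place, hne _ (hσ 0 (by decide)), hne _ (hσ 2 (by decide))]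
    simp only [Fin.mk_one] at hi
    simpa [hi] using Aw.mk_tails (K := K) (S 0 ++ (![[tail q, tail p], b, c] (σ 0) ++ S 1)) _ p q
  · simp only [place, hne _ (hσ 0 (by decide)), hne _ (hσ 1 (by decide))]
    simp only [Fin.reduceFinMk] at hi
    simpa [hi] using Aw.mk_tails (K := K) (S 0 ++ (![[tail q, tail p], b, c] (σ 0) ++
      (S 1 ++ (![[tail q, tail p], b, c] (σ 1) ++ S 2)))) _ p q

/-- The relation 6T, of which TC makes the first commutator vanish. -/
theorem mk_fourT (S : Fin 4 → List Letter) (σ : Equiv.Perm (Fin 3)) (p q : ℕ) :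
    (Aw.mk K (place S σ ![[tail p], [head p, tail q], [head q]])
      - Aw.mk K (place S σ ![[tail p], [tail q, head p], [head q]]))
    + (Aw.mk K (place S σ ![[tail p], [tail q], [head p, head q]])
      - Aw.mk K (place S σ ![[tail p], [tail q], [head q, head p]])) = 0 := by
  by_cases h : Valid (place S σ ![[tail p, tail q], [head p], [head q]])
  · have := Aw.mk_sixT K h
    rwa [mk_place_tails, sub_self, zero_add] at this
  · have key : ∀ a b c : List Letter, ([tail p, tail q] ++ [head p] ++ [head q]).Perm (a ++ b ++ c) →
        Aw.mk K (place S σ ![a, b, c]) = 0 := fun a b c hp =>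
      Aw.mk_of_not_valid fun h' => h (h'.of_perm (place_perm S σ _ _ _ _ _ _ hp.symm))
    rw [key _ _ _ (perm_four_mid _ _ _ _), key [tail p] [tail q, head p] [head q] (List.Perm.refl _),
      key [tail p] [tail q] [head p, head q] (List.Perm.refl _), key _ _ _ (perm_four_last _ _ _ _)]
    simp

theorem exists_append_of_mem_tails {a : ℕ} {l : List Letter} (h : a ∈ tails l) :
    ∃ s t, l = s ++ tail a :: t := by
  obtain ⟨b, hb, hb'⟩ := List.mem_filterMap.1 h
  cases b with
  | tail e =>
    obtain rfl : e = a := by simpa [Letter.tail?] using hb'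
    exact List.append_of_mem hb
  | head e => simp [Letter.tail?] at hb'

/-- The relation 6T in the presence of TC: moving the head of `a` across the tail of `c` costs the
commutator of the two heads, placed where the arrow `c` ends. Here `c` points to the right. -/
theorem Aw.mk_slide_right (u v w : List Letter) {a c : ℕ} (hac : a ≠ c) :
    Aw.mk K (u ++ head a :: tail c :: (v ++ head c :: w))
      - Aw.mk K (u ++ tail c :: head a :: (v ++ head c :: w))
      + (Aw.mk K (u ++ tail c :: (v ++ head a :: head c :: w))
        - Aw.mk K (u ++ tail c :: (v ++ head c :: head a :: w))) = 0 := by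
  by_cases ha : a ∈ tails (u ++ v ++ w)
  · rw [tails_append, tails_append] at ha
    rcases List.mem_append.1 ha with ha | ha
    · rcases List.mem_append.1 ha with ha | ha
      · obtain ⟨s, t, rfl⟩ := exists_append_of_mem_tails ha
        simpa [place] using mk_fourT (K := K) ![s, t, v, w] 1 a c
      · obtain ⟨s, t, rfl⟩ := exists_append_of_mem_tails ha
        simpa [place, Equiv.swap_apply_def] using mk_fourT (K := K) ![u, s, t, w] (Equiv.swap 0 1) a c
    · obtain ⟨s, t, rfl⟩ := exists_append_of_mem_tails ha
      simpa [place, finRotate_apply] using mk_fourT (K := K) ![u, v, s, t] (finRotate 3) a c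
  · rw [Aw.mk_of_not_valid, Aw.mk_of_not_valid, Aw.mk_of_not_valid, Aw.mk_of_not_valid]
    · simp
    all_goals
      intro h
      have := h.name_mem (a := head a) (by simp)
      simp_all

/-- As `Aw.mk_slide_right`, with `c` pointing to the left. -/
theorem Aw.mk_slide_left (u v w : List Letter) {a c : ℕ} (hac : a ≠ c) :
    Aw.mk K (u ++ head c :: (v ++ head a :: tail c :: w))
      - Aw.mk K (u ++ head c :: (v ++ tail c :: head a :: w))
      + (Aw.mk K (u ++ head a :: head c :: (v ++ tail c :: w))
        - Aw.mk K (u ++ head c :: head a :: (v ++ tail c :: w))) = 0 := by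
  by_cases ha : a ∈ tails (u ++ v ++ w)
  · rw [tails_append, tails_append] at ha
    rcases List.mem_append.1 ha with ha | ha
    · rcases List.mem_append.1 ha with ha | ha
      · obtain ⟨s, t, rfl⟩ := exists_append_of_mem_tails ha
        simpa [place, Equiv.swap_apply_def] using mk_fourT (K := K) ![s, t, v, w] (Equiv.swap 1 2) a c
      · obtain ⟨s, t, rfl⟩ := exists_append_of_mem_tails ha
        simpa [place, finRotate_apply] using
          mk_fourT (K := K) ![u, s, t, w] (finRotate 3).symm a c
    · obtain ⟨s, t, rfl⟩ := exists_append_of_mem_tails ha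
      simpa [place, Equiv.swap_apply_def] using mk_fourT (K := K) ![u, v, s, t] (Equiv.swap 0 2) a c
  · rw [Aw.mk_of_not_valid, Aw.mk_of_not_valid, Aw.mk_of_not_valid, Aw.mk_of_not_valid]
    · simp
    all_goals
      intro h
      have := h.name_mem (a := head a) (by simp)
      simp_all

end Words

/-! ### Sliding Lie elements across tails -/

section Slides

variable (K : Type u) [Field K]

/-- The head of the arrow `a`, as an element of the free algebra. -/
noncomputable abbrev hd (a : ℕ) : WordAlg K := wd K [head a]

/-- The tail of the arrow `a`, as an element of the free algebra. -/
noncomputable abbrev tl (a : ℕ) : WordAlg K := wd K [tail a]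

variable {K}

/-- Replacing `y` by `y'` and replacing `z` by `z'` have opposite effects in the algebra of arrow
diagrams, wherever `y` and `z` stand on the skeleton, `y` being before `z`. -/
def Balanced (y y' z z' : WordAlg K) : Prop :=
  ∀ u v w, ev (u * y' * v * z * w + u * y * v * z' * w) = 0

/-- The two ends of the arrow `c`, in any order, are killed by the derivation `⁅Y, ·⁆`: moving `Y`
across the tail of `c` costs, up to sign, the commutator of `Y` with the head of `c`. -/
def Slides (c : ℕ) (Y : WordAlg K) : Prop :=
  Balanced (tl K c) ⁅Y, tl K c⁆ (hd K c) ⁅Y, hd K c⁆ ∧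
    Balanced (hd K c) ⁅Y, hd K c⁆ (tl K c) ⁅Y, tl K c⁆

theorem Balanced.eq {y y' z z' : WordAlg K} (h : Balanced y y' z z') (u v w : WordAlg K) :
    ev (u * y' * v * z * w) = -ev (u * y * v * z' * w) := by
  rw [eq_neg_iff_add_eq_zero, ← map_add]
  exact h u v w

theorem balanced_of_words {y y' z z' : WordAlg K}
    (h : ∀ u v w, ev (wd K u * y' * wd K v * z * wd K w
      + wd K u * y * wd K v * z' * wd K w) = 0) : Balanced y y' z z' := by
  intro u v w
  simp only [map_add] at h ⊢
  induction u using WordAlg.induction with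
  | hw u =>
    induction v using WordAlg.induction with
    | hw v =>
      induction w using WordAlg.induction with
      | hw w => exact h u v w
      | hadd x y hx hy =>
        simp only [mul_add, map_add]
        rw [add_add_add_comm, hx, hy, add_zero]
      | hsmul r x hx => simp only [mul_smul_comm, map_smul, ← smul_add, hx, smul_zero]
    | hadd x y hx hy =>
      simp only [mul_add, add_mul, map_add]
      rw [add_add_add_comm, hx, hy, add_zero]
    | hsmul r x hx =>
      simp only [mul_smul_comm, smul_mul_assoc, map_smul, ← smul_add, hx, smul_zero]
  | hadd x y hx hy =>
    simp only [add_mul, map_add]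
    rw [add_add_add_comm, hx, hy, add_zero]
  | hsmul r x hx => simp only [smul_mul_assoc, map_smul, ← smul_add, hx, smul_zero]

theorem lie_eq_neg (x y : WordAlg K) : ⁅x, y⁆ = -⁅y, x⁆ := by
  rw [Ring.lie_def, Ring.lie_def, neg_sub]

/-- The combined relations 6T and TC, for both directions of the arrow `c`. -/
theorem slides_hd {a c : ℕ} (h : a ≠ c) : Slides c (hd K a) := by
  refine ⟨balanced_of_words fun u v w => ?_, balanced_of_words fun u v w => ?_⟩
  · rw [← Aw.mk_slide_right u v w h]
    simp only [Ring.lie_def, mul_sub, sub_mul, map_add, map_sub, ← wd_append, ev_wd,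
      List.append_assoc, List.cons_append, List.nil_append]
  · rw [← Aw.mk_slide_left u v w h, add_comm]
    simp only [Ring.lie_def, mul_sub, sub_mul, map_add, map_sub, ← wd_append, ev_wd,
      List.append_assoc, List.cons_append, List.nil_append]

/-- If the derivations `⁅P, ·⁆` and `⁅Q, ·⁆` are balanced at `y` and `z`, then so is their
commutator. -/
theorem Balanced.lie {P Q y z : WordAlg K} (hP : Balanced y ⁅P, y⁆ z ⁅P, z⁆)
    (hQ : Balanced y ⁅Q, y⁆ z ⁅Q, z⁆) : Balanced y ⁅⁅P, Q⁆, y⁆ z ⁅⁅P, Q⁆, z⁆ := by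
  intro u v w
  have e : u * ⁅⁅P, Q⁆, y⁆ * v * z * w + u * y * v * ⁅⁅P, Q⁆, z⁆ * w =
      ((u * P) * ⁅Q, y⁆ * v * z * w + (u * P) * y * v * ⁅Q, z⁆ * w)
      - (u * ⁅Q, y⁆ * (P * v) * z * w + u * y * (P * v) * ⁅Q, z⁆ * w)
      - ((u * Q) * ⁅P, y⁆ * v * z * w + (u * Q) * y * v * ⁅P, z⁆ * w)
      + (u * ⁅P, y⁆ * (Q * v) * z * w + u * y * (Q * v) * ⁅P, z⁆ * w)
      - (u * ⁅P, y⁆ * (v * Q) * z * w + u * y * (v * Q) * ⁅P, z⁆ * w)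
      + (u * ⁅P, y⁆ * v * z * (Q * w) + u * y * v * ⁅P, z⁆ * (Q * w))
      + (u * ⁅Q, y⁆ * (v * P) * z * w + u * y * (v * P) * ⁅Q, z⁆ * w)
      - (u * ⁅Q, y⁆ * v * z * (P * w) + u * y * v * ⁅Q, z⁆ * (P * w)) := by
    simp only [Ring.lie_def]; noncomm_ring
  rw [e, ← LinearMap.mem_ker]
  exact sub_mem (add_mem (add_mem (sub_mem (add_mem (sub_mem (sub_mem (hQ _ _ _) (hQ _ _ _))
    (hP _ _ _)) (hP _ _ _)) (hP _ _ _)) (hP _ _ _)) (hQ _ _ _)) (hQ _ _ _)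

theorem Slides.lie {c : ℕ} {P Q : WordAlg K} (hP : Slides c P) (hQ : Slides c Q) :
    Slides c ⁅P, Q⁆ := ⟨hP.1.lie hQ.1, hP.2.lie hQ.2⟩

theorem Balanced.lie_right {y y' P P' : WordAlg K} (h : Balanced y y' P P') (Q : WordAlg K) :
    Balanced y y' ⁅P, Q⁆ ⁅P', Q⁆ := by
  intro u v w
  have e : u * y' * v * ⁅P, Q⁆ * w + u * y * v * ⁅P', Q⁆ * w =
      (u * y' * v * P * (Q * w) + u * y * v * P' * (Q * w))
      - (u * y' * (v * Q) * P * w + u * y * (v * Q) * P' * w) := by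
    simp only [Ring.lie_def]; noncomm_ring
  rw [e, map_sub, h, h, sub_zero]

theorem Balanced.lie_left {y y' P P' : WordAlg K} (h : Balanced P P' y y') (Q : WordAlg K) :
    Balanced ⁅P, Q⁆ ⁅P', Q⁆ y y' := by
  intro u v w
  have e : u * ⁅P', Q⁆ * v * y * w + u * ⁅P, Q⁆ * v * y' * w =
      (u * P' * (Q * v) * y * w + u * P * (Q * v) * y' * w)
      - (u * Q * P' * v * y * w + u * Q * P * v * y' * w) := by
    simp only [Ring.lie_def]; noncomm_ring
  rw [e, map_sub, h, h, sub_zero]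

theorem Balanced.neg_right {y y' P P' : WordAlg K} (h : Balanced y y' P P') :
    Balanced y y' (-P) (-P') := by
  intro u v w
  rw [← neg_zero, ← h u v w, ← map_neg]
  congr 1
  noncomm_ring

theorem Balanced.neg_left {y y' P P' : WordAlg K} (h : Balanced P P' y y') :
    Balanced (-P) (-P') y y' := by
  intro u v w
  rw [← neg_zero, ← h u v w, ← map_neg]
  congr 1
  noncomm_ring

end Slides

/-! ### Trees on the skeleton -/

/-- A rooted planar binary tree whose leaves are labelled by the names of arrows. It stands for a
tree of internal vertices of a w-Jacobi diagram whose root is a head on the skeleton. -/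
inductive LTree : Type
  | leaf : ℕ → LTree
  | node : LTree → LTree → LTree

namespace LTree

def leaves : LTree → List ℕ
  | leaf a => [a]
  | node l r => l.leaves ++ r.leaves

/-- Each leaf labelled `c` is replaced by the tree with left part `Y` and right part the leaf. -/
def attach : LTree → LTree → ℕ → LTree
  | leaf a, Y, c => if a = c then node Y (leaf a) else leaf a
  | node l r, Y, c => node (l.attach Y c) (r.attach Y c)

theorem attach_of_notMem {Y : LTree} {c : ℕ} {X : LTree} (h : c ∉ X.leaves) : X.attach Y c = X := by
  induction X with
  | leaf a => simp_all [leaves, attach, eq_comm]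
  | node l r hl hr => simp_all [leaves, attach]

theorem leaves_attach {Y : LTree} {c : ℕ} {X : LTree} (hc : c ∈ X.leaves) (h : X.leaves.Nodup) :
    (X.attach Y c).leaves.Perm (Y.leaves ++ X.leaves) := by
  induction X with
  | leaf a => simp_all [leaves, attach]
  | node l r hl hr =>
    simp only [leaves, List.nodup_append, List.mem_append] at h hc
    simp only [leaves, attach]
    rcases hc with hc | hc
    · rw [attach_of_notMem fun h' => h.2.2 _ hc _ h' rfl, ← List.append_assoc]
      exact (hl hc h.1).append_right _
    · rw [attach_of_notMem fun h' => h.2.2 _ h' _ hc rfl]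
      refine ((hr hc h.2.1).append_left _).trans ?_
      rw [← List.append_assoc, ← List.append_assoc]
      exact List.perm_append_comm.append_right _

variable (K : Type u) [Field K]

/-- A tree read as an iterated commutator of heads on the skeleton. -/
noncomputable def eval : LTree → WordAlg K
  | leaf a => hd K a
  | node l r => ⁅l.eval, r.eval⁆

variable {K}

theorem slides_eval {c : ℕ} {X : LTree} (h : c ∉ X.leaves) : Slides c (X.eval K) := by
  induction X with
  | leaf a => exact slides_hd (by simpa [leaves, eq_comm] using h)
  | node l r hl hr =>
    simp only [leaves, List.mem_append, not_or] at h
    exact (hl h.1).lie (hr h.2)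

/-- Moving the tree `Y` across the tail of `c` costs the diagram in which `Y` is attached to the tree
that has the leaf `c`. Here this tree is to the right of the tail. -/
theorem balanced_attach_right {c : ℕ} {Y X : LTree} (hY : c ∉ Y.leaves) (hc : c ∈ X.leaves)
    (h : X.leaves.Nodup) :
    Balanced (tl K c) ⁅Y.eval K, tl K c⁆ (X.eval K) ((X.attach Y c).eval K) := by
  induction X with
  | leaf a =>
    obtain rfl : c = a := by simpa [leaves] using hc
    simpa [attach, eval] using (slides_eval hY).1
  | node l r hl hr =>
    simp only [leaves, List.nodup_append, List.mem_append] at h hc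
    simp only [eval, attach]
    rcases hc with hc | hc
    · rw [attach_of_notMem fun h' => h.2.2 _ hc _ h' rfl]
      exact (hl hc h.1).lie_right _
    · rw [attach_of_notMem fun h' => h.2.2 _ h' _ hc rfl,
        lie_eq_neg (l.eval K) (r.eval K), lie_eq_neg (l.eval K) ((r.attach Y c).eval K)]
      exact ((hr hc h.2.1).lie_right _).neg_right

/-- As `balanced_attach_right`, with the tree `X` to the left of the tail. -/
theorem balanced_attach_left {c : ℕ} {Y X : LTree} (hY : c ∉ Y.leaves) (hc : c ∈ X.leaves)
    (h : X.leaves.Nodup) :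
    Balanced (X.eval K) ((X.attach Y c).eval K) (tl K c) ⁅Y.eval K, tl K c⁆ := by
  induction X with
  | leaf a =>
    obtain rfl : c = a := by simpa [leaves] using hc
    simpa [attach, eval] using (slides_eval hY).2
  | node l r hl hr =>
    simp only [leaves, List.nodup_append, List.mem_append] at h hc
    simp only [eval, attach]
    rcases hc with hc | hc
    · rw [attach_of_notMem fun h' => h.2.2 _ hc _ h' rfl]
      exact (hl hc h.1).lie_left _
    · rw [attach_of_notMem fun h' => h.2.2 _ h' _ hc rfl,
        lie_eq_neg (l.eval K) (r.eval K), lie_eq_neg (l.eval K) ((r.attach Y c).eval K)]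
      exact ((hr hc h.2.1).lie_left _).neg_left

end LTree

/-! ### Words with the same letters -/

section PermSpan

variable (K : Type u) [Field K]

/-- The span of the rearrangements of a word. -/
noncomputable def permSpan (s : List Letter) : Submodule K (WordAlg K) :=
  Submodule.span K (wd K '' {w | w.Perm s})

variable {K}

theorem wd_mem_permSpan (s : List Letter) : wd K s ∈ permSpan K s :=
  Submodule.subset_span ⟨s, List.Perm.refl s, rfl⟩

theorem permSpan_congr {s t : List Letter} (h : s.Perm t) : permSpan K s = permSpan K t := by
  have e : {w : List Letter | w.Perm s} = {w | w.Perm t} :=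
    Set.ext fun w => ⟨fun hw => hw.trans h, fun hw => hw.trans h.symm⟩
  rw [permSpan, e, permSpan]

theorem permSpan_induction {s : List Letter} {P : WordAlg K → Prop}
    (hw : ∀ w : List Letter, w.Perm s → P (wd K w)) (h0 : P 0) (hadd : ∀ x y, P x → P y → P (x + y))
    (hsmul : ∀ (r : K) x, P x → P (r • x)) {x : WordAlg K} (hx : x ∈ permSpan K s) : P x := by
  refine Submodule.span_induction (p := fun x _ => P x) ?_ h0 (fun x y _ _ => hadd x y)
    (fun r x _ => hsmul r x) hx
  rintro _ ⟨w, hs, rfl⟩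
  exact hw w hs

theorem mul_mem_permSpan {s t : List Letter} {x y : WordAlg K} (hx : x ∈ permSpan K s)
    (hy : y ∈ permSpan K t) : x * y ∈ permSpan K (s ++ t) := by
  refine permSpan_induction (P := fun x => x * y ∈ permSpan K (s ++ t)) (fun u hu => ?_)
    (by rw [zero_mul]; exact zero_mem _) (fun a b ha hb => by rw [add_mul]; exact add_mem ha hb)
    (fun r a ha => by rw [smul_mul_assoc]; exact Submodule.smul_mem _ _ ha) hx
  refine permSpan_induction (P := fun y => wd K u * y ∈ permSpan K (s ++ t)) (fun v hv => ?_)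
    (by rw [mul_zero]; exact zero_mem _) (fun a b ha hb => by rw [mul_add]; exact add_mem ha hb)
    (fun r a ha => by rw [mul_smul_comm]; exact Submodule.smul_mem _ _ ha) hy
  rw [← wd_append]
  exact Submodule.subset_span ⟨_, hu.append hv, rfl⟩

theorem lie_mem_permSpan {s t : List Letter} {x y : WordAlg K} (hx : x ∈ permSpan K s)
    (hy : y ∈ permSpan K t) : ⁅x, y⁆ ∈ permSpan K (s ++ t) := by
  refine sub_mem (mul_mem_permSpan hx hy) ?_
  rw [permSpan_congr List.perm_append_comm]
  exact mul_mem_permSpan hy hx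

theorem LTree.eval_mem_permSpan (X : LTree) : X.eval K ∈ permSpan K (X.leaves.map head) := by
  induction X with
  | leaf a => exact wd_mem_permSpan _
  | node l r hl hr =>
    rw [leaves, List.map_append]
    exact lie_mem_permSpan hl hr

/-- Disjoint pieces of the skeleton that no arrow joins multiply as diagrams do. -/
theorem ev_mul {s t : List Letter} (hs : Valid s) (ht : Valid t) (h : ∀ n ∈ tails s, n ∉ tails t)
    {x y : WordAlg K} (hx : x ∈ permSpan K s) (hy : y ∈ permSpan K t) :
    ev (x * y) = ev x * ev y := by
  refine permSpan_induction (P := fun x => ev (x * y) = ev x * ev y) (fun u hu => ?_)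
    (by simp) (fun a b ha hb => by simp only [add_mul, map_add, ha, hb])
    (fun r a ha => by simp only [smul_mul_assoc, map_smul, ha]) hx
  refine permSpan_induction (P := fun y => ev (wd K u * y) = ev (wd K u) * ev y) (fun v hv => ?_)
    (by simp) (fun a b ha hb => by simp only [mul_add, map_add, ha, hb])
    (fun r a ha => by simp only [mul_smul_comm, map_smul, ha]) hy
  rw [← wd_append, ev_wd, ev_wd, ev_wd, Aw.mk_mul K (hs.of_perm hu.symm) (ht.of_perm hv.symm)]
  intro n hn hn'
  exact h n ((tails_perm hu).mem_iff.1 hn) ((tails_perm hv).mem_iff.1 hn')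

end PermSpan

/-! ### Gathering a tree with its tails -/

/-- A part of the skeleton that carries tails and roots of trees. -/
abbrev TreeWord : Type := List (ℕ ⊕ LTree)

namespace TreeWord

/-- The ends of arrows that are left when the trees are cut into their leaves. -/
def letters (W : TreeWord) : List Letter :=
  W.flatMap (Sum.elim (fun a => [tail a]) fun X => X.leaves.map head)

/-- The number of trees. -/
def trees (W : TreeWord) : ℕ := W.countP Sum.isRight

@[simp] theorem letters_nil : letters [] = [] := rfl

@[simp] theorem letters_cons (g : ℕ ⊕ LTree) (W : TreeWord) :
    letters (g :: W) = Sum.elim (fun a => [tail a]) (fun X => X.leaves.map head) g ++ letters W :=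
  List.flatMap_cons

@[simp] theorem letters_append (U V : TreeWord) : letters (U ++ V) = letters U ++ letters V :=
  List.flatMap_append

@[simp] theorem letters_tails (P : List ℕ) : letters (P.map Sum.inl) = P.map tail := by
  induction P with
  | nil => rfl
  | cons a P ih => simp [ih]

@[simp] theorem trees_nil : trees [] = 0 := rfl

@[simp] theorem trees_cons_inl (a : ℕ) (W : TreeWord) : trees (Sum.inl a :: W) = trees W := by
  simp [trees]

@[simp] theorem trees_cons_inr (X : LTree) (W : TreeWord) :
    trees (Sum.inr X :: W) = trees W + 1 :=
  List.countP_cons_of_pos rfl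

@[simp] theorem trees_append (U V : TreeWord) : trees (U ++ V) = trees U + trees V :=
  List.countP_append

@[simp] theorem trees_tails (P : List ℕ) : trees (P.map Sum.inl) = 0 := by
  induction P <;> simp_all

variable (K : Type u) [Field K]

/-- Each tree is read as an iterated commutator of heads. -/
noncomputable def eval (W : TreeWord) : WordAlg K :=
  (W.map (Sum.elim (tl K) (LTree.eval K))).prod

@[simp] theorem eval_nil : eval K [] = 1 := rfl

@[simp] theorem eval_cons (g : ℕ ⊕ LTree) (W : TreeWord) :
    eval K (g :: W) = Sum.elim (tl K) (LTree.eval K) g * eval K W := by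
  simp [eval]

@[simp] theorem eval_append (U V : TreeWord) : eval K (U ++ V) = eval K U * eval K V := by
  simp [eval]

theorem eval_mem_permSpan (W : TreeWord) : eval K W ∈ permSpan K (letters W) := by
  induction W with
  | nil => rw [eval_nil, ← wd_nil]; exact wd_mem_permSpan []
  | cons g W ih =>
    rw [eval_cons, letters_cons]
    refine mul_mem_permSpan ?_ ih
    cases g with
    | inl a => exact wd_mem_permSpan _
    | inr X => exact X.eval_mem_permSpan

end TreeWord

@[simp] theorem tails_map_tail (P : List ℕ) : tails (P.map tail) = P := by
  induction P <;> simp_all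

@[simp] theorem heads_map_tail (P : List ℕ) : heads (P.map tail) = [] := by
  induction P <;> simp_all

@[simp] theorem tails_map_head (P : List ℕ) : tails (P.map head) = [] := by
  induction P <;> simp_all

@[simp] theorem heads_map_head (P : List ℕ) : heads (P.map head) = P := by
  induction P <;> simp_all

theorem Valid.nodup_heads {w : List Letter} (h : Valid w) : (heads w).Nodup := h.2.nodup_iff.1 h.1

namespace TreeWord

theorem exists_first_tree {W : TreeWord} (h : trees W ≠ 0) :
    ∃ (P : List ℕ) (X : LTree) (R : TreeWord), W = P.map Sum.inl ++ Sum.inr X :: R := by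
  induction W with
  | nil => simp at h
  | cons g W ih =>
    cases g with
    | inr X => exact ⟨[], X, W, rfl⟩
    | inl a =>
      obtain ⟨P, X, R, rfl⟩ := ih (by simpa using h)
      exact ⟨a :: P, X, R, rfl⟩

theorem exists_tree_of_mem_heads {W : TreeWord} {c : ℕ} (h : c ∈ heads (letters W)) :
    ∃ (R₁ : TreeWord) (Y : LTree) (R₂ : TreeWord), W = R₁ ++ Sum.inr Y :: R₂ ∧ c ∈ Y.leaves := by
  induction W with
  | nil => simp at h
  | cons g W ih =>
    by_cases hW : c ∈ heads (letters W)
    · obtain ⟨R₁, Y, R₂, rfl, hc⟩ := ih hW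
      exact ⟨g :: R₁, Y, R₂, rfl, hc⟩
    · cases g with
      | inl a => simp_all
      | inr Y => exact ⟨[], Y, W, rfl, by simpa [hW] using h⟩

theorem exists_tail_of_mem_tails {W : TreeWord} {a : ℕ} (h : a ∈ tails (letters W)) :
    ∃ R₁ R₂ : TreeWord, W = R₁ ++ Sum.inl a :: R₂ := by
  induction W with
  | nil => simp at h
  | cons g W ih =>
    by_cases hW : a ∈ tails (letters W)
    · obtain ⟨R₁, R₂, rfl⟩ := ih hW
      exact ⟨g :: R₁, R₂, rfl⟩
    · cases g with
      | inr Y => simp_all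
      | inl b =>
        obtain rfl : a = b := by simpa [hW] using h
        exact ⟨[], W, rfl⟩

variable {K : Type u} [Field K]

theorem ev_tail_past_tails (u v : WordAlg K) (c : ℕ) (P : List ℕ) :
    ev (u * tl K c * eval K (P.map Sum.inl) * v) = ev (u * eval K (P.map Sum.inl) * tl K c * v) := by
  induction P generalizing u with
  | nil => simp
  | cons a P ih =>
    have h1 := ih (u * tl K a)
    have h2 := ev_tails u (eval K (P.map Sum.inl) * v) c a
    simp only [List.map_cons, eval_cons, Sum.elim_inl, mul_assoc] at h1 h2 ⊢
    rw [h2, h1]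

section Gather

variable {G : ℕ → Submodule K (Aw K)} {r : ℕ}

/-- The tails that stand before the first tree `X` and do not belong to it are moved behind it. -/
theorem ev_mem_of_tails_before {n : ℕ} {X : LTree}
    (ih : ∀ W, trees W = r → Valid (letters W) → ev (eval K W) ∈ G (tails (letters W)).length)
    (h : ∀ (P : List ℕ) (R : TreeWord), trees R = r → (∀ a ∈ P, a ∈ X.leaves) →
      Valid (letters (P.map Sum.inl ++ Sum.inr X :: R)) →
      (tails (letters (P.map Sum.inl ++ Sum.inr X :: R))).length = n →
      ev (eval K (P.map Sum.inl ++ Sum.inr X :: R)) ∈ G n)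
    (k : ℕ) (P : List ℕ) (R : TreeWord) (hk : P.countP (fun c => c ∉ X.leaves) = k)
    (hr : trees R = r) (hW : Valid (letters (P.map Sum.inl ++ Sum.inr X :: R)))
    (hn : (tails (letters (P.map Sum.inl ++ Sum.inr X :: R))).length = n) :
    ev (eval K (P.map Sum.inl ++ Sum.inr X :: R)) ∈ G n := by
  induction k generalizing P R with
  | zero => exact h P R hr (by simpa using List.countP_eq_zero.1 hk) hW hn
  | succ k ihk =>
    obtain ⟨c, hcP, hcX⟩ := List.countP_pos_iff.1 (hk.symm ▸ Nat.succ_pos k :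
      0 < P.countP fun c => c ∉ X.leaves)
    have hcX : c ∉ X.leaves := by simpa using hcX
    obtain ⟨P₁, P₂, rfl⟩ := List.append_of_mem hcP
    have hcR : c ∈ heads (letters R) := by
      have : c ∈ heads (letters ((P₁ ++ c :: P₂).map Sum.inl ++ Sum.inr X :: R)) :=
        hW.2.mem_iff.1 (by simp)
      simpa [hcX] using this
    obtain ⟨R₁, Y, R₂, rfl, hcY⟩ := exists_tree_of_mem_heads hcR
    have hYn : Y.leaves.Nodup := by
      have := hW.nodup_heads
      simp only [letters_append, letters_cons, heads_append, Sum.elim_inr, heads_map_head] at this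
      exact ((this.of_append_right.of_append_right).of_append_right).of_append_left
    have key : ev (eval K ((P₁ ++ c :: P₂).map Sum.inl ++ Sum.inr X :: (R₁ ++ Sum.inr Y :: R₂))) =
        ev (eval K ((P₁ ++ P₂).map Sum.inl ++ Sum.inr X ::
          (Sum.inl c :: (R₁ ++ Sum.inr Y :: R₂)))) +
        ev (eval K ((P₁ ++ P₂ ++ [c]).map Sum.inl ++ (R₁ ++ Sum.inr (Y.attach X c) :: R₂))) := by
      have h1 := ev_tail_past_tails (eval K (P₁.map Sum.inl))
        (X.eval K * (eval K R₁ * (Y.eval K * eval K R₂))) c P₂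
      have h2 := (LTree.balanced_attach_right hcX hcY hYn).eq
        (eval K (P₁.map Sum.inl) * eval K (P₂.map Sum.inl)) (eval K R₁) (eval K R₂)
      simp only [Ring.lie_def, mul_sub, sub_mul, map_sub] at h2
      simp only [List.map_append, List.map_cons, List.map_nil, eval_append, eval_cons, eval_nil,
        Sum.elim_inl, Sum.elim_inr, mul_one, mul_assoc] at h1 h2 ⊢
      rw [h1]
      exact sub_eq_iff_eq_add'.1 ((neg_sub _ _).symm.trans (neg_eq_iff_eq_neg.2 h2))
    have hp : (letters ((P₁ ++ c :: P₂).map Sum.inl ++ Sum.inr X ::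
        (R₁ ++ Sum.inr Y :: R₂))).Perm (letters ((P₁ ++ P₂).map Sum.inl ++ Sum.inr X ::
          (Sum.inl c :: (R₁ ++ Sum.inr Y :: R₂)))) := by
      rw [← Multiset.coe_eq_coe]
      simp only [letters_append, letters_cons, letters_tails, List.map_append, List.map_cons,
        Sum.elim_inl, Sum.elim_inr, ← Multiset.coe_add, ← Multiset.cons_coe,
        ← Multiset.singleton_add, Multiset.coe_nil]
      abel
    have hp' : (letters ((P₁ ++ c :: P₂).map Sum.inl ++ Sum.inr X ::
        (R₁ ++ Sum.inr Y :: R₂))).Perm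
        (letters ((P₁ ++ P₂ ++ [c]).map Sum.inl ++ (R₁ ++ Sum.inr (Y.attach X c) :: R₂))) := by
      have e := Multiset.coe_eq_coe.2 ((LTree.leaves_attach (Y := X) hcY hYn).map head)
      rw [← Multiset.coe_eq_coe]
      simp only [letters_append, letters_cons, letters_tails, List.map_append, List.map_cons,
        Sum.elim_inl, Sum.elim_inr, ← Multiset.coe_add, ← Multiset.cons_coe,
        ← Multiset.singleton_add, Multiset.coe_nil, List.map_nil] at e ⊢
      rw [e]
      abel
    rw [key]
    refine add_mem (ihk _ _ ?_ (by simpa using hr) (hW.of_perm hp) ?_) ?_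
    · simp only [List.countP_append, List.countP_cons, hcX, not_false_eq_true, decide_true,
        if_true] at hk ⊢
      omega
    · rw [← hn, (tails_perm hp).length_eq]
    · rw [← hn, (tails_perm hp').length_eq]
      refine ih _ ?_ (hW.of_perm hp')
      simp only [trees_append, trees_cons_inr, trees_tails] at hr ⊢
      omega

/-- The tails of the first tree `X` that stand behind it are moved next to it; what is gathered is a
diagram of its own, which can be split off. -/
theorem ev_mem_of_tails_after {X : LTree}
    (hG : ∀ m n, ∀ x ∈ G m, ∀ y ∈ G n, x * y ∈ G (m + n))
    (hone : ∀ A B : List ℕ, Valid (letters (A.map Sum.inl ++ Sum.inr X :: B.map Sum.inl)) →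
      ev (eval K (A.map Sum.inl ++ Sum.inr X :: B.map Sum.inl)) ∈ G X.leaves.length)
    (ih : ∀ W, trees W = r → Valid (letters W) → ev (eval K W) ∈ G (tails (letters W)).length)
    {n : ℕ} {P : List ℕ} (hP : ∀ a ∈ P, a ∈ X.leaves)
    (k : ℕ) (B : List ℕ) (R : TreeWord) (hB : ∀ a ∈ B, a ∈ X.leaves)
    (hk : (tails (letters R)).countP (fun c => c ∈ X.leaves) = k) (hr : trees R = r)
    (hW : Valid (letters (P.map Sum.inl ++ Sum.inr X :: (B.map Sum.inl ++ R))))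
    (hn : (tails (letters (P.map Sum.inl ++ Sum.inr X :: (B.map Sum.inl ++ R)))).length = n) :
    ev (eval K (P.map Sum.inl ++ Sum.inr X :: (B.map Sum.inl ++ R))) ∈ G n := by
  induction k generalizing B R with
  | zero =>
    have hR : ∀ a ∈ tails (letters R), a ∉ X.leaves := by
      simpa using List.countP_eq_zero.1 hk
    have hW' : Valid (letters (P.map Sum.inl ++ Sum.inr X :: B.map Sum.inl) ++ letters R) := by
      simpa using hW
    have hX : Valid (letters (P.map Sum.inl ++ Sum.inr X :: B.map Sum.inl)) := by
      have h1 := hW'.1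
      have h2 := hW'.nodup_heads
      rw [tails_append] at h1
      rw [heads_append] at h2
      refine ⟨h1.of_append_left, (List.perm_ext_iff_of_nodup h1.of_append_left
        h2.of_append_left).2 fun a => ?_⟩
      simp only [letters_append, letters_cons, letters_tails, tails_append, heads_append,
        tails_map_tail, heads_map_tail, tails_map_head, heads_map_head, Sum.elim_inr,
        List.nil_append, List.append_nil, List.mem_append]
      refine ⟨fun h => h.elim (hP a) (hB a), fun h => ?_⟩
      have ha : a ∈ tails (letters (P.map Sum.inl ++ Sum.inr X :: B.map Sum.inl) ++ letters R) :=
        hW'.2.mem_iff.2 (by simp [h])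
      have := hR a
      simp only [letters_append, letters_cons, letters_tails, tails_append, tails_map_tail,
        tails_map_head, Sum.elim_inr, List.nil_append, List.mem_append] at ha
      tauto
    have hR' : Valid (letters R) := by
      have h1 := hW'.1
      have h2 := hW'.2
      rw [tails_append] at h1 h2
      rw [heads_append] at h2
      exact ⟨h1.of_append_right, (List.perm_append_left_iff _).1 (h2.trans (hX.2.symm.append_right _))⟩
    have hd : ∀ a ∈ tails (letters (P.map Sum.inl ++ Sum.inr X :: B.map Sum.inl)),
        a ∉ tails (letters R) := by
      have h1 := hW'.1
      rw [tails_append, List.nodup_append] at h1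
      exact fun a ha ha' => h1.2.2 a ha a ha' rfl
    have e : eval K (P.map Sum.inl ++ Sum.inr X :: (B.map Sum.inl ++ R)) =
        eval K (P.map Sum.inl ++ Sum.inr X :: B.map Sum.inl) * eval K R := by
      simp [mul_assoc]
    have hl : X.leaves.length + (tails (letters R)).length = n := by
      have h1 := hX.2.length_eq
      rw [← hn]
      simp at h1 ⊢
      omega
    rw [e, ev_mul hX hR' hd (eval_mem_permSpan K _) (eval_mem_permSpan K _), ← hl]
    exact hG _ _ _ (hone _ _ hX) _ (ih R hr hR')
  | succ k ihk =>
    obtain ⟨a, haR, haX⟩ := List.countP_pos_iff.1 (hk.symm ▸ Nat.succ_pos k :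
      0 < (tails (letters R)).countP fun c => c ∈ X.leaves)
    have haX : a ∈ X.leaves := by simpa using haX
    obtain ⟨R₁, R₂, rfl⟩ := exists_tail_of_mem_tails haR
    have hXn : X.leaves.Nodup := by
      have := hW.nodup_heads
      simp only [letters_append, letters_cons, heads_append, Sum.elim_inr, heads_map_head] at this
      exact this.of_append_right.of_append_left
    -- The tail of `a` is moved to the left, past the part `R₁`.
    induction R₁ using List.reverseRecOn generalizing R₂ with
    | nil =>
      have := ihk (B ++ [a]) R₂ (by simpa [or_imp, forall_and] using ⟨hB, haX⟩)
        (by simpa [haX] using hk) (by simpa using hr) (by simpa using hW) (by simpa using hn)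
      simpa using this
    | append_singleton R₁ g ihR =>
      have hp : (letters (P.map Sum.inl ++ Sum.inr X ::
          (B.map Sum.inl ++ (R₁ ++ [g] ++ Sum.inl a :: R₂)))).Perm
          (letters (P.map Sum.inl ++ Sum.inr X ::
          (B.map Sum.inl ++ (R₁ ++ Sum.inl a :: g :: R₂)))) := by
        rw [← Multiset.coe_eq_coe]
        simp only [letters_append, letters_cons, letters_tails, Sum.elim_inl, Sum.elim_inr,
          ← Multiset.coe_add, ← Multiset.cons_coe, ← Multiset.singleton_add, Multiset.coe_nil,
          letters_nil]
        abel
      have hrec := ihR (g :: R₂)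
        (by simp only [letters_append, letters_cons, letters_nil, tails_append,
              List.countP_append, tails_nil, List.countP_nil] at hk ⊢; omega)
        (by cases g <;> simp only [trees_append, trees_cons_inl, trees_cons_inr, trees_nil] at hr ⊢ <;>
              omega)
        (hW.of_perm hp) (by rw [← hn, (tails_perm hp).length_eq]) (by simp)
      cases g with
      | inl b =>
        convert hrec using 1
        have h1 := ev_tails (eval K (P.map Sum.inl) * (X.eval K * (eval K (B.map Sum.inl) * eval K R₁)))
          (eval K R₂) b a
        simpa only [eval_append, eval_cons, eval_nil, Sum.elim_inl, Sum.elim_inr, mul_one,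
          mul_assoc] using h1
      | inr Y =>
        have hY : a ∉ Y.leaves := fun h => by
          have := hW.nodup_heads
          simp only [letters_append, letters_cons, heads_append, Sum.elim_inr, heads_map_head] at this
          exact (List.nodup_append.1 this.of_append_right).2.2 a haX a (by simp [h]) rfl
        have key : ev (eval K (P.map Sum.inl ++ Sum.inr X ::
              (B.map Sum.inl ++ (R₁ ++ [Sum.inr Y] ++ Sum.inl a :: R₂)))) =
            ev (eval K (P.map Sum.inl ++ Sum.inr X ::
              (B.map Sum.inl ++ (R₁ ++ Sum.inl a :: Sum.inr Y :: R₂)))) -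
            ev (eval K (P.map Sum.inl ++ Sum.inr (X.attach Y a) ::
              (B.map Sum.inl ++ (R₁ ++ Sum.inl a :: R₂)))) := by
          have h2 := (LTree.balanced_attach_left hY haX hXn).eq
            (eval K (P.map Sum.inl)) (eval K (B.map Sum.inl) * eval K R₁) (eval K R₂)
          simp only [Ring.lie_def, mul_sub, sub_mul, map_sub] at h2
          simp only [eval_append, eval_cons, eval_nil,
            Sum.elim_inl, Sum.elim_inr, mul_one, mul_assoc] at h2 ⊢
          rw [h2]
          abel
        have hp' : (letters (P.map Sum.inl ++ Sum.inr X ::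
            (B.map Sum.inl ++ (R₁ ++ [Sum.inr Y] ++ Sum.inl a :: R₂)))).Perm
            (letters (P.map Sum.inl ++ Sum.inr (X.attach Y a) ::
              (B.map Sum.inl ++ (R₁ ++ Sum.inl a :: R₂)))) := by
          have e := Multiset.coe_eq_coe.2 ((LTree.leaves_attach (Y := Y) haX hXn).map head)
          rw [← Multiset.coe_eq_coe]
          simp only [letters_append, letters_cons, letters_tails, List.map_append,
            Sum.elim_inl, Sum.elim_inr, ← Multiset.coe_add, ← Multiset.cons_coe,
            ← Multiset.singleton_add, Multiset.coe_nil, letters_nil] at e ⊢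
          rw [e]
          abel
        rw [key]
        refine sub_mem hrec ?_
        rw [← hn, (tails_perm hp').length_eq]
        refine ih _ ?_ (hW.of_perm hp')
        simp only [trees_append, trees_cons_inr, trees_cons_inl, trees_tails, trees_nil] at hr ⊢
        omega

/-- A graded family of subspaces that is closed under multiplication and contains all diagrams with
a single tree contains all diagrams. -/
theorem ev_mem_of_single_tree (h1 : 1 ∈ G 0)
    (hG : ∀ m n, ∀ x ∈ G m, ∀ y ∈ G n, x * y ∈ G (m + n))
    (hone : ∀ (A B : List ℕ) (X : LTree),
      Valid (letters (A.map Sum.inl ++ Sum.inr X :: B.map Sum.inl)) →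
      ev (eval K (A.map Sum.inl ++ Sum.inr X :: B.map Sum.inl)) ∈ G X.leaves.length)
    (r : ℕ) (W : TreeWord) (hr : trees W = r) (hW : Valid (letters W)) :
    ev (eval K W) ∈ G (tails (letters W)).length := by
  induction r generalizing W with
  | zero =>
    have : ∀ c, c ∉ heads (letters W) := fun c hc => by
      obtain ⟨R₁, Y, R₂, rfl, -⟩ := exists_tree_of_mem_heads hc
      simp at hr
    have h0 : tails (letters W) = [] :=
      List.eq_nil_iff_forall_not_mem.2 fun c hc => this c (hW.2.mem_iff.1 hc)
    cases W with
    | nil => simpa [← wd_nil, Aw.mk_nil] using h1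
    | cons g W =>
      cases g with
      | inl a => simp at h0
      | inr X => simp at hr
  | succ r ih =>
    obtain ⟨P, X, R, rfl⟩ := exists_first_tree (hr.symm ▸ Nat.succ_ne_zero r : trees W ≠ 0)
    refine ev_mem_of_tails_before (r := r) ih ?_ _ P R rfl
      (by simpa using hr) hW rfl
    intro P R hr hP hW hn
    exact ev_mem_of_tails_after (B := []) hG (fun A B => hone A B X) ih hP _ R (by simp) rfl hr hW hn

end Gather

/-- An arrow diagram, each head being a tree with one leaf. -/
def ofWord (w : List Letter) : TreeWord :=
  w.map fun
    | tail a => Sum.inl a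
    | head a => Sum.inr (LTree.leaf a)

theorem letters_ofWord (w : List Letter) : letters (ofWord w) = w := by
  induction w with
  | nil => rfl
  | cons l w ih => cases l <;> simp_all [ofWord, LTree.leaves]

theorem eval_ofWord (w : List Letter) : eval K (ofWord w) = wd K w := by
  induction w with
  | nil => rfl
  | cons l w ih => rw [wd_cons, ← ih]; cases l <;> simp [ofWord, LTree.eval]

end TreeWord

/-! ### Renaming in the algebra of words -/

section Rename

variable {K : Type u} [Field K]

/-- Renaming of arrows, extended to the algebra of words. -/
noncomputable def ren (f : ℕ → ℕ) : WordAlg K →ₐ[K] WordAlg K :=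
  letterLift fun l => wd K [l.map f]

@[simp] theorem ren_wd (f : ℕ → ℕ) (w : List Letter) : ren f (wd K w) = wd K (rename f w) := by
  rw [ren, letterLift_wd]
  induction w with
  | nil => exact (wd_nil K).symm
  | cons l w ih => rw [List.map_cons, List.prod_cons, ih, ← wd_append]; rfl

theorem ren_lie (f : ℕ → ℕ) (x y : WordAlg K) : ren f ⁅x, y⁆ = ⁅ren f x, ren f y⁆ := by
  simp only [Ring.lie_def, map_sub, map_mul]

theorem ev_ren (f : Equiv.Perm ℕ) (x : WordAlg K) : ev (ren f x) = ev x := by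
  induction x using WordAlg.induction with
  | hw w =>
    rw [ren_wd, ev_wd, ev_wd]
    refine (Aw.mk_renamed K ⟨f, f.symm, rfl, ?_⟩).symm
    rw [rename_rename]
    exact (rename_eq_self fun a _ => f.symm_apply_apply _).symm
  | hadd x y hx hy => simp only [map_add, hx, hy]
  | hsmul r x hx => simp only [map_smul, hx]

end Rename

/-! ### Products of tails -/

section Tails

variable (K : Type u) [Field K]

/-- The tails of a list of arrows, one after the other. -/
noncomputable def tls (P : List ℕ) : WordAlg K := (P.map (tl K)).prod

@[simp] theorem tls_nil : tls K [] = 1 := rfl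

@[simp] theorem tls_cons (a : ℕ) (P : List ℕ) : tls K (a :: P) = tl K a * tls K P := by
  simp [tls]

@[simp] theorem tls_append (P Q : List ℕ) : tls K (P ++ Q) = tls K P * tls K Q := by
  simp [tls]

theorem tls_eq_wd (P : List ℕ) : tls K P = wd K (P.map tail) := by
  induction P with
  | nil => exact (wd_nil K).symm
  | cons a P ih => rw [tls_cons, ih, ← wd_append]; rfl

theorem TreeWord.eval_tails (P : List ℕ) : TreeWord.eval K (P.map Sum.inl) = tls K P := by
  induction P with
  | nil => rfl
  | cons a P ih => simp [ih]

variable {K}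

theorem ren_tls (f : ℕ → ℕ) (P : List ℕ) : ren f (tls K P) = tls K (P.map f) := by
  induction P with
  | nil => simp
  | cons a P ih =>
    rw [tls_cons, map_mul, ih, ren_wd, List.map_cons, tls_cons]
    rfl

theorem ev_tls_perm {P Q : List ℕ} (h : P.Perm Q) (u v : WordAlg K) :
    ev (u * tls K P * v) = ev (u * tls K Q * v) := by
  induction h generalizing u with
  | nil => rfl
  | cons a _ ih => simpa only [tls_cons, mul_assoc] using ih (u * tl K a)
  | swap a b l => simpa only [tls_cons, mul_assoc] using ev_tails u (tls K l * v) b a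
  | trans _ _ ih₁ ih₂ => exact (ih₁ u).trans (ih₂ u)

end Tails

/-! ### Combs -/

namespace LTree

/-- The tree of the right-normed commutator `⁅x_{c₁}, ⁅x_{c₂}, …, x_b⁆⁆`. -/
def comb : List ℕ → ℕ → LTree
  | [], b => leaf b
  | c :: cs, b => node (leaf c) (comb cs b)

theorem leaves_comb (cs : List ℕ) (b : ℕ) : (comb cs b).leaves = cs ++ [b] := by
  induction cs with
  | nil => rfl
  | cons c cs ih => simp [comb, leaves, ih]

theorem comb_concat {cs : List ℕ} {c b : ℕ} (h : b ∉ cs) :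
    comb (cs ++ [c]) b = (comb cs b).attach (leaf c) b := by
  induction cs with
  | nil => simp [comb, attach]
  | cons d cs ih =>
    simp only [List.mem_cons, not_or] at h
    simp [comb, attach, ih h.2, Ne.symm h.1]

variable {K : Type u} [Field K]

theorem eval_comb_swap (cs : List ℕ) (b c : ℕ) :
    (comb (cs ++ [b]) c).eval K = -(comb (cs ++ [c]) b).eval K := by
  induction cs with
  | nil => exact lie_eq_neg _ _
  | cons d cs ih =>
    simp only [List.cons_append, comb, eval, ih, Ring.lie_def]
    noncomm_ring

theorem ren_eval_comb (f : ℕ → ℕ) (cs : List ℕ) (b : ℕ) :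
    ren f ((comb cs b).eval K) = (comb (cs.map f) (f b)).eval K := by
  induction cs with
  | nil => exact ren_wd _ _
  | cons d cs ih =>
    simp only [comb, eval, List.map_cons, ren_lie, ih, ren_wd]
    rfl

variable (K) in
/-- The span of the combs with innermost leaf `b` whose other leaves are those listed in `s`. -/
noncomputable def combSpan (s : List ℕ) (b : ℕ) : Submodule K (WordAlg K) :=
  Submodule.span K ((fun cs => (comb cs b).eval K) '' {cs | cs.Perm s})

theorem combSpan_congr {s t : List ℕ} (h : s.Perm t) (b : ℕ) : combSpan K s b = combSpan K t b := by
  have e : {w : List ℕ | w.Perm s} = {w | w.Perm t} :=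
    Set.ext fun w => ⟨fun hw => hw.trans h, fun hw => hw.trans h.symm⟩
  rw [combSpan, e, combSpan]

theorem combSpan_le {s : List ℕ} {b : ℕ} {S : Submodule K (WordAlg K)}
    (h : ∀ cs : List ℕ, cs.Perm s → (comb cs b).eval K ∈ S) : combSpan K s b ≤ S := by
  refine Submodule.span_le.2 ?_
  rintro _ ⟨cs, hcs, rfl⟩
  exact h cs hcs

theorem lie_mem_combSpan (Y : LTree) (s : List ℕ) {b : ℕ} {z : WordAlg K}
    (hz : z ∈ combSpan K s b) : ⁅Y.eval K, z⁆ ∈ combSpan K (Y.leaves ++ s) b := by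
  induction Y generalizing s z with
  | leaf a =>
    refine Submodule.span_induction (p := fun z _ => ⁅(leaf a).eval K, z⁆ ∈ combSpan K _ b)
      ?_ ?_ ?_ ?_ hz
    · rintro _ ⟨cs, hcs, rfl⟩
      exact Submodule.subset_span ⟨a :: cs, List.Perm.cons a hcs, rfl⟩
    · simp [Ring.lie_def]
    · intro x y _ _ hx hy
      have e : ⁅(leaf a).eval K, x + y⁆ = ⁅(leaf a).eval K, x⁆ + ⁅(leaf a).eval K, y⁆ := by
        simp only [Ring.lie_def]; noncomm_ring
      exact e ▸ add_mem hx hy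
    · intro r x _ hx
      have e : ⁅(leaf a).eval K, r • x⁆ = r • ⁅(leaf a).eval K, x⁆ := by
        simp only [Ring.lie_def, mul_smul_comm, smul_mul_assoc, smul_sub]
      exact e ▸ Submodule.smul_mem _ _ hx
  | node l r hl hr =>
    have e : ⁅(node l r).eval K, z⁆ =
        ⁅l.eval K, ⁅r.eval K, z⁆⁆ - ⁅r.eval K, ⁅l.eval K, z⁆⁆ := by
      simp only [eval, Ring.lie_def]; noncomm_ring
    rw [e]
    refine sub_mem ?_ ?_
    · have := hl _ (hr _ hz)
      rwa [← List.append_assoc] at this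
    · have := hr _ (hl _ hz)
      rw [← List.append_assoc] at this
      rwa [combSpan_congr (List.perm_append_comm.append_right s)] at this

/-- A tree is a linear combination of combs with any given leaf innermost. -/
theorem eval_mem_combSpan {X : LTree} {b : ℕ} {s : List ℕ} (h : X.leaves.Perm (b :: s)) :
    X.eval K ∈ combSpan K s b := by
  induction X generalizing s with
  | leaf a =>
    obtain ⟨rfl, rfl⟩ : a = b ∧ s = [] := by
      have := List.perm_singleton.1 h.symm
      simp_all
    exact Submodule.subset_span ⟨[], List.Perm.refl _, rfl⟩
  | node l r hl hr =>
    have hb : b ∈ l.leaves ++ r.leaves := h.symm.subset (by simp)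
    simp only [leaves] at h
    rcases List.mem_append.1 hb with hb | hb
    · have hp := List.perm_cons_erase hb
      have hs : (r.leaves ++ l.leaves.erase b).Perm s :=
        (List.perm_append_comm.trans
          ((List.perm_cons b).1 ((hp.symm.append_right r.leaves).trans h)))
      rw [eval, lie_eq_neg, ← combSpan_congr hs]
      exact neg_mem (lie_mem_combSpan r _ (hl hp))
    · have hp := List.perm_cons_erase hb
      have hs : (l.leaves ++ r.leaves.erase b).Perm s :=
        (List.perm_cons b).1 ((List.perm_middle.symm.trans (hp.symm.append_left l.leaves)).trans h)
      rw [eval, ← combSpan_congr hs]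
      exact lie_mem_combSpan l _ (hr hp)

end LTree

/-! ### Tails commute with closed trees -/

section Closed

variable {K : Type u} [Field K]

theorem exists_append_of_mem_heads {a : ℕ} {l : List Letter} (h : a ∈ heads l) :
    ∃ s t, l = s ++ head a :: t := by
  obtain ⟨b, hb, hb'⟩ := List.mem_filterMap.1 h
  cases b with
  | head e =>
    obtain rfl : e = a := by simpa [Letter.head?] using hb'
    exact List.append_of_mem hb
  | tail e => simp [Letter.head?] at hb'

theorem ev_eq_zero {s : List Letter} (hs : ¬ Valid s) {x : WordAlg K} (hx : x ∈ permSpan K s) :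
    ev x = 0 :=
  permSpan_induction (P := fun x => ev x = 0)
    (fun w hw => by rw [ev_wd, Aw.mk_of_not_valid fun h => hs (h.of_perm hw)]) (map_zero _)
    (fun x y hx hy => by rw [map_add, hx, hy, add_zero])
    (fun r x hx => by rw [map_smul, hx, smul_zero]) hx

theorem ev_eq_zero_of_words {y : WordAlg K} (h : ∀ u v, ev (wd K u * y * wd K v) = 0)
    (u v : WordAlg K) : ev (u * y * v) = 0 := by
  simpa using ev_eq_of_words (y := y) (z := 0) (fun u v => by simpa using h u v) u v

theorem ev_lie_tails_swap (X : WordAlg K) (a b : ℕ) (u v : WordAlg K) :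
    ev (u * ⁅⁅X, tl K a⁆, tl K b⁆ * v) = ev (u * ⁅⁅X, tl K b⁆, tl K a⁆ * v) := by
  have h1 := ev_tails (u * X) v a b
  have h2 := ev_tails u (X * v) a b
  rw [← sub_eq_zero, ← map_sub]
  have e : u * ⁅⁅X, tl K a⁆, tl K b⁆ * v - u * ⁅⁅X, tl K b⁆, tl K a⁆ * v =
      (u * X * (tl K a * tl K b) * v - u * X * (tl K b * tl K a) * v)
      - (u * (tl K a * tl K b) * (X * v) - u * (tl K b * tl K a) * (X * v)) := by
    simp only [Ring.lie_def]; noncomm_ring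
  rw [e, map_sub, map_sub, map_sub, h1, h2, sub_self, sub_self, sub_self]

theorem LTree.lie_lie_tail_mem_permSpan (X : LTree) (a b : ℕ) (u v : List Letter) :
    wd K u * ⁅⁅X.eval K, tl K a⁆, tl K b⁆ * wd K v ∈
      permSpan K (u ++ (X.leaves.map head ++ [tail a] ++ [tail b]) ++ v) :=
  mul_mem_permSpan (mul_mem_permSpan (wd_mem_permSpan _) (lie_mem_permSpan
    (lie_mem_permSpan X.eval_mem_permSpan (wd_mem_permSpan _)) (wd_mem_permSpan _)))
    (wd_mem_permSpan _)

/-- The tail of `b` commutes with the commutator of a tree and a tail if `b` is not a leaf of the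
tree: both products are equal to the same diagram with the tree attached to the arrow `b`. -/
theorem ev_lie_lie_tail_of_notMem {X : LTree} {b : ℕ} (hb : b ∉ X.leaves) (a : ℕ)
    (u v : WordAlg K) : ev (u * ⁅⁅X.eval K, tl K a⁆, tl K b⁆ * v) = 0 := by
  refine ev_eq_zero_of_words (fun u v => ?_) u v
  have hX : Slides b (X.eval K) := LTree.slides_eval hb
  rw [ev_lie_tails_swap]
  have e : ∀ u v : WordAlg K, u * ⁅⁅X.eval K, tl K b⁆, tl K a⁆ * v =
      u * ⁅X.eval K, tl K b⁆ * (tl K a * v) - u * tl K a * ⁅X.eval K, tl K b⁆ * v := fun u v => by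
    simp only [Ring.lie_def]; noncomm_ring
  by_cases hv : b ∈ heads v
  · obtain ⟨v₁, v₂, rfl⟩ := exists_append_of_mem_heads hv
    have h1 := hX.1.eq (wd K u) (tl K a * wd K v₁) (wd K v₂)
    have h2 := hX.1.eq (wd K u * tl K a) (wd K v₁) (wd K v₂)
    have h3 := ev_tails (wd K u) (wd K v₁ * ⁅X.eval K, hd K b⁆ * wd K v₂) a b
    rw [e, wd_append, wd_cons, map_sub]
    simp only [mul_assoc] at h1 h2 h3 ⊢
    rw [h1, h2, h3, sub_self]
  · by_cases hu : b ∈ heads u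
    · obtain ⟨u₁, u₂, rfl⟩ := exists_append_of_mem_heads hu
      have h1 := hX.2.eq (wd K u₁) (wd K u₂) (tl K a * wd K v)
      have h2 := hX.2.eq (wd K u₁) (wd K u₂ * tl K a) (wd K v)
      have h3 := ev_tails (wd K u₁ * ⁅X.eval K, hd K b⁆ * wd K u₂) (wd K v) a b
      rw [e, wd_append, wd_cons, map_sub]
      simp only [mul_assoc] at h1 h2 h3 ⊢
      rw [← neg_eq_iff_eq_neg.2 h1, ← neg_eq_iff_eq_neg.2 h2, h3, sub_self]
    · refine ev_eq_zero (fun h => ?_) (X.lie_lie_tail_mem_permSpan b a u v)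
      have := h.2.subset (show b ∈ tails _ by simp)
      simp_all

/-- The tails of two leaves of a comb commute with each other's commutators with the comb. The
leaves of the comb are moved, innermost first, to the tail of the innermost leaf `d`, until one of
`a` and `b` has been moved. -/
theorem ev_lie_lie_tail_comb {cs : List ℕ} {a b d : ℕ} (hd : (cs ++ [d]).Nodup) (ha : a ∈ cs)
    (hb : b ∈ cs) (hab : a ≠ b) (u v : WordAlg K) :
    ev (u * ⁅⁅(LTree.comb cs d).eval K, tl K a⁆, tl K b⁆ * v) = 0 := by
  induction cs using List.reverseRecOn generalizing u v with
  | nil => simp at ha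
  | append_singleton cs c ih =>
    have hcs : (cs ++ [d]).Nodup := by
      simp only [List.nodup_append] at hd ⊢
      simp_all
    have hd' : d ∉ cs := fun h => (List.nodup_append.1 hcs).2.2 d h d (by simp) rfl
    have hcd : c ≠ d := (List.nodup_append.1 hd).2.2 c (by simp) d (by simp)
    have hc : c ∉ cs := fun h =>
      (List.nodup_append.1 (List.nodup_append.1 hd).1).2.2 c h c (by simp) rfl
    have hleaves := LTree.leaves_comb cs d
    have key : ∀ u v : WordAlg K,
        ev (u * ⁅⁅(LTree.comb cs d).eval K, tl K a⁆, tl K b⁆ * v) = 0 := by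
      intro u v
      rcases eq_or_ne c b with rfl | hcb
      · exact ev_lie_lie_tail_of_notMem (by simp [hleaves, hc, hcd]) a u v
      · rcases eq_or_ne c a with rfl | hca
        · rw [ev_lie_tails_swap]
          exact ev_lie_lie_tail_of_notMem (by simp [hleaves, hc, hcd]) b u v
        · refine ih hcs ?_ ?_ u v <;> simp_all [eq_comm]
    rw [LTree.comb_concat hd']
    refine ev_eq_zero_of_words (fun u v => ?_) u v
    have hdc : d ∉ (LTree.leaf c).leaves := by simpa [LTree.leaves] using Ne.symm hcd
    have hdl : d ∈ (LTree.comb cs d).leaves := by simp [hleaves]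
    have hn : (LTree.comb cs d).leaves.Nodup := hleaves ▸ hcs
    by_cases hu : d ∈ tails u
    · obtain ⟨u₁, u₂, rfl⟩ := exists_append_of_mem_tails hu
      have h1 := (((LTree.balanced_attach_right (K := K) hdc hdl hn).lie_right (tl K a)).lie_right
        (tl K b)).eq (wd K u₁) (wd K u₂) (wd K v)
      rw [key, eq_comm, neg_eq_zero] at h1
      rw [wd_append, wd_cons, ← mul_assoc]
      exact h1
    · by_cases hv : d ∈ tails v
      · obtain ⟨v₁, v₂, rfl⟩ := exists_append_of_mem_tails hv
        have h1 := (((LTree.balanced_attach_left (K := K) hdc hdl hn).lie_left (tl K a)).lie_left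
          (tl K b)).eq (wd K u) (wd K v₁) (wd K v₂)
        rw [mul_assoc _ (wd K v₁), mul_assoc _ (wd K v₁), mul_assoc (wd K u * _),
          mul_assoc (wd K u * _), key, neg_zero] at h1
        rw [wd_append, wd_cons]
        simpa only [mul_assoc] using h1
      · refine ev_eq_zero (fun h => ?_) (LTree.lie_lie_tail_mem_permSpan _ a b u v)
        have hx : d ∈ ((LTree.comb cs d).attach (LTree.leaf c) d).leaves := by
          rw [← LTree.comb_concat hd', LTree.leaves_comb]; simp
        have := h.2.symm.subset (show d ∈ heads _ by simp [hx])
        have hda : d ≠ a := fun h => (List.nodup_append.1 hd).2.2 a ha d (by simp) h.symm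
        have hdb : d ≠ b := fun h => (List.nodup_append.1 hd).2.2 b hb d (by simp) h.symm
        simp_all

theorem ev_eq_zero_of_eq_neg [CharZero K] {x : WordAlg K} (h : ev x = -ev x) : ev x = 0 := by
  have h2 : (2 : K) • ev x = 0 := by rw [two_smul]; nth_rw 2 [h]; exact add_neg_cancel _
  exact (smul_eq_zero.1 h2).resolve_left two_ne_zero

theorem rename_swap_of_notMem {a b : ℕ} {w : List Letter} (ha : ∀ l ∈ w, l.name ≠ a)
    (hb : ∀ l ∈ w, l.name ≠ b) : rename (Equiv.swap a b) w = w :=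
  rename_eq_self fun l hl => Equiv.swap_apply_of_ne_of_ne (ha l hl) (hb l hl)

theorem notMem_names {u s v : List Letter} {a : ℕ} (h : Valid (u ++ s ++ v)) (ht : a ∈ tails s)
    (hh : a ∈ heads s) : (∀ l ∈ u, l.name ≠ a) ∧ ∀ l ∈ v, l.name ≠ a := by
  have h1 := h.1
  have h2 := h.nodup_heads
  simp only [tails_append, heads_append, List.nodup_append, List.mem_append] at h1 h2
  constructor
  · rintro l hl rfl
    rcases mem_names_iff.1 ⟨l, hl, rfl⟩ with h' | h'
    · exact h1.1.2.2 _ h' _ ht rfl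
    · exact h2.1.2.2 _ h' _ hh rfl
  · rintro l hl rfl
    rcases mem_names_iff.1 ⟨l, hl, rfl⟩ with h' | h'
    · exact h1.2.2 _ (Or.inr ht) _ h' rfl
    · exact h2.2.2 _ (Or.inr hh) _ h' rfl

/-- For a tree with the leaves `a` and `b` only, exchanging the names of the leaves is a symmetry of
the diagram that changes its sign. -/
theorem ev_lie_lie_tail_pair [CharZero K] (a b : ℕ) (u v : WordAlg K) :
    ev (u * ⁅⁅(LTree.comb [a] b).eval K, tl K a⁆, tl K b⁆ * v) = 0 := by
  refine ev_eq_zero_of_words (fun u v => ?_) u v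
  have hm := LTree.lie_lie_tail_mem_permSpan (K := K) (LTree.comb [a] b) a b u v
  by_cases h : Valid (u ++ ((LTree.comb [a] b).leaves.map head ++ [tail a] ++ [tail b]) ++ v)
  · have ha := notMem_names (a := a) h (by simp) (by simp [LTree.leaves_comb])
    have hb := notMem_names (a := b) h (by simp) (by simp [LTree.leaves_comb])
    refine ev_eq_zero_of_eq_neg ?_
    conv_lhs => rw [← ev_ren (Equiv.swap a b)]
    rw [map_mul (ren _), map_mul (ren _), ren_wd, ren_wd, rename_swap_of_notMem ha.1 hb.1,
      rename_swap_of_notMem ha.2 hb.2, ren_lie, ren_lie, LTree.ren_eval_comb, ren_wd, ren_wd]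
    simp only [List.map_cons, List.map_nil, Equiv.swap_apply_left, Equiv.swap_apply_right, rename,
      Letter.map]
    have e := LTree.eval_comb_swap (K := K) [] b a
    simp only [List.nil_append] at e
    rw [e, ← map_neg, ← sub_eq_zero, ← map_sub]
    have e' : wd K u * ⁅⁅-(LTree.comb [a] b).eval K, tl K b⁆, tl K a⁆ * wd K v -
        -(wd K u * ⁅⁅(LTree.comb [a] b).eval K, tl K a⁆, tl K b⁆ * wd K v) =
        wd K u * ⁅⁅(LTree.comb [a] b).eval K, tl K a⁆, tl K b⁆ * wd K v -
        wd K u * ⁅⁅(LTree.comb [a] b).eval K, tl K b⁆, tl K a⁆ * wd K v := by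
      simp only [Ring.lie_def]; noncomm_ring
    rw [e', map_sub, ev_lie_tails_swap, sub_self]
  · exact ev_eq_zero h hm

theorem lie_lie_eq_zero_of_combSpan {s : List ℕ} {d a b : ℕ} {X : WordAlg K}
    (hX : X ∈ LTree.combSpan K s d) (u v : WordAlg K)
    (h : ∀ cs : List ℕ, cs.Perm s → ev (u * ⁅⁅(LTree.comb cs d).eval K, tl K a⁆, tl K b⁆ * v) = 0) :
    ev (u * ⁅⁅X, tl K a⁆, tl K b⁆ * v) = 0 := by
  have hle : LTree.combSpan K s d ≤ LinearMap.ker (ev ∘ₗ LinearMap.mulRight K v ∘ₗ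
      LinearMap.mulLeft K u ∘ₗ
        ((LinearMap.mulRight K (tl K b) - LinearMap.mulLeft K (tl K b)) ∘ₗ
          (LinearMap.mulRight K (tl K a) - LinearMap.mulLeft K (tl K a)))) :=
    LTree.combSpan_le fun cs hcs => h cs hcs
  exact hle hX

/-- The tails of two leaves of a tree commute with each other's commutators with the tree. -/
theorem ev_lie_lie_tail_of_mem [CharZero K] {X : LTree} (hX : X.leaves.Nodup) {a b : ℕ}
    (ha : a ∈ X.leaves) (hb : b ∈ X.leaves) (hab : a ≠ b) (u v : WordAlg K) :
    ev (u * ⁅⁅X.eval K, tl K a⁆, tl K b⁆ * v) = 0 := by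
  by_cases hd : ∃ d ∈ X.leaves, d ≠ a ∧ d ≠ b
  · obtain ⟨d, hd, hda, hdb⟩ := hd
    have hp := List.perm_cons_erase hd
    refine lie_lie_eq_zero_of_combSpan (LTree.eval_mem_combSpan hp) u v fun cs hcs => ?_
    refine ev_lie_lie_tail_comb ?_ (hcs.symm.subset ((List.mem_erase_of_ne hda.symm).2 ha))
      (hcs.symm.subset ((List.mem_erase_of_ne hdb.symm).2 hb)) hab u v
    exact (((hcs.append_right [d]).trans (List.perm_append_singleton _ _)).trans hp.symm).nodup_iff.2 hX
  · have hp : X.leaves.Perm [b, a] := by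
      refine (List.perm_ext_iff_of_nodup hX (by simpa using hab.symm)).2 fun d => ?_
      refine ⟨fun h => ?_, fun h => ?_⟩
      · by_contra h'
        exact hd ⟨d, h, by simp_all⟩
      · simp only [List.mem_cons, List.not_mem_nil, or_false] at h
        rcases h with rfl | rfl <;> assumption
    refine lie_lie_eq_zero_of_combSpan (LTree.eval_mem_combSpan hp) u v fun cs hcs => ?_
    rw [List.perm_singleton.1 hcs]
    exact ev_lie_lie_tail_pair a b u v

end Closed

/-! ### Diagrams with a single tree -/

section SingleTree

variable {K : Type u} [Field K] [CharZero K]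

/-- A tree with at least two leaves vanishes if all its tails are to its left: exchanging the two
innermost leaves of a comb changes the sign. -/
theorem ev_tls_tree {X : LTree} (hX : X.leaves.Nodup) (h2 : 2 ≤ X.leaves.length) {P : List ℕ}
    (hP : P.Perm X.leaves) : ev (tls K P * X.eval K) = 0 := by
  obtain ⟨b, s, hbs⟩ : ∃ b s, X.leaves = b :: s := List.exists_cons_of_length_pos (by omega)
  have hle : LTree.combSpan K s b ≤ LinearMap.ker (ev ∘ₗ LinearMap.mulLeft K (tls K P)) := by
    refine LTree.combSpan_le fun cs hcs => ?_
    obtain ⟨cs, c, rfl⟩ : ∃ cs' c, cs = cs' ++ [c] := by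
      have : cs ≠ [] := by
        rintro rfl
        rw [hbs, List.perm_nil.1 (hcs : [].Perm s).symm] at h2
        simp at h2
      exact ⟨_, _, (List.dropLast_append_getLast this).symm⟩
    have hp : P.Perm (cs ++ [c] ++ [b]) :=
      (hP.trans (hbs ▸ (hcs.symm.cons b))).trans (List.perm_append_singleton _ _).symm
    have hn : (cs ++ [c] ++ [b]).Nodup := hp.nodup_iff.1 (hP.nodup_iff.2 hX)
    have hmap : cs.map (Equiv.swap c b) = cs := by
      rw [List.append_assoc, List.nodup_append] at hn
      refine (List.map_congr_left (g := id) fun d hd => ?_).trans (List.map_id _)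
      exact Equiv.swap_apply_of_ne_of_ne (hn.2.2 d hd c (by simp)) (hn.2.2 d hd b (by simp))
    rw [LinearMap.mem_ker, LinearMap.comp_apply, LinearMap.mulLeft_apply]
    refine ev_eq_zero_of_eq_neg ?_
    conv_lhs => rw [← ev_ren (Equiv.swap c b), map_mul (ren _), ren_tls, LTree.ren_eval_comb]
    rw [List.map_append, hmap, List.map_singleton, Equiv.swap_apply_left, Equiv.swap_apply_right,
      LTree.eval_comb_swap, mul_neg, map_neg]
    have hp' : (P.map (Equiv.swap c b)).Perm P := by
      refine (hp.map _).trans (List.Perm.trans ?_ hp.symm)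
      rw [List.map_append, List.map_append, hmap, List.map_singleton, List.map_singleton,
        Equiv.swap_apply_left, Equiv.swap_apply_right, List.append_assoc, List.append_assoc]
      exact (List.Perm.swap _ _ _).append_left cs
    have := ev_tls_perm (K := K) hp' 1 ((LTree.comb (cs ++ [c]) b).eval K)
    rw [one_mul, one_mul] at this
    rw [this]
  exact hle (LTree.eval_mem_combSpan (hbs ▸ List.Perm.refl _))

/-- The wheel with spokes `b` and `cs`, cut open at the spoke `b`: STU turns the wheel into this
combination of arrow diagrams (see `toJacobi_wheelSum`). -/
noncomputable def wheelElt (K : Type u) [Field K] (cs : List ℕ) (b : ℕ) : WordAlg K :=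
  tls K cs * ⁅(LTree.comb cs b).eval K, tl K b⁆

/-- The tails of the leaves other than `b` commute with `⁅X, φ_b⁆`, so that all of them can be moved to
the left. -/
theorem ev_tls_closed_tls {X : LTree} (hX : X.leaves.Nodup) {b : ℕ} (hb : b ∈ X.leaves)
    (A B : List ℕ) (hB : b ∉ B) (hBX : ∀ a ∈ B, a ∈ X.leaves) :
    ev (tls K A * ⁅X.eval K, tl K b⁆ * tls K B) =
      ev (tls K (A ++ B) * ⁅X.eval K, tl K b⁆) := by
  induction B generalizing A with
  | nil => simp
  | cons a B ih =>
    simp only [List.mem_cons, not_or, forall_eq_or_imp] at hB hBX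
    have h1 := ev_lie_lie_tail_of_mem hX hb hBX.1 hB.1 (tls K A) (tls K B)
    have e : tls K A * ⁅⁅X.eval K, tl K b⁆, tl K a⁆ * tls K B =
        tls K A * ⁅X.eval K, tl K b⁆ * tls K (a :: B) -
          tls K (A ++ [a]) * ⁅X.eval K, tl K b⁆ * tls K B := by
      simp only [tls_append, tls_cons, tls_nil, Ring.lie_def]; noncomm_ring
    rw [e, map_sub, sub_eq_zero, ih _ hB.2 hBX.2] at h1
    rw [h1, List.append_assoc, List.singleton_append]

/-- A diagram with a single tree and at least two arrows is a linear combination of wheels. -/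
theorem ev_single_tree_mem {S : Submodule K (Aw K)} {X : LTree} (h2 : 2 ≤ X.leaves.length)
    (hS : ∀ (cs : List ℕ) (b : ℕ), (b :: cs).Perm X.leaves → ev (wheelElt K cs b) ∈ S)
    (A B : List ℕ) (hAB : (A ++ B).Perm X.leaves) (hX : X.leaves.Nodup) :
    ev (tls K A * X.eval K * tls K B) ∈ S := by
  induction B generalizing A with
  | nil =>
    rw [tls_nil, mul_one, ev_tls_tree hX h2 (by simpa using hAB)]
    exact zero_mem _
  | cons b B ih =>
    have hb : b ∈ X.leaves := hAB.subset (by simp)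
    have hn := hAB.nodup_iff.2 hX
    have hbB : b ∉ B := (List.nodup_cons.1 (List.nodup_append.1 hn).2.1).1
    have hBX : ∀ a ∈ B, a ∈ X.leaves := fun a ha => hAB.subset (by simp [ha])
    have e : tls K A * X.eval K * tls K (b :: B) =
        tls K (A ++ [b]) * X.eval K * tls K B + tls K A * ⁅X.eval K, tl K b⁆ * tls K B := by
      simp only [tls_append, tls_cons, tls_nil, Ring.lie_def]; noncomm_ring
    rw [e, map_add]
    refine add_mem (ih _ (by simpa using hAB)) ?_
    rw [ev_tls_closed_tls hX hb A B hbB hBX]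
    have hp : X.leaves.Perm (b :: (A ++ B)) := hAB.symm.trans List.perm_middle
    have hle : LTree.combSpan K (A ++ B) b ≤ S.comap (ev ∘ₗ LinearMap.mulLeft K (tls K (A ++ B)) ∘ₗ
        (LinearMap.mulRight K (tl K b) - LinearMap.mulLeft K (tl K b))) := by
      refine LTree.combSpan_le fun cs hcs => ?_
      have h1 := hS cs b ((hcs.cons b).trans hp.symm)
      have h3 := ev_tls_perm (K := K) hcs 1 ⁅(LTree.comb cs b).eval K, tl K b⁆
      rw [one_mul, one_mul] at h3
      rw [wheelElt, h3] at h1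
      exact h1
    exact hle (LTree.eval_mem_combSpan hp)

end SingleTree

/-! ### Wheels and central elements -/

section Central

variable {K : Type u} [Field K]

/-- A property of the elements of the algebra of arrow diagrams can be checked on diagrams. -/
theorem Aw.induction {P : Aw K → Prop} (hmk : ∀ w, Valid w → P (Aw.mk K w))
    (hadd : ∀ x y, P x → P y → P (x + y)) (hsmul : ∀ (r : K) x, P x → P (r • x)) (x : Aw K) :
    P x := by
  obtain ⟨y, rfl⟩ := RingQuot.mkAlgHom_surjective K (Rel K) x
  refine MonoidAlgebra.induction_on (motive := fun y => P (RingQuot.mkAlgHom K (Rel K) y)) y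
    (fun D => ?_) (fun a b ha hb => ?_) (fun r a ha => ?_)
  · induction D using ArrowDiagram.ind with
    | h w hw =>
      have := hmk w hw
      rwa [Aw.mk_of_valid K hw] at this
  · rw [map_add]
    exact hadd _ _ ha hb
  · rw [map_smul]
    exact hsmul _ _ ha

theorem exists_perm_map_eq {l l' : List ℕ} (h : l.Nodup) (h' : l'.Nodup)
    (hlen : l.length = l'.length) : ∃ f : Equiv.Perm ℕ, l.map f = l' := by
  obtain ⟨f, hf⟩ := MulAction.isMultiplyPretransitive_iff.1
    (Equiv.Perm.isMultiplyPretransitive ℕ l.length)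
    ⟨fun i => l.get i, List.nodup_iff_injective_get.1 h⟩
    ⟨fun i => l'.get (i.cast hlen), fun i j hij => by
      simpa using List.nodup_iff_injective_get.1 h' hij⟩
  refine ⟨f, List.ext_get (by simpa using hlen) fun n h1 h2 => ?_⟩
  have := DFunLike.congr_fun hf ⟨n, by simpa using h1⟩
  simpa using this

theorem ren_wheelElt (f : ℕ → ℕ) (cs : List ℕ) (b : ℕ) :
    ren f (wheelElt K cs b) = wheelElt K (cs.map f) (f b) := by
  rw [wheelElt, map_mul, ren_tls, ren_lie, LTree.ren_eval_comb, ren_wd, wheelElt]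
  rfl

theorem ev_wheelElt_eq {cs cs' : List ℕ} {b b' : ℕ} (h : (b :: cs).Nodup) (h' : (b' :: cs').Nodup)
    (hlen : cs.length = cs'.length) : ev (wheelElt K cs b) = ev (wheelElt K cs' b') := by
  obtain ⟨f, hf⟩ := exists_perm_map_eq h h' (by simp [hlen])
  rw [List.map_cons, List.cons.injEq] at hf
  rw [← ev_ren f, ren_wheelElt, hf.1, hf.2]

/-- The names `2 (j - 1), …, 2, 0` of the spokes of a wheel, apart from the last spoke. -/
def spokes : ℕ → List ℕ
  | 0 => []
  | j + 1 => 2 * j :: spokes j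

theorem length_spokes (j : ℕ) : (spokes j).length = j := by
  induction j with
  | zero => rfl
  | succ j ih => simp [spokes, ih]

theorem mem_spokes {j n : ℕ} : n ∈ spokes j ↔ ∃ i < j, n = 2 * i := by
  induction j with
  | zero => simp [spokes]
  | succ j ih =>
    rw [spokes, List.mem_cons, ih]
    constructor
    · rintro (rfl | ⟨i, hi, rfl⟩)
      · exact ⟨j, by omega, rfl⟩
      · exact ⟨i, by omega, rfl⟩
    · rintro ⟨i, hi, rfl⟩
      rcases Nat.lt_succ_iff_lt_or_eq.1 hi with h | rfl
      · exact Or.inr ⟨i, h, rfl⟩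
      · exact Or.inl rfl

theorem nodup_spokes (j : ℕ) : (spokes j).Nodup := by
  induction j with
  | zero => exact List.nodup_nil
  | succ j ih =>
    refine List.nodup_cons.2 ⟨fun h => ?_, ih⟩
    obtain ⟨i, hi, h⟩ := mem_spokes.1 h
    omega

theorem nodup_cons_spokes (j : ℕ) : (1 :: spokes j).Nodup := by
  refine List.nodup_cons.2 ⟨fun h => ?_, nodup_spokes j⟩
  obtain ⟨i, hi, h⟩ := mem_spokes.1 h
  omega

variable (K) in
/-- The wheel with `j + 1` spokes, as a combination of arrow diagrams. -/
noncomputable def wheelSum (j : ℕ) : Aw K := ev (wheelElt K (spokes j) 1)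

theorem ev_wheelElt {cs : List ℕ} {b : ℕ} (h : (b :: cs).Nodup) :
    ev (wheelElt K cs b) = wheelSum K cs.length :=
  ev_wheelElt_eq h (nodup_cons_spokes _) (length_spokes _).symm

theorem wheelSum_zero : wheelSum K 0 = Aw.mk K [head 0, tail 0] - Aw.mk K [tail 0, head 0] := by
  have h := ev_wheelElt (K := K) (cs := []) (b := 0) (by simp)
  rw [List.length_nil] at h
  rw [← h, wheelElt, tls_nil, one_mul, Ring.lie_def, map_sub]
  simp only [LTree.comb, LTree.eval, ← wd_append, ev_wd]
  rfl

/-- The word of the letters of a wheel, in some order. -/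
def wheelLetters (cs : List ℕ) (b : ℕ) : List Letter :=
  cs.map tail ++ ((cs ++ [b]).map head ++ [tail b])

theorem tails_wheelLetters (cs : List ℕ) (b : ℕ) : tails (wheelLetters cs b) = cs ++ [b] := by
  simp only [wheelLetters, tails_append, tails_map_tail, tails_map_head]
  rfl

theorem valid_wheelLetters {cs : List ℕ} {b : ℕ} (h : (b :: cs).Nodup) :
    Valid (wheelLetters cs b) := by
  have hp : (cs ++ [b]).Perm (b :: cs) := List.perm_append_singleton _ _
  refine ⟨?_, ?_⟩
  · rw [tails_wheelLetters]
    exact hp.nodup_iff.2 h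
  · rw [tails_wheelLetters]
    simp only [wheelLetters, heads_append, heads_map_tail, heads_map_head]
    simp

theorem wheelElt_mem_permSpan (cs : List ℕ) (b : ℕ) :
    wheelElt K cs b ∈ permSpan K (wheelLetters cs b) := by
  refine mul_mem_permSpan ?_ (lie_mem_permSpan ?_ (wd_mem_permSpan _))
  · rw [tls_eq_wd]
    exact wd_mem_permSpan _
  · rw [← LTree.leaves_comb]
    exact LTree.eval_mem_permSpan _

/-- The part of the commutator `⁅x_a, s⁆` that comes from the ends of the arrow `c`. -/
noncomputable def headDer (a c : ℕ) : List Letter → WordAlg K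
  | [] => 0
  | l :: s => (if l.name = c then ⁅hd K a, wd K [l]⁆ else 0) * wd K s + wd K [l] * headDer a c s

theorem headDer_of_notMem (a : ℕ) {c : ℕ} {s : List Letter} (h : ∀ l ∈ s, l.name ≠ c) :
    headDer (K := K) a c s = 0 := by
  induction s with
  | nil => rfl
  | cons l s ih =>
    rw [headDer, if_neg (h l (by simp)), ih fun m hm => h m (by simp [hm])]
    simp

theorem headDer_append (a c : ℕ) (s t : List Letter) :
    headDer (K := K) a c (s ++ t) = headDer a c s * wd K t + wd K s * headDer a c t := by
  induction s with
  | nil => simp [headDer, wd_nil]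
  | cons l s ih =>
    rw [List.cons_append, headDer, headDer, ih, wd_append, wd_cons K l s]
    noncomm_ring

theorem sum_headDer (a : ℕ) (s : List Letter) (C : Finset ℕ) (h : ∀ l ∈ s, l.name ∈ C) :
    ∑ c ∈ C, headDer (K := K) a c s = ⁅hd K a, wd K s⁆ := by
  induction s with
  | nil => simp [headDer, wd_nil, Ring.lie_def]
  | cons l s ih =>
    simp only [headDer, Finset.sum_add_distrib, ← Finset.sum_mul, ← Finset.mul_sum,
      ih fun m hm => h m (by simp [hm])]
    rw [Finset.sum_ite_eq, if_pos (h l (by simp)), wd_cons K l s]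
    simp only [Ring.lie_def]
    noncomm_ring

theorem ev_headDer {a c : ℕ} (hac : a ≠ c) {s : List Letter} (hs : Valid s) (u v : WordAlg K) :
    ev (u * headDer a c s * v) = 0 := by
  by_cases hc : c ∈ tails s
  · obtain ⟨s₁, s₂, rfl⟩ := exists_append_of_mem_tails hc
    have hh := hs.2.mem_iff.1 hc
    have h1 := hs.1
    have h2 := hs.nodup_heads
    have hn : ∀ w : List Letter, c ∉ tails w → c ∉ heads w → ∀ l ∈ w, l.name ≠ c := by
      rintro w hw hw' l hl rfl
      exact (mem_names_iff.1 ⟨l, hl, rfl⟩).elim hw hw'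
    rw [heads_append, heads_cons_tail, List.mem_append] at hh
    rcases hh with hh | hh
    · obtain ⟨t₁, t₂, rfl⟩ := exists_append_of_mem_heads hh
      simp only [tails_append, heads_append, tails_cons_tail, tails_cons_head, heads_cons_tail,
        heads_cons_head, List.nodup_append, List.nodup_cons, List.mem_append, List.mem_cons] at h1 h2
      have e1 := headDer_of_notMem (K := K) a (hn t₁ (by grind) (by grind))
      have e2 := headDer_of_notMem (K := K) a (hn t₂ (by grind) (by grind))
      have e3 := headDer_of_notMem (K := K) a (hn s₂ (by grind) (by grind))
      rw [List.append_assoc, headDer_append, e1, List.cons_append, headDer, headDer_append, e2,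
        headDer, e3, if_pos (name_head c), if_pos (name_tail c), wd_append, wd_cons K (tail c)]
      rw [← (slides_hd hac).2 (u * wd K t₁) (wd K t₂) (wd K s₂ * v)]
      congr 1
      noncomm_ring
    · obtain ⟨t₁, t₂, rfl⟩ := exists_append_of_mem_heads hh
      simp only [tails_append, heads_append, tails_cons_tail, tails_cons_head, heads_cons_tail,
        heads_cons_head, List.nodup_append, List.nodup_cons, List.mem_append, List.mem_cons] at h1 h2
      have e1 := headDer_of_notMem (K := K) a (hn t₁ (by grind) (by grind))
      have e2 := headDer_of_notMem (K := K) a (hn t₂ (by grind) (by grind))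
      have e3 := headDer_of_notMem (K := K) a (hn s₁ (by grind) (by grind))
      rw [headDer_append, e3, headDer, headDer_append, e1,
        headDer, e2, if_pos (name_tail c), if_pos (name_head c), wd_append, wd_cons K (head c)]
      rw [← (slides_hd hac).1 (u * wd K s₁) (wd K t₁) (wd K t₂ * v)]
      congr 1
      noncomm_ring
  · rw [headDer_of_notMem a fun l hl h => hc (by rw [← h]; exact hs.name_mem hl)]
    simp

/-- The head of an arrow commutes with a piece of the skeleton that meets no other part of the
diagram: the sum over the arrows of the piece of the corollary of 6T in `slides_hd`. -/
theorem ev_lie_head {s : List Letter} (hs : Valid s) {a : ℕ} (ha : a ∉ tails s) {y : WordAlg K}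
    (hy : y ∈ permSpan K s) (u v : WordAlg K) : ev (u * ⁅hd K a, y⁆ * v) = 0 := by
  refine permSpan_induction (P := fun y => ev (u * ⁅hd K a, y⁆ * v) = 0) (fun w hw => ?_) ?_ ?_ ?_ hy
  · have hv : Valid w := hs.of_perm hw.symm
    rw [← sum_headDer a w (tails w).toFinset fun l hl => List.mem_toFinset.2 (hv.name_mem hl),
      Finset.mul_sum, Finset.sum_mul, map_sum]
    refine Finset.sum_eq_zero fun c hc => ev_headDer ?_ hv u v
    rintro rfl
    exact ha ((tails_perm hw).mem_iff.1 (List.mem_toFinset.1 hc))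
  · simp [Ring.lie_def]
  · intro x y hx hy
    rw [← add_zero (0 : Aw K)]
    nth_rw 1 [← hx]
    rw [← hy, ← map_add]
    congr 1
    simp only [Ring.lie_def]
    noncomm_ring
  · intro r x hx
    rw [← smul_zero r, ← hx, ← map_smul]
    congr 1
    simp only [Ring.lie_def, mul_smul_comm, smul_mul_assoc, ← smul_sub]

/-- An element with which tails commute in every context is central. -/
theorem ev_mem_center {s : List Letter} (hs : Valid s) {y : WordAlg K} (hy : y ∈ permSpan K s)
    (ht : ∀ a, a ∉ tails s → ∀ u v, ev (u * ⁅tl K a, y⁆ * v) = 0) :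
    ev y ∈ Subalgebra.center K (Aw K) := by
  have hl : ∀ l : Letter, l.name ∉ tails s → ∀ u v : WordAlg K,
      ev (u * wd K [l] * y * v) = ev (u * y * wd K [l] * v) := by
    intro l hl u v
    have h : ev (u * ⁅wd K [l], y⁆ * v) = 0 := by
      cases l with
      | tail a => exact ht a hl u v
      | head a => exact ev_lie_head hs hl hy u v
    rw [← sub_eq_zero, ← map_sub, ← h]
    congr 1
    simp only [Ring.lie_def]
    noncomm_ring
  have hw : ∀ w : List Letter, (∀ l ∈ w, l.name ∉ tails s) → ∀ u : WordAlg K,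
      ev (u * wd K w * y) = ev (u * y * wd K w) := by
    intro w
    induction w with
    | nil => simp [wd_nil]
    | cons l w ih =>
      intro h u
      rw [wd_cons K l w, ← mul_assoc, ih (fun m hm => h m (by simp [hm])), ← mul_assoc,
        ← hl l (h l (by simp))]
  rw [Subalgebra.mem_center_iff]
  intro x
  refine Aw.induction (P := fun x => x * ev y = ev y * x) (fun w hv => ?_)
    (fun a b ha hb => by rw [add_mul, mul_add, ha, hb])
    (fun r a ha => by rw [smul_mul_assoc, mul_smul_comm, ha]) x
  -- The names of `w` are shifted beyond those of `s`.
  set N := (tails s).sum + 1 with hN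
  have hr : Renamed w (rename (fun n => n + N) w) := by
    refine ⟨fun n => n + N, fun n => n - N, rfl, ?_⟩
    rw [rename_rename]
    exact (rename_eq_self fun a _ => by omega).symm
  have hd : ∀ n ∈ tails (rename (fun n => n + N) w), n ∉ tails s := by
    intro n hn hn'
    rw [tails_rename, List.mem_map] at hn
    obtain ⟨m, -, rfl⟩ := hn
    have := List.single_le_sum (l := tails s) (fun _ _ => Nat.zero_le _) _ hn'
    omega
  have hv' := hr.valid hv
  rw [Aw.mk_renamed K hr, ← ev_wd, ← ev_mul hv' hs hd (wd_mem_permSpan _) hy,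
    ← ev_mul hs hv' (fun n hn hn' => hd n hn' hn) hy (wd_mem_permSpan _)]
  simpa using hw _ (fun l hl => hd _ (hv'.name_mem hl)) 1

theorem ev_wheelElt_mem_center {cs : List ℕ} {b : ℕ} (h : (b :: cs).Nodup) :
    ev (wheelElt K cs b) ∈ Subalgebra.center K (Aw K) := by
  refine ev_mem_center (valid_wheelLetters h) (wheelElt_mem_permSpan cs b) fun a ha u v => ?_
  rw [tails_wheelLetters] at ha
  have h1 := ev_lie_lie_tail_of_notMem (K := K) (X := LTree.comb cs b) (b := a)
    (by rwa [LTree.leaves_comb]) b (u * tls K cs) v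
  have hp : (cs ++ [a]).Perm (a :: cs) := List.perm_append_singleton _ _
  have h2 := ev_tls_perm (K := K) hp u (⁅(LTree.comb cs b).eval K, tl K b⁆ * v)
  rw [tls_append, tls_cons, tls_cons, tls_nil, mul_one] at h2
  rw [← sub_eq_zero, ← map_sub] at h2
  have e : u * ⁅tl K a, wheelElt K cs b⁆ * v =
      -(u * tls K cs * ⁅⁅(LTree.comb cs b).eval K, tl K b⁆, tl K a⁆ * v) -
        (u * (tls K cs * tl K a) * (⁅(LTree.comb cs b).eval K, tl K b⁆ * v) -
          u * (tl K a * tls K cs) * (⁅(LTree.comb cs b).eval K, tl K b⁆ * v)) := by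
    rw [wheelElt, Ring.lie_def (tl K a), Ring.lie_def _ (tl K a)]
    noncomm_ring
  rw [e, map_sub, map_neg, h1, h2, neg_zero, sub_zero]

theorem wheelSum_mem_center (j : ℕ) : wheelSum K j ∈ Subalgebra.center K (Aw K) :=
  ev_wheelElt_mem_center (nodup_cons_spokes j)

/-- The tails of two arrows being adjacent, the commutator of their heads vanishes: it changes its
sign when the two arrows are exchanged. -/
theorem ev_tails_lie_heads [CharZero K] (a b : ℕ) (u v w : List Letter) :
    ev (wd K u * (tl K a * tl K b) * wd K v * ⁅hd K a, hd K b⁆ * wd K w) = 0 ∧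
      ev (wd K u * ⁅hd K a, hd K b⁆ * wd K v * (tl K a * tl K b) * wd K w) = 0 := by
  by_cases h : ∀ l ∈ u ++ v ++ w, l.name ≠ a ∧ l.name ≠ b
  · have hr : ∀ z : List Letter, (∀ l ∈ z, l ∈ u ++ v ++ w) →
        rename (Equiv.swap a b) z = z := fun z hz =>
      rename_swap_of_notMem (fun l hl => (h l (hz l hl)).1) fun l hl => (h l (hz l hl)).2
    have hu := hr u (by simp +contextual)
    have hv := hr v (by simp +contextual)
    have hw := hr w (by simp +contextual)
    have ht : ∀ c, ren (Equiv.swap a b) (tl K c) = tl K (Equiv.swap a b c) :=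
      fun c => ren_wd _ _
    have hh : ∀ c, ren (Equiv.swap a b) (hd K c) = hd K (Equiv.swap a b c) :=
      fun c => ren_wd _ _
    constructor
    · refine ev_eq_zero_of_eq_neg ?_
      conv_lhs => rw [← ev_ren (Equiv.swap a b)]
      simp only [map_mul (ren _), ren_lie, ht, hh, Equiv.swap_apply_left,
        Equiv.swap_apply_right]
      rw [ren_wd, ren_wd, ren_wd, hu, hv, hw, lie_eq_neg, ← map_neg]
      have := ev_tails (wd K u) (wd K v * -⁅hd K a, hd K b⁆ * wd K w) b a
      simpa only [mul_assoc, mul_neg, neg_mul] using this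
    · refine ev_eq_zero_of_eq_neg ?_
      conv_lhs => rw [← ev_ren (Equiv.swap a b)]
      simp only [map_mul (ren _), ren_lie, ht, hh, Equiv.swap_apply_left,
        Equiv.swap_apply_right]
      rw [ren_wd, ren_wd, ren_wd, hu, hv, hw, lie_eq_neg, ← map_neg]
      have := ev_tails (wd K u * -⁅hd K a, hd K b⁆ * wd K v) (wd K w) b a
      simpa only [mul_assoc, mul_neg, neg_mul] using this
  · have hz : ∀ z : List Letter,
        z.Perm (u ++ v ++ w ++ [tail a, tail b, head a, head b]) → Aw.mk K z = 0 := by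
      refine fun z hz => Aw.mk_of_not_valid fun hv => h fun l hl => ?_
      have hv' : Valid (u ++ v ++ w ++ [tail a, tail b, head a, head b] ++ []) := by
        simpa only [List.append_nil] using hv.of_perm hz
      exact ⟨(notMem_names (a := a) hv' (by simp) (by simp)).1 l hl,
        (notMem_names (a := b) hv' (by simp) (by simp)).1 l hl⟩
    constructor <;>
    · simp only [Ring.lie_def, mul_sub, sub_mul, map_sub, ← wd_append, ev_wd]
      rw [hz, hz, sub_zero]
      all_goals
        rw [← Multiset.coe_eq_coe]
        simp only [← Multiset.coe_add, ← Multiset.cons_coe, ← Multiset.singleton_add,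
          Multiset.coe_nil]
        abel

theorem mk_dR_mem_center [CharZero K] :
    Aw.mk K [tail 0, head 0] ∈ Subalgebra.center K (Aw K) := by
  rw [← ev_wd]
  refine ev_mem_center ⟨by simp, by simp⟩ (wd_mem_permSpan _) fun a ha => ev_eq_zero_of_words ?_
  intro u v
  -- The tail of `a` passes the tail of the arrow `0` by TC, and its head at the cost of a commutator
  -- of the heads of `0` and `a`, which vanishes as the tails have become adjacent.
  have ha0 : 0 ≠ a := by simpa [eq_comm] using ha
  have h1 := ev_tails (wd K u) (hd K 0 * wd K v) a 0
  have e : wd K u * ⁅tl K a, wd K [tail 0, head 0]⁆ * wd K v =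
      (wd K u * (tl K a * tl K 0) * (hd K 0 * wd K v)
        - wd K u * (tl K 0 * tl K a) * (hd K 0 * wd K v))
      - wd K u * tl K 0 * ⁅hd K 0, tl K a⁆ * wd K v := by
    rw [wd_cons K (tail 0), Ring.lie_def, Ring.lie_def]
    noncomm_ring
  rw [e, map_sub, map_sub, h1, sub_self, zero_sub, neg_eq_zero]
  by_cases hh : a ∈ heads (u ++ v)
  · rw [heads_append, List.mem_append] at hh
    rcases hh with hh | hh
    · obtain ⟨u₁, u₂, rfl⟩ := exists_append_of_mem_heads hh
      have h2 := (slides_hd (K := K) ha0).2.eq (wd K u₁) (wd K u₂ * tl K 0) (wd K v)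
      have h3 := (ev_tails_lie_heads (K := K) 0 a u₁ u₂ v).2
      rw [wd_append, wd_cons K (head a)]
      simp only [mul_assoc] at h2 h3 ⊢
      rw [← neg_eq_zero, ← h2, h3]
    · obtain ⟨v₁, v₂, rfl⟩ := exists_append_of_mem_heads hh
      have h2 := (slides_hd (K := K) ha0).1.eq (wd K u * tl K 0) (wd K v₁) (wd K v₂)
      have h3 := (ev_tails_lie_heads (K := K) 0 a u v₁ v₂).1
      rw [wd_append, wd_cons K (head a)]
      simp only [mul_assoc] at h2 h3 ⊢
      rw [h2, h3, neg_zero]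
  · simp only [Ring.lie_def, mul_sub, sub_mul, map_sub, ← wd_append, ev_wd]
    have hz : ∀ z : List Letter, a ∈ tails z → a ∉ heads z → Aw.mk K z = 0 := fun z h1 h2 =>
      Aw.mk_of_not_valid fun h => h2 (h.2.mem_iff.1 h1)
    rw [heads_append, List.mem_append, not_or] at hh
    rw [hz _ (by simp) (by simp [hh, ha0.symm]), hz _ (by simp) (by simp [hh, ha0.symm]), sub_zero]

theorem mk_dL_mem_center [CharZero K] :
    Aw.mk K [head 0, tail 0] ∈ Subalgebra.center K (Aw K) := by
  have h := add_mem (wheelSum_mem_center (K := K) 0) (mk_dR_mem_center (K := K))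
  rwa [wheelSum_zero, sub_add_cancel] at h

end Central

/-! ### Primitive elements -/

section Coproduct

variable {K : Type u} [Field K]

variable (K) in
open Classical in
/-- The arrows named in `A` are sent to the left cofactor, the others to the right one. -/
noncomputable def divide (A : Finset ℕ) : WordAlg K →ₐ[K] WordAlg K ⊗[K] WordAlg K :=
  letterLift fun l => if l.name ∈ A then wd K [l] ⊗ₜ[K] 1 else 1 ⊗ₜ[K] wd K [l]

theorem divide_wd (A : Finset ℕ) (w : List Letter) :
    divide K A (wd K w) = wd K (restrict (fun n => n ∈ A) w) ⊗ₜ[K] wd K (restrict (fun n => n ∉ A) w) := by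
  rw [divide, letterLift_wd]
  induction w with
  | nil => simp [restrict, wd_nil, Algebra.TensorProduct.one_def]
  | cons l w ih =>
    rw [List.map_cons, List.prod_cons, ih]
    by_cases h : l.name ∈ A
    · rw [if_pos h, Algebra.TensorProduct.tmul_mul_tmul, one_mul, ← wd_append]
      simp [restrict, h]
    · rw [if_neg h, Algebra.TensorProduct.tmul_mul_tmul, one_mul, ← wd_append]
      simp [restrict, h]

theorem comul_ev {s : List Letter} (hs : Valid s) {x : WordAlg K} (hx : x ∈ permSpan K s) :
    Coalgebra.comul (R := K) (ev x) =
      ∑ A ∈ (tails s).toFinset.powerset, TensorProduct.map ev ev (divide K A x) := by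
  refine permSpan_induction (P := fun x => Coalgebra.comul (R := K) (ev x) =
      ∑ A ∈ (tails s).toFinset.powerset, TensorProduct.map ev ev (divide K A x)) (fun w hw => ?_)
    (by simp) (fun x y hx hy => by simp only [map_add, hx, hy, Finset.sum_add_distrib])
    (fun r x hx => by simp only [map_smul, hx, Finset.smul_sum]) hx
  rw [ev_wd, Aw.comul_mk K (hs.of_perm hw.symm), Aw.comulWord,
    List.toFinset_eq_of_perm _ _ (tails_perm hw)]
  simp only [divide_wd, TensorProduct.map_tmul, ev_wd]

theorem divide_of_forall_mem {A : Finset ℕ} {s : List Letter} (h : ∀ l ∈ s, l.name ∈ A)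
    {x : WordAlg K} (hx : x ∈ permSpan K s) : divide K A x = x ⊗ₜ[K] 1 := by
  refine permSpan_induction (P := fun x => divide K A x = x ⊗ₜ[K] 1) (fun w hw => ?_)
    (by simp) (fun x y hx hy => by simp only [map_add, hx, hy, TensorProduct.add_tmul])
    (fun r x hx => by simp only [map_smul, hx, TensorProduct.smul_tmul']) hx
  have h' : ∀ l ∈ w, l.name ∈ A := fun l hl => h l (hw.mem_iff.1 hl)
  rw [divide_wd, restrict, List.filter_eq_self.2 (by simpa using h'), restrict,
    List.filter_eq_nil_iff.2 (by simpa using h'), wd_nil]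

theorem divide_of_forall_notMem {A : Finset ℕ} {s : List Letter} (h : ∀ l ∈ s, l.name ∉ A)
    {x : WordAlg K} (hx : x ∈ permSpan K s) : divide K A x = 1 ⊗ₜ[K] x := by
  refine permSpan_induction (P := fun x => divide K A x = 1 ⊗ₜ[K] x) (fun w hw => ?_)
    (by simp) (fun x y hx hy => by simp only [map_add, hx, hy, TensorProduct.tmul_add])
    (fun r x hx => by simp only [map_smul, hx, TensorProduct.tmul_smul]) hx
  have h' : ∀ l ∈ w, l.name ∉ A := fun l hl => h l (hw.mem_iff.1 hl)
  rw [divide_wd, restrict, List.filter_eq_nil_iff.2 (by simpa using h'), restrict,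
    List.filter_eq_self.2 (by simpa using h'), wd_nil]

theorem divide_lie (A : Finset ℕ) (x y : WordAlg K) :
    divide K A ⁅x, y⁆ = ⁅divide K A x, divide K A y⁆ := by
  simp only [Ring.lie_def, map_sub, map_mul]

/-- A tree cannot be divided: elements of different cofactors commute. -/
theorem divide_eval_eq_zero {A : Finset ℕ} {X : LTree} (h : ∃ n ∈ X.leaves, n ∈ A)
    (h' : ∃ n ∈ X.leaves, n ∉ A) : divide K A (X.eval K) = 0 := by
  induction X with
  | leaf a => simp_all [LTree.leaves]
  | node l r hl hr =>
    rw [LTree.eval, divide_lie]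
    have hin : ∀ Y : LTree, (¬ ∃ n ∈ Y.leaves, n ∉ A) → divide K A (Y.eval K) = Y.eval K ⊗ₜ[K] 1 :=
      fun Y hY => divide_of_forall_mem (by simpa using hY) Y.eval_mem_permSpan
    have hout : ∀ Y : LTree, (¬ ∃ n ∈ Y.leaves, n ∈ A) → divide K A (Y.eval K) = 1 ⊗ₜ[K] Y.eval K :=
      fun Y hY => divide_of_forall_notMem (by simpa using hY) Y.eval_mem_permSpan
    simp only [LTree.leaves, List.mem_append] at h h'
    by_cases l1 : ∃ n ∈ l.leaves, n ∈ A
    · by_cases l2 : ∃ n ∈ l.leaves, n ∉ A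
      · simp [hl l1 l2, Ring.lie_def]
      · by_cases r1 : ∃ n ∈ r.leaves, n ∈ A
        · have r2 : ∃ n ∈ r.leaves, n ∉ A := by grind
          simp [hr r1 r2, Ring.lie_def]
        · simp [hin l l2, hout r r1, Ring.lie_def]
    · by_cases r2 : ∃ n ∈ r.leaves, n ∉ A
      · have r1 : ∃ n ∈ r.leaves, n ∈ A := by grind
        simp [hr r1 r2, Ring.lie_def]
      · simp [hout l l1, hin r r2, Ring.lie_def]

theorem comul_ev_wheelElt {cs : List ℕ} {b : ℕ} (h : (b :: cs).Nodup) :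
    Coalgebra.comul (R := K) (ev (wheelElt K cs b)) =
      ev (wheelElt K cs b) ⊗ₜ[K] 1 + 1 ⊗ₜ[K] ev (wheelElt K cs b) := by
  have hv := valid_wheelLetters h
  have hm := wheelElt_mem_permSpan (K := K) cs b
  have hev : ev (1 : WordAlg K) = 1 := by rw [← wd_nil, ev_wd, Aw.mk_nil]
  have ht := tails_wheelLetters cs b
  have hb : b ∈ (tails (wheelLetters cs b)).toFinset := by rw [ht]; simp
  -- Only the two trivial divisions of the arrows contribute.
  rw [comul_ev hv hm, Finset.sum_eq_add_of_mem (tails (wheelLetters cs b)).toFinset ∅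
    (by simp) (by simp) (fun h0 => by simp [h0] at hb)]
  · rw [divide_of_forall_mem (fun l hl => List.mem_toFinset.2 (hv.name_mem hl)) hm,
      divide_of_forall_notMem (by simp) hm, TensorProduct.map_tmul, TensorProduct.map_tmul, hev]
  · intro A hA hne
    rw [wheelElt, map_mul, divide_lie, divide_eval_eq_zero]
    · simp [Ring.lie_def]
    · obtain ⟨n, hn⟩ := Finset.nonempty_iff_ne_empty.2 hne.2
      have := Finset.mem_powerset.1 hA hn
      rw [List.mem_toFinset, ht] at this
      exact ⟨n, by rwa [LTree.leaves_comb], hn⟩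
    · by_contra! h0
      refine hne.1 (Finset.Subset.antisymm (Finset.mem_powerset.1 hA) fun n hn => h0 n ?_)
      rwa [LTree.leaves_comb, ← ht, ← List.mem_toFinset]

theorem comul_wheelSum (j : ℕ) : Coalgebra.comul (R := K) (wheelSum K j) =
    wheelSum K j ⊗ₜ[K] 1 + 1 ⊗ₜ[K] wheelSum K j :=
  comul_ev_wheelElt (nodup_cons_spokes j)

theorem comul_single {w : List Letter} (h : Valid w) {a : ℕ} (ha : tails w = [a]) :
    Coalgebra.comul (R := K) (Aw.mk K w) = Aw.mk K w ⊗ₜ[K] 1 + 1 ⊗ₜ[K] Aw.mk K w := by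
  have hev : ev (1 : WordAlg K) = 1 := by rw [← wd_nil, ev_wd, Aw.mk_nil]
  have hn : ∀ l ∈ w, l.name = a := fun l hl => by simpa [ha] using h.name_mem hl
  rw [← ev_wd, comul_ev h (wd_mem_permSpan w), ha]
  have e : ([a] : List ℕ).toFinset.powerset = {{a}, ∅} := by
    ext A
    simp [Finset.subset_singleton_iff, or_comm]
  rw [e, Finset.sum_pair (by simp), divide_of_forall_mem (s := w) (by simpa using hn)
    (wd_mem_permSpan w), divide_of_forall_notMem (s := w) (by simp) (wd_mem_permSpan w),
    TensorProduct.map_tmul, TensorProduct.map_tmul, hev]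

theorem counit_ev {s : List Letter} (hs : s ≠ []) {x : WordAlg K} (hx : x ∈ permSpan K s) :
    Coalgebra.counit (R := K) (ev x) = 0 := by
  refine permSpan_induction (P := fun x => Coalgebra.counit (R := K) (ev x) = 0) (fun w hw => ?_)
    (by simp) (fun x y hx hy => by simp only [map_add, hx, hy, add_zero])
    (fun r x hx => by simp only [map_smul, hx, smul_zero]) hx
  rw [ev_wd]
  by_cases hv : Valid w
  · refine (Aw.counitHom_mk K hv).trans (if_neg ?_)
    rintro rfl
    exact hs hw.symm.eq_nil
  · rw [Aw.mk_of_not_valid hv, map_zero]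

theorem counit_wheelSum (j : ℕ) : Coalgebra.counit (R := K) (wheelSum K j) = 0 :=
  counit_ev (by simp [wheelLetters]) (wheelElt_mem_permSpan _ _)

end Coproduct

/-! ### Linear maps out of the space of arrow diagrams -/

section LinearLift

variable {K : Type u} [Field K]

theorem Aw.proj_surjective : Function.Surjective (Aw.proj K) :=
  RingQuot.mkAlgHom_surjective K (Rel K)

/-- A linear map on formal combinations of arrow diagrams descends to the quotient by 6T and TC if
it respects the relations inside every diagram. -/
theorem Aw.map_eq_of_proj_eq {M : Type*} [AddCommGroup M] [Module K M] (L : Dv K →ₗ[K] M)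
    (h : ∀ x y, Rel K x y → ∀ D E, L (D * x * E) = L (D * y * E)) {x y : Dv K}
    (hxy : Aw.proj K x = Aw.proj K y) : L x = L y := by
  have h1 : RingQuot.mkRingHom (Rel K) x = RingQuot.mkRingHom (Rel K) y := by
    rw [← RingQuot.mkAlgHom_coe K]
    exact hxy
  simp only [RingQuot.mkRingHom_def, RingHom.coe_mk, MonoidHom.coe_mk, OneHom.coe_mk] at h1
  have h2 := Quot.eqvGen_exact (congrArg RingQuot.toQuot h1)
  have h3 : ∀ x y, RingQuot.Rel (Rel K) x y → ∀ D E, L (D * x * E) = L (D * y * E) := by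
    intro x y hr
    induction hr with
    | of hr => exact h _ _ hr
    | add_left _ ih => intro D E; simp only [mul_add, add_mul, map_add, ih]
    | mul_left _ ih => intro D E; simpa only [mul_assoc] using ih D (_ * E)
    | mul_right _ ih => intro D E; simpa only [mul_assoc] using ih (D * _) E
  clear h1 hxy
  induction h2 with
  | rel x y hr => simpa using h3 x y hr 1 1
  | refl x => rfl
  | symm x y _ ih => exact ih.symm
  | trans x y z _ _ ih₁ ih₂ => exact ih₁.trans ih₂

theorem exists_words_disjoint (D E : ArrowDiagram) (N : ℕ) : ∃ d e : List Letter,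
    ∃ (hd : Valid d) (he : Valid e), D = ArrowDiagram.mk d hd ∧ E = ArrowDiagram.mk e he ∧
      (∀ n ∈ tails d, N < n) ∧ (∀ n ∈ tails e, N < n) ∧ ∀ n ∈ tails d, n ∉ tails e := by
  induction D using ArrowDiagram.ind with | h d hd => ?_
  induction E using ArrowDiagram.ind with | h e he => ?_
  have r1 : Renamed d (rename (fun n => 2 * n + (2 * N + 1)) d) := by
    refine ⟨_, fun n => (n - (2 * N + 1)) / 2, rfl, ?_⟩
    rw [rename_rename]
    exact (rename_eq_self fun a _ => by omega).symm
  have r2 : Renamed e (rename (fun n => 2 * n + (2 * N + 2)) e) := by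
    refine ⟨_, fun n => (n - (2 * N + 2)) / 2, rfl, ?_⟩
    rw [rename_rename]
    exact (rename_eq_self fun a _ => by omega).symm
  refine ⟨_, _, r1.valid hd, r2.valid he, ArrowDiagram.mk_eq _ _ r1, ArrowDiagram.mk_eq _ _ r2,
    ?_, ?_, ?_⟩
  all_goals
    simp only [tails_rename, List.mem_map]
    rintro _ ⟨n, -, rfl⟩
  · omega
  · omega
  · rintro ⟨m, -, hm⟩
    omega

/-- The linear map on the algebra of arrow diagrams with prescribed values on words, provided that
these are invariant under renaming and respect the relations TC and 6T. -/
theorem Aw.exists_linearMap {M : Type*} [AddCommGroup M] [Module K M] (f : List Letter → M)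
    (hren : ∀ u v, Valid u → Renamed u v → f u = f v)
    (htc : ∀ (S₁ S₂ : List Letter) (p q : ℕ), Valid (S₁ ++ [tail p, tail q] ++ S₂) →
      f (S₁ ++ [tail p, tail q] ++ S₂) = f (S₁ ++ [tail q, tail p] ++ S₂))
    (hsixT : ∀ (S : Fin 4 → List Letter) (σ : Equiv.Perm (Fin 3)) (p q : ℕ),
      Valid (place S σ ![[tail p, tail q], [head p], [head q]]) →
      (f (place S σ ![[tail p, tail q], [head p], [head q]])
        - f (place S σ ![[tail q, tail p], [head p], [head q]]))
      + (f (place S σ ![[tail p], [head p, tail q], [head q]])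
        - f (place S σ ![[tail p], [tail q, head p], [head q]]))
      + (f (place S σ ![[tail p], [tail q], [head p, head q]])
        - f (place S σ ![[tail p], [tail q], [head q, head p]])) = 0) :
    ∃ F : Aw K →ₗ[K] M, ∀ w, Valid w → F (Aw.mk K w) = f w := by
  let fD : ArrowDiagram → M := Quotient.lift (fun u => f u.1) fun u v h => hren u.1 v.1 u.2 h
  let L : Dv K →ₗ[K] M :=
    Finsupp.lift M K ArrowDiagram fD ∘ₗ (MonoidAlgebra.coeffLinearEquiv K).toLinearMap
  have hLof : ∀ D, L (MonoidAlgebra.of K ArrowDiagram D) = fD D := fun D => by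
    simp [L, MonoidAlgebra.of]
  have hL : ∀ w, Valid w → L (dia K w) = f w := fun w hw => by
    rw [dia, dif_pos hw, hLof]
    rfl
  have hbase : ∀ x y, Rel K x y → ∀ D E : ArrowDiagram,
      L (MonoidAlgebra.of K ArrowDiagram D * x * MonoidAlgebra.of K ArrowDiagram E) =
        L (MonoidAlgebra.of K ArrowDiagram D * y * MonoidAlgebra.of K ArrowDiagram E) := by
    intro x y hxy D E
    have key : ∀ (s : List Letter), ∃ d e : List Letter, ∀ w : List Letter, Valid w → w.Perm s →
        Valid (d ++ w ++ e) ∧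
        L (MonoidAlgebra.of K ArrowDiagram D * dia K w * MonoidAlgebra.of K ArrowDiagram E) =
          f (d ++ w ++ e) := by
      intro s
      obtain ⟨d, e, hd, he, rfl, rfl, h1, h2, h3⟩ := exists_words_disjoint D E (tails s).sum
      refine ⟨d, e, fun w hw hws => ?_⟩
      have hle : ∀ n ∈ tails w, n ≤ (tails s).sum := fun n hn =>
        List.single_le_sum (fun _ _ => Nat.zero_le _) _ ((tails_perm hws).mem_iff.1 hn)
      have hdw : ∀ n ∈ tails d, n ∉ tails w := fun n hn hn' =>
        absurd (hle n hn') (not_le.2 (h1 n hn))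
      have hdwe : ∀ n ∈ tails (d ++ w), n ∉ tails e := by
        intro n hn hn'
        rw [tails_append, List.mem_append] at hn
        exact hn.elim (fun hn => h3 n hn hn') fun hn => absurd (hle n hn) (not_le.2 (h2 n hn'))
      have hv := (hd.append hw hdw).append he hdwe
      refine ⟨hv, ?_⟩
      rw [← hL _ hv, dia, dia, dif_pos hw, dif_pos hv,
        ← ArrowDiagram.mk_mul_mk_of_disjoint (hd.append hw hdw) he hdwe,
        ← ArrowDiagram.mk_mul_mk_of_disjoint hd hw hdw,
        map_mul (MonoidAlgebra.of K _), map_mul (MonoidAlgebra.of K _)]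
    cases hxy with
    | tc S₁ S₂ p q h =>
      have hP : (S₁ ++ [tail q, tail p] ++ S₂).Perm (S₁ ++ [tail p, tail q] ++ S₂) :=
        ((List.Perm.swap _ _ _).append_left S₁).append_right S₂
      obtain ⟨d, e, hde⟩ := key (S₁ ++ [tail p, tail q] ++ S₂)
      obtain ⟨hv, h1⟩ := hde _ h (List.Perm.refl _)
      rw [h1, (hde _ (h.of_perm hP.symm) hP).2]
      have := htc (d ++ S₁) (S₂ ++ e) p q (by simpa using hv)
      simpa using this
    | sixT S σ p q h =>
      obtain ⟨d, e, hde⟩ := key (place S σ ![[tail p, tail q], [head p], [head q]])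
      have hpl : ∀ a b c : List Letter, d ++ place S σ ![a, b, c] ++ e =
          place ![d ++ S 0, S 1, S 2, S 3 ++ e] σ ![a, b, c] := by
        intro a b c
        simp [place]
      have hk : ∀ a b c : List Letter,
          ([tail p, tail q] ++ [head p] ++ [head q]).Perm (a ++ b ++ c) →
          L (MonoidAlgebra.of K ArrowDiagram D * dia K (place S σ ![a, b, c]) *
            MonoidAlgebra.of K ArrowDiagram E) =
          f (place ![d ++ S 0, S 1, S 2, S 3 ++ e] σ ![a, b, c]) := by
        intro a b c hp
        have hP := place_perm S σ _ _ _ _ _ _ hp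
        rw [← hpl]
        exact (hde _ (h.of_perm hP) hP.symm).2
      have hv := (hde _ h (List.Perm.refl _)).1
      rw [hpl] at hv
      simp only [mul_add, mul_sub, add_mul, sub_mul, map_add, map_sub, mul_zero, zero_mul, map_zero]
      rw [hk _ _ _ (List.Perm.refl _), hk _ _ _ (perm_four_swap _ _ _ _),
        hk _ _ _ (perm_four_mid _ _ _ _), hk [tail p] [tail q, head p] [head q] (List.Perm.refl _),
        hk [tail p] [tail q] [head p, head q] (List.Perm.refl _),
        hk _ _ _ (perm_four_last _ _ _ _)]
      exact hsixT _ σ p q hv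
  have hall : ∀ x y, Rel K x y → ∀ D E, L (D * x * E) = L (D * y * E) := by
    intro x y hxy D E
    refine MonoidAlgebra.induction_on (motive := fun D => L (D * x * E) = L (D * y * E)) D
      (fun D => ?_) (fun a b ha hb => by simp only [add_mul, map_add, ha, hb])
      (fun r a ha => by simp only [smul_mul_assoc, map_smul, ha])
    refine MonoidAlgebra.induction_on
      (motive := fun E => L (MonoidAlgebra.of K _ D * x * E) = L (MonoidAlgebra.of K _ D * y * E)) E
      (fun E => hbase x y hxy D E) (fun a b ha hb => by simp only [mul_add, map_add, ha, hb])
      (fun r a ha => by simp only [mul_smul_comm, map_smul, ha])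
  obtain ⟨s, hs⟩ := LinearMap.exists_rightInverse_of_surjective (Aw.proj K).toLinearMap
    (LinearMap.range_eq_top.2 Aw.proj_surjective)
  refine ⟨L ∘ₗ s, fun w hw => ?_⟩
  rw [← hL w hw, LinearMap.comp_apply]
  exact Aw.map_eq_of_proj_eq L hall (LinearMap.congr_fun hs (Aw.mk K w))

end LinearLift

/-! ### From arrow diagrams to w-Jacobi diagrams -/

namespace JWord

theorem starts_rename (f : ℕ → ℕ) (D : JWord) : (D.rename f).starts = D.starts.map f := by
  simp only [starts, rename, tails_rename, Multiset.map_add, Multiset.map_coe, Multiset.map_map]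
  rfl

theorem ends_rename (f : ℕ → ℕ) (D : JWord) : (D.rename f).ends = D.ends.map f := by
  simp only [ends, rename, heads_rename, Multiset.map_add, Multiset.map_coe, Multiset.map_map]
  rfl

theorem rename_congr {f g : ℕ → ℕ} {D : JWord} (hD : D.Valid) (h : ∀ n ∈ D.starts, f n = g n) :
    D.rename f = D.rename g := by
  have h' : ∀ n ∈ D.ends, f n = g n := fun n hn => h n (hD.2 ▸ hn)
  simp only [rename]
  congr 1
  · refine WKnot.rename_congr fun a ha => ?_
    rcases mem_names_iff.1 ⟨a, ha, rfl⟩ with h1 | h1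
    · exact h _ (by simp [starts, h1])
    · exact h' _ (by simp [ends, h1])
  · refine Multiset.map_congr rfl fun v hv => ?_
    have h1 := h v.out (Multiset.mem_add.2 (Or.inr (Multiset.mem_map_of_mem _ hv)))
    have h2 := h' v.left (Multiset.mem_add.2 (Or.inl (Multiset.mem_add.2
      (Or.inr (Multiset.mem_map_of_mem _ hv)))))
    have h3 := h' v.right (Multiset.mem_add.2 (Or.inr (Multiset.mem_map_of_mem _ hv)))
    simp [Vertex.map, h1, h2, h3]

theorem Valid.rename {f : ℕ → ℕ} {D : JWord} (hD : D.Valid)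
    (hf : ∀ m ∈ D.starts, ∀ n ∈ D.starts, f m = f n → m = n) : (D.rename f).Valid := by
  refine ⟨?_, ?_⟩
  · rw [starts_rename]
    exact (Multiset.nodup_map_iff_of_inj_on (by grind)).2 hD.1
  · rw [starts_rename, ends_rename, hD.2]

/-- Shrinking an arrow `e` removes its name from the places where arrows begin and from the places
where arrows end. -/
theorem valid_iff_of_shrink {D E : JWord} {e : ℕ} (hs : D.starts = e ::ₘ E.starts)
    (he : D.ends = e ::ₘ E.ends) : D.Valid ↔ e ∉ E.starts ∧ E.Valid := by
  rw [Valid, Valid, hs, he, Multiset.nodup_cons, Multiset.cons_inj_right]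
  tauto

end JWord

theorem starts_ends_stu₁ (S₁ S₂ : List Letter) (V : Multiset Vertex) (a b c : ℕ) :
    JWord.starts ⟨S₁ ++ [head c] ++ S₂, ⟨a, b, c⟩ ::ₘ V⟩ =
        c ::ₘ JWord.starts ⟨S₁ ++ [head a, head b] ++ S₂, V⟩ ∧
      JWord.ends ⟨S₁ ++ [head c] ++ S₂, ⟨a, b, c⟩ ::ₘ V⟩ =
        c ::ₘ JWord.ends ⟨S₁ ++ [head a, head b] ++ S₂, V⟩ := by
  constructor <;>
  · simp only [JWord.starts, JWord.ends, tails_append, heads_append, ← Multiset.coe_add,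
      Multiset.map_cons]
    simp only [tails_cons_head, tails_nil, heads_cons_head, heads_nil,
      ← Multiset.cons_coe, Multiset.coe_nil, ← Multiset.singleton_add]
    abel

theorem starts_ends_stu₂ (S₁ S₂ : List Letter) (V : Multiset Vertex) (a b c : ℕ) :
    JWord.starts ⟨S₁ ++ [tail b] ++ S₂, ⟨a, b, c⟩ ::ₘ V⟩ =
        b ::ₘ JWord.starts ⟨S₁ ++ [tail c, head a] ++ S₂, V⟩ ∧
      JWord.ends ⟨S₁ ++ [tail b] ++ S₂, ⟨a, b, c⟩ ::ₘ V⟩ =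
        b ::ₘ JWord.ends ⟨S₁ ++ [tail c, head a] ++ S₂, V⟩ := by
  constructor <;>
  · simp only [JWord.starts, JWord.ends, tails_append, heads_append, ← Multiset.coe_add,
      Multiset.map_cons]
    simp only [tails_cons_head, tails_nil, heads_cons_head, heads_nil, tails_cons_tail,
      heads_cons_tail, ← Multiset.cons_coe, Multiset.coe_nil, ← Multiset.singleton_add]
    abel

theorem starts_ends_stu₂' (S₁ S₂ : List Letter) (V : Multiset Vertex) (a b c : ℕ) :
    JWord.starts ⟨S₁ ++ [tail a] ++ S₂, ⟨a, b, c⟩ ::ₘ V⟩ =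
        a ::ₘ JWord.starts ⟨S₁ ++ [head b, tail c] ++ S₂, V⟩ ∧
      JWord.ends ⟨S₁ ++ [tail a] ++ S₂, ⟨a, b, c⟩ ::ₘ V⟩ =
        a ::ₘ JWord.ends ⟨S₁ ++ [head b, tail c] ++ S₂, V⟩ := by
  constructor <;>
  · simp only [JWord.starts, JWord.ends, tails_append, heads_append, ← Multiset.coe_add,
      Multiset.map_cons]
    simp only [tails_cons_head, tails_nil, heads_cons_head, heads_nil, tails_cons_tail,
      heads_cons_tail, ← Multiset.cons_coe, Multiset.coe_nil, ← Multiset.singleton_add]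
    abel

section JacobiQuotient

variable {K : Type u} [Field K]

variable (K) in
/-- The class of the w-Jacobi diagram described by a word; it is `0` if the word describes none. -/
noncomputable def Awt.mk (D : JWord) : Awt K := Submodule.Quotient.mk (jdia K D)

namespace Awt

theorem mk_of_valid {D : JWord} (h : D.Valid) : mk K D = of K (JacobiDiagram.mk D h) := by
  rw [mk, jdia, dif_pos h, of]

theorem mk_of_not_valid {D : JWord} (h : ¬ D.Valid) : mk K D = 0 := by
  rw [mk, jdia, dif_neg h]
  rfl

theorem mk_rename (f : Equiv.Perm ℕ) (D : JWord) : mk K (D.rename f) = mk K D := by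
  have key : ∀ (f : Equiv.Perm ℕ) (D : JWord), D.Valid → (D.rename f).Valid :=
    fun f D hD => hD.rename fun m _ n _ h => f.injective h
  have e : (D.rename f).rename f.symm = D := by
    rw [JWord.rename_rename]
    simp only [Equiv.symm_apply_apply]
    exact JWord.rename_id D
  by_cases hD : D.Valid
  · rw [mk_of_valid hD, mk_of_valid (key f D hD)]
    congr 1
    exact Quotient.sound ⟨f.symm, f, e.symm, rfl⟩
  · rw [mk_of_not_valid hD, mk_of_not_valid fun h => hD (by rw [← e]; exact key f.symm _ h)]

theorem mk_tc (S₁ S₂ : List Letter) (V : Multiset Vertex) (p q : ℕ) :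
    mk K ⟨S₁ ++ [tail p, tail q] ++ S₂, V⟩ = mk K ⟨S₁ ++ [tail q, tail p] ++ S₂, V⟩ := by
  by_cases h : JWord.Valid ⟨S₁ ++ [tail p, tail q] ++ S₂, V⟩
  · exact (Submodule.Quotient.eq _).2 (Submodule.subset_span (JRel.tc S₁ S₂ V p q h))
  · have hP : (S₁ ++ [tail p, tail q] ++ S₂).Perm (S₁ ++ [tail q, tail p] ++ S₂) :=
      ((List.Perm.swap _ _ _).append_left S₁).append_right S₂
    rw [mk_of_not_valid h, mk_of_not_valid]
    rintro ⟨h1, h2⟩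
    simp only [JWord.starts, JWord.ends] at h1 h2
    rw [← Multiset.coe_eq_coe.2 (tails_perm hP)] at h1 h2
    rw [← Multiset.coe_eq_coe.2 (heads_perm hP)] at h2
    exact h ⟨h1, h2⟩

theorem valid_perm {S S' : List Letter} (V : Multiset Vertex) (h : S.Perm S') :
    JWord.Valid ⟨S, V⟩ ↔ JWord.Valid ⟨S', V⟩ := by
  simp only [JWord.Valid, JWord.starts, JWord.ends, Multiset.coe_eq_coe.2 (tails_perm h),
    Multiset.coe_eq_coe.2 (heads_perm h)]

theorem mk_stu₁ (S₁ S₂ : List Letter) (V : Multiset Vertex) (a b c : ℕ)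
    (hc : c ∉ JWord.starts ⟨S₁ ++ [head a, head b] ++ S₂, V⟩) :
    mk K ⟨S₁ ++ [head c] ++ S₂, ⟨a, b, c⟩ ::ₘ V⟩ =
      mk K ⟨S₁ ++ [head a, head b] ++ S₂, V⟩ - mk K ⟨S₁ ++ [head b, head a] ++ S₂, V⟩ := by
  by_cases h : JWord.Valid ⟨S₁ ++ [head c] ++ S₂, ⟨a, b, c⟩ ::ₘ V⟩
  · exact (Submodule.Quotient.eq _).2 (Submodule.subset_span (JRel.stu₁ S₁ S₂ V a b c h))
  · have hP : (S₁ ++ [head a, head b] ++ S₂).Perm (S₁ ++ [head b, head a] ++ S₂) :=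
      ((List.Perm.swap _ _ _).append_left S₁).append_right S₂
    have h' : ¬ JWord.Valid ⟨S₁ ++ [head a, head b] ++ S₂, V⟩ := by
      obtain ⟨hs, he⟩ := starts_ends_stu₁ S₁ S₂ V a b c
      exact fun h' => h ((JWord.valid_iff_of_shrink hs he).2 ⟨hc, h'⟩)
    rw [mk_of_not_valid h, mk_of_not_valid h', mk_of_not_valid (mt (valid_perm V hP).2 h'), sub_zero]

theorem mk_stu₂ (S₁ S₂ : List Letter) (V : Multiset Vertex) (a b c : ℕ)
    (hb : b ∉ JWord.starts ⟨S₁ ++ [tail c, head a] ++ S₂, V⟩) :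
    mk K ⟨S₁ ++ [tail b] ++ S₂, ⟨a, b, c⟩ ::ₘ V⟩ =
      mk K ⟨S₁ ++ [tail c, head a] ++ S₂, V⟩ - mk K ⟨S₁ ++ [head a, tail c] ++ S₂, V⟩ := by
  by_cases h : JWord.Valid ⟨S₁ ++ [tail b] ++ S₂, ⟨a, b, c⟩ ::ₘ V⟩
  · exact (Submodule.Quotient.eq _).2 (Submodule.subset_span (JRel.stu₂ S₁ S₂ V a b c h))
  · have hP : (S₁ ++ [tail c, head a] ++ S₂).Perm (S₁ ++ [head a, tail c] ++ S₂) :=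
      ((List.Perm.swap _ _ _).append_left S₁).append_right S₂
    have h' : ¬ JWord.Valid ⟨S₁ ++ [tail c, head a] ++ S₂, V⟩ := by
      obtain ⟨hs, he⟩ := starts_ends_stu₂ S₁ S₂ V a b c
      exact fun h' => h ((JWord.valid_iff_of_shrink hs he).2 ⟨hb, h'⟩)
    rw [mk_of_not_valid h, mk_of_not_valid h', mk_of_not_valid (mt (valid_perm V hP).2 h'), sub_zero]

theorem mk_stu₂_of_valid (S₁ S₂ : List Letter) (V : Multiset Vertex) (a b c : ℕ)
    (h : JWord.Valid ⟨S₁ ++ [tail b] ++ S₂, ⟨a, b, c⟩ ::ₘ V⟩) :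
    mk K ⟨S₁ ++ [tail b] ++ S₂, ⟨a, b, c⟩ ::ₘ V⟩ =
      mk K ⟨S₁ ++ [tail c, head a] ++ S₂, V⟩ - mk K ⟨S₁ ++ [head a, tail c] ++ S₂, V⟩ :=
  (Submodule.Quotient.eq _).2 (Submodule.subset_span (JRel.stu₂ S₁ S₂ V a b c h))

theorem mk_stu₂'_of_valid (S₁ S₂ : List Letter) (V : Multiset Vertex) (a b c : ℕ)
    (h : JWord.Valid ⟨S₁ ++ [tail a] ++ S₂, ⟨a, b, c⟩ ::ₘ V⟩) :
    mk K ⟨S₁ ++ [tail a] ++ S₂, ⟨a, b, c⟩ ::ₘ V⟩ =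
      mk K ⟨S₁ ++ [head b, tail c] ++ S₂, V⟩ - mk K ⟨S₁ ++ [tail c, head b] ++ S₂, V⟩ :=
  (Submodule.Quotient.eq _).2 (Submodule.subset_span (JRel.stu₂' S₁ S₂ V a b c h))

theorem mem_of_mk_mem {S : Submodule K (Awt K)} (h : ∀ D, D.Valid → mk K D ∈ S) : S = ⊤ := by
  rw [eq_top_iff]
  rintro x -
  induction x using Submodule.Quotient.induction_on with | H x => ?_
  induction x using Finsupp.induction_linear with
  | zero => exact zero_mem S
  | add x y hx hy => exact add_mem hx hy
  | single D r =>
    have h1 : of K D ∈ S := by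
      obtain ⟨D', rfl⟩ := Quotient.exists_rep D
      have := h D'.1 D'.2
      rwa [mk_of_valid D'.2] at this
    rw [← mul_one r, ← smul_eq_mul, ← Finsupp.smul_single]
    exact S.smul_mem r h1

end Awt

/-- One of three pieces of the skeleton, seen as a piece between two parts of the skeleton. -/
theorem exists_place_update (S : Fin 4 → List Letter) (σ : Equiv.Perm (Fin 3))
    (c : Fin 3 → List Letter) (i : Fin 3) :
    ∃ S₁ S₂, ∀ x, place S σ (Function.update c i x) = S₁ ++ x ++ S₂ := by
  obtain ⟨j, rfl⟩ := σ.surjective i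
  fin_cases j
  · refine ⟨S 0, S 1 ++ (c (σ 1) ++ (S 2 ++ (c (σ 2) ++ S 3))), fun x => ?_⟩
    simp [place, σ.injective.eq_iff]
  · refine ⟨S 0 ++ (c (σ 0) ++ S 1), S 2 ++ (c (σ 2) ++ S 3), fun x => ?_⟩
    simp [place, σ.injective.eq_iff]
  · refine ⟨S 0 ++ (c (σ 0) ++ (S 1 ++ (c (σ 1) ++ S 2))), S 3, fun x => ?_⟩
    simp [place, σ.injective.eq_iff]

theorem exists_place_eq (S : Fin 4 → List Letter) (σ : Equiv.Perm (Fin 3)) (a b c : List Letter) :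
    (∃ S₁ S₂, ∀ x, place S σ ![x, b, c] = S₁ ++ x ++ S₂) ∧
    (∃ S₁ S₂, ∀ x, place S σ ![a, x, c] = S₁ ++ x ++ S₂) ∧
    ∃ S₁ S₂, ∀ x, place S σ ![a, b, x] = S₁ ++ x ++ S₂ := by
  refine ⟨?_, ?_, ?_⟩
  · obtain ⟨S₁, S₂, h⟩ := exists_place_update S σ ![a, b, c] 0
    exact ⟨S₁, S₂, fun x => by rw [← h]; congr 1; ext i; fin_cases i <;> rfl⟩
  · obtain ⟨S₁, S₂, h⟩ := exists_place_update S σ ![a, b, c] 1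
    exact ⟨S₁, S₂, fun x => by rw [← h]; congr 1; ext i; fin_cases i <;> rfl⟩
  · obtain ⟨S₁, S₂, h⟩ := exists_place_update S σ ![a, b, c] 2
    exact ⟨S₁, S₂, fun x => by rw [← h]; congr 1; ext i; fin_cases i <;> rfl⟩

theorem place_perm_append (S : Fin 4 → List Letter) (σ : Equiv.Perm (Fin 3))
    (c : Fin 3 → List Letter) :
    (place S σ c).Perm (S 0 ++ S 1 ++ S 2 ++ S 3 ++ (c 0 ++ c 1 ++ c 2)) := by
  have e := Equiv.sum_comp σ fun i => (c i : Multiset Letter)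
  rw [Fin.sum_univ_three, Fin.sum_univ_three] at e
  rw [← Multiset.coe_eq_coe]
  simp only [place, ← Multiset.coe_add]
  rw [← e]
  abel

theorem rename_place (f : ℕ → ℕ) {S : Fin 4 → List Letter} (hS : ∀ i, rename f (S i) = S i)
    (σ : Equiv.Perm (Fin 3)) (c : Fin 3 → List Letter) :
    rename f (place S σ c) = place S σ fun i => rename f (c i) := by
  simp only [place, rename_append, hS]

/-- The relation 6T follows from STU: both of the commutators that remain by TC are the same
diagram with one internal vertex, with opposite signs. -/
theorem Awt.mk_sixT (S : Fin 4 → List Letter) (σ : Equiv.Perm (Fin 3)) (p q : ℕ)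
    (h : Valid (place S σ ![[tail p, tail q], [head p], [head q]])) :
    (mk K ⟨place S σ ![[tail p, tail q], [head p], [head q]], 0⟩
      - mk K ⟨place S σ ![[tail q, tail p], [head p], [head q]], 0⟩)
    + (mk K ⟨place S σ ![[tail p], [head p, tail q], [head q]], 0⟩
      - mk K ⟨place S σ ![[tail p], [tail q, head p], [head q]], 0⟩)
    + (mk K ⟨place S σ ![[tail p], [tail q], [head p, head q]], 0⟩
      - mk K ⟨place S σ ![[tail p], [tail q], [head q, head p]], 0⟩) = 0 := by
  -- A new name for the arrow that is shrunk.
  set N := (tails (place S σ ![[tail p, tail q], [head p], [head q]])).sum + 1 with hN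
  have hfresh : ∀ n ∈ tails (place S σ ![[tail p, tail q], [head p], [head q]]), n ≠ N := by
    intro n hn
    have := List.single_le_sum (fun _ _ => Nat.zero_le _) n hn
    omega
  have hnew : ∀ a b c : List Letter, ([tail p, tail q] ++ [head p] ++ [head q]).Perm (a ++ b ++ c) →
      N ∉ JWord.starts ⟨place S σ ![a, b, c], 0⟩ := by
    intro a b c hp hn
    simp only [JWord.starts, Multiset.map_zero, add_zero, Multiset.mem_coe] at hn
    exact hfresh N ((tails_perm (place_perm S σ _ _ _ _ _ _ hp)).mem_iff.2 hn) rfl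
  obtain ⟨⟨A₁, A₂, hA⟩, -, -⟩ := exists_place_eq S σ [] [head p] [head q]
  obtain ⟨-, ⟨B₁, B₂, hB⟩, -⟩ := exists_place_eq S σ [tail p] [] [head q]
  obtain ⟨-, -, ⟨C₁, C₂, hC⟩⟩ := exists_place_eq S σ [tail p] [tail q] []
  have h2 := mk_stu₂ (K := K) B₁ B₂ 0 p N q
    (by rw [← hB]; exact hnew [tail p] [tail q, head p] [head q] (List.Perm.refl _))
  have h3 := mk_stu₁ (K := K) C₁ C₂ 0 p q N
    (by rw [← hC]; exact hnew [tail p] [tail q] [head p, head q] (List.Perm.refl _))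
  rw [← hB, ← hB, ← hB] at h2
  rw [← hC, ← hC, ← hC] at h3
  have h1 := mk_tc (K := K) A₁ A₂ 0 p q
  rw [← hA, ← hA] at h1
  have hS : ∀ i, ∀ l ∈ S i, l.name ≠ q ∧ l.name ≠ N := by
    have hP := place_perm_append S σ ![[tail p, tail q], [head p], [head q]]
    have hv := h.of_perm hP
    rw [← List.append_nil (_ ++ (_ ++ _ ++ _))] at hv
    have hq := (notMem_names (a := q) hv (by simp) (by simp)).1
    intro i l hl
    have hl' : l ∈ S 0 ++ S 1 ++ S 2 ++ S 3 := by
      fin_cases i <;> simp_all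
    exact ⟨hq l hl', hfresh _ (h.name_mem (hP.mem_iff.2 (List.mem_append_left _ hl')))⟩
  have hpN : p ≠ N := hfresh p (h.name_mem (a := tail p) (by rw [hA]; simp))
  have hpq : p ≠ q := by
    have := h.1
    rw [hA, tails_append, tails_append, List.nodup_append, List.nodup_append] at this
    simpa using this.1.2.1
  have hren : mk K ⟨place S σ ![[tail p], [tail N], [head q]], ⟨p, N, q⟩ ::ₘ 0⟩ =
      mk K ⟨place S σ ![[tail p], [tail q], [head N]], ⟨p, q, N⟩ ::ₘ 0⟩ := by
    rw [← mk_rename (Equiv.swap q N), JWord.rename, rename_place]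
    · congr 2
      · congr 1
        ext i : 1
        fin_cases i <;> simp [WKnot.rename, Letter.map, Equiv.swap_apply_of_ne_of_ne hpq hpN]
      · simp [Vertex.map, Equiv.swap_apply_of_ne_of_ne hpq hpN]
    · exact fun i => rename_swap_of_notMem (fun l hl => (hS i l hl).1) fun l hl => (hS i l hl).2
  rw [h1, sub_self, zero_add, ← h3, ← hren, h2]
  abel

theorem exists_toJacobi_linearMap : ∃ ι : Aw K →ₗ[K] Awt K,
    ∀ w, ι (Aw.mk K w) = Awt.mk K ⟨w, 0⟩ := by
  have hren : ∀ u v : List Letter, Valid u → Renamed u v →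
      Awt.mk K ⟨u, 0⟩ = Awt.mk K ⟨v, 0⟩ := by
    rintro u v hu hr
    have hv := hr.valid hu
    obtain ⟨f, g, h1, h2⟩ := hr
    rw [Awt.mk_of_valid hu.toJWord, Awt.mk_of_valid hv.toJWord]
    congr 1
    refine Quotient.sound ⟨f, g, ?_, ?_⟩
    · simp only [JWord.rename, Multiset.map_zero, ← h1]
    · simp only [JWord.rename, Multiset.map_zero, ← h2]
  obtain ⟨ι, hι⟩ := Aw.exists_linearMap (K := K) (fun w => Awt.mk K ⟨w, 0⟩) hren
    (fun S₁ S₂ p q _ => Awt.mk_tc S₁ S₂ 0 p q) Awt.mk_sixT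
  refine ⟨ι, fun w => ?_⟩
  by_cases hw : Valid w
  · exact hι w hw
  · rw [Aw.mk_of_not_valid hw, map_zero, Awt.mk_of_not_valid]
    simpa [JWord.Valid, JWord.starts, JWord.ends, Valid] using hw

variable (K) in
/-- The map induced by the inclusion of arrow diagrams into w-Jacobi diagrams. -/
noncomputable def toJacobi : Aw K →ₗ[K] Awt K := exists_toJacobi_linearMap.choose

@[simp] theorem toJacobi_mk (w : List Letter) : toJacobi K (Aw.mk K w) = Awt.mk K ⟨w, 0⟩ :=
  exists_toJacobi_linearMap.choose_spec w

theorem toJacobi_of (D : ArrowDiagram) : toJacobi K (Aw.of K D) = Awt.of K D.toJacobi := by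
  induction D using ArrowDiagram.ind with | h w hw => ?_
  rw [← Aw.mk_of_valid K hw, toJacobi_mk, Awt.mk_of_valid hw.toJWord]
  rfl

/-- Some internal vertex receives an arrow from the skeleton, and STU removes this vertex. -/
theorem Awt.mk_mem_range (D : JWord) : mk K D ∈ LinearMap.range (toJacobi K) := by
  induction hn : D.verts.card generalizing D with
  | zero =>
    obtain ⟨w, V⟩ := D
    obtain rfl : V = 0 := Multiset.card_eq_zero.1 hn
    exact ⟨_, toJacobi_mk w⟩
  | succ n ih =>
    by_cases hD : D.Valid
    swap
    · rw [mk_of_not_valid hD]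
      exact zero_mem _
    have h0 : D.verts ≠ 0 := fun h => by simp [h] at hn
    have hmem : ∀ m ∈ D.ends, (¬ ∃ v' ∈ D.verts, v'.out = m) → m ∈ tails D.skel := by
      intro m hm hm'
      rw [← hD.2, JWord.starts, Multiset.mem_add, Multiset.mem_map] at hm
      exact hm.resolve_right hm'
    by_cases hl : ∀ v ∈ D.verts, ∃ v' ∈ D.verts, v'.out = v.left
    · have hr : ¬ ∀ v ∈ D.verts, ∃ v' ∈ D.verts, v'.out = v.right :=
        fun hr => h0 (hD.connected le_rfl hl hr)
      push Not at hr
      obtain ⟨v, hv, hvr⟩ := hr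
      have ht := hmem v.right (Multiset.mem_add.2 (Or.inr (Multiset.mem_map_of_mem _ hv)))
        (by push Not; exact hvr)
      obtain ⟨S₁, S₂, hS⟩ := exists_append_of_mem_tails ht
      obtain ⟨V, hV⟩ := Multiset.exists_cons_of_mem hv
      obtain ⟨w, W⟩ := D
      obtain ⟨a, b, c⟩ := v
      simp only at hS hV hn
      subst hS hV
      have hw : S₁ ++ tail b :: S₂ = S₁ ++ [tail b] ++ S₂ := by simp
      rw [hw] at hD ⊢
      rw [mk_stu₂_of_valid _ _ _ _ _ _ hD]
      rw [Multiset.card_cons, add_left_inj] at hn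
      exact sub_mem (ih _ hn) (ih _ hn)
    · push Not at hl
      obtain ⟨v, hv, hvl⟩ := hl
      have ht := hmem v.left (Multiset.mem_add.2 (Or.inl (Multiset.mem_add.2
        (Or.inr (Multiset.mem_map_of_mem _ hv))))) (by push Not; exact hvl)
      obtain ⟨S₁, S₂, hS⟩ := exists_append_of_mem_tails ht
      obtain ⟨V, hV⟩ := Multiset.exists_cons_of_mem hv
      obtain ⟨w, W⟩ := D
      obtain ⟨a, b, c⟩ := v
      simp only at hS hV hn
      subst hS hV
      have hw : S₁ ++ tail a :: S₂ = S₁ ++ [tail a] ++ S₂ := by simp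
      rw [hw] at hD ⊢
      rw [mk_stu₂'_of_valid _ _ _ _ _ _ hD]
      rw [Multiset.card_cons, add_left_inj] at hn
      exact sub_mem (ih _ hn) (ih _ hn)

theorem toJacobi_surjective : Function.Surjective (toJacobi K) :=
  LinearMap.range_eq_top.1 (Awt.mem_of_mk_mem fun D _ => Awt.mk_mem_range D)

/-! ### Wheels as w-Jacobi diagrams -/

/-- The first `j` vertices of a wheel. -/
def wheelVerts (j : ℕ) : Multiset Vertex :=
  (((List.range j).map fun i => (⟨2 * i, 2 * i + 1, 2 * i + 3⟩ : Vertex)) : List Vertex)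

theorem wheelVerts_succ (j : ℕ) :
    wheelVerts (j + 1) = ⟨2 * j, 2 * j + 1, 2 * j + 3⟩ ::ₘ wheelVerts j := by
  simp only [wheelVerts, List.range_succ, List.map_append, ← Multiset.coe_add, List.map_cons,
    List.map_nil, ← Multiset.singleton_add, Multiset.coe_singleton, add_comm]

theorem Awt.mk_head_wheelVerts (j : ℕ) (u v : List Letter)
    (hu : ∀ n ∈ tails u, n % 2 = 0 ∨ n = 1) (hv : ∀ n ∈ tails v, n % 2 = 0 ∨ n = 1) :
    mk K ⟨u ++ [head (2 * j + 1)] ++ v, wheelVerts j⟩ =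
      toJacobi K (ev (wd K u * (LTree.comb (spokes j) 1).eval K * wd K v)) := by
  induction j generalizing u v with
  | zero =>
    simp only [spokes, LTree.comb, LTree.eval, ← wd_append, ev_wd, toJacobi_mk]
    rfl
  | succ j ih =>
    have e : 2 * (j + 1) + 1 = 2 * j + 3 := by ring
    have w1 : ∀ a b : Letter, u ++ [a, b] ++ v = (u ++ [a]) ++ [b] ++ v := fun a b => by simp
    have w2 : ∀ a b : Letter, u ++ [a, b] ++ v = u ++ [a] ++ ([b] ++ v) := fun a b => by simp
    rw [e, wheelVerts_succ, mk_stu₁, w1, ih (u ++ [head (2 * j)]) v (by simpa using hu) hv, w2,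
      ih u ([head (2 * j)] ++ v) hu (by simpa using hv), ← map_sub, ← map_sub]
    · congr 2
      simp only [spokes, LTree.comb, LTree.eval, Ring.lie_def, wd_append]
      noncomm_ring
    · simp only [JWord.starts, wheelVerts, tails_append, Multiset.map_coe, List.map_map,
        Multiset.mem_add, Multiset.mem_coe, List.mem_append, List.mem_map, List.mem_range,
        Function.comp_apply]
      rintro ((( h | h) | h) | ⟨i, hi, h⟩)
      · have := hu _ h; omega
      · simp at h
      · have := hv _ h; omega
      · omega

theorem perm_spokes (j : ℕ) : ((List.range j).map fun i => 2 * i).Perm (spokes j) := by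
  induction j with
  | zero => exact List.Perm.nil
  | succ j ih =>
    rw [List.range_succ, List.map_append]
    exact (List.perm_append_singleton _ _).trans (ih.cons _)

theorem wheelWord_succ (j : ℕ) :
    wheelWord (j + 1) = ⟨((List.range j).map fun i => 2 * i).map tail ++ [tail (2 * j)] ++ [],
      ⟨2 * j, 2 * j + 1, 1⟩ ::ₘ wheelVerts j⟩ := by
  have h1 : ((List.range j).map fun i =>
      (⟨2 * i, 2 * i + 1, 2 * ((i + 1) % (j + 1)) + 1⟩ : Vertex)) =
      (List.range j).map fun i => ⟨2 * i, 2 * i + 1, 2 * i + 3⟩ := by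
    refine List.map_congr_left fun i hi => ?_
    rw [Nat.mod_eq_of_lt (by have := List.mem_range.1 hi; omega)]
    congr 1
  rw [wheelWord, List.range_succ, List.map_append, List.map_append, h1, List.map_map]
  congr 1
  · simp
  · rw [← Multiset.coe_add, add_comm]
    simp [wheelVerts]

theorem toJacobi_wheelSum (k : ℕ+) :
    toJacobi K (wheelSum K (k - 1)) = Awt.of K (JacobiDiagram.wheel k) := by
  obtain ⟨j, hj⟩ : ∃ j, (k : ℕ) = j + 1 := ⟨k - 1, by have := k.pos; omega⟩
  have hv := wheelWord_valid k
  rw [JacobiDiagram.wheel, ← Awt.mk_of_valid hv, hj, Nat.add_sub_cancel]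
  rw [hj] at hv
  rw [wheelWord_succ] at hv ⊢
  have ht : ∀ n ∈ tails (((List.range j).map fun i => 2 * i).map tail), n % 2 = 0 ∨ n = 1 := by
    rw [tails_map_tail]
    simp only [List.mem_map]
    rintro _ ⟨i, -, rfl⟩
    omega
  have h1 := Awt.mk_head_wheelVerts (K := K) j (((List.range j).map fun i => 2 * i).map tail)
    [tail 1] ht (by simp)
  have h2 := Awt.mk_head_wheelVerts (K := K) j
    (((List.range j).map fun i => 2 * i).map tail ++ [tail 1]) [] (by
      rw [tails_append]
      intro n hn
      rcases List.mem_append.1 hn with hn | hn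
      · exact ht n hn
      · exact Or.inr (by simpa using hn)) (by simp)
  rw [Awt.mk_stu₂'_of_valid _ _ _ _ _ _ hv]
  simp only [List.append_assoc, List.cons_append, List.nil_append, List.append_nil] at h1 h2 ⊢
  rw [h1, h2, ← map_sub, ← map_sub, wheelSum, wheelElt]
  have h3 := ev_tls_perm (K := K) (perm_spokes j) 1 ⁅(LTree.comb (spokes j) 1).eval K, tl K 1⁆
  rw [one_mul, one_mul] at h3
  rw [← h3, tls_eq_wd]
  congr 2
  rw [wd_append, wd_nil, Ring.lie_def]
  noncomm_ring

end JacobiQuotient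

/-! ### Summation over colourings -/

section SumOver

variable {B : Type*} [Fintype B] {R : Type*} [Ring R]

/-- The sum of `F` over all the ways of changing the values at the names in the list. -/
def sumOver : List ℕ → ((ℕ → B) → R) → (ℕ → B) → R
  | [], F, χ => F χ
  | n :: l, F, χ => ∑ b, sumOver l F (Function.update χ n b)

theorem sumOver_append (l m : List ℕ) (F : (ℕ → B) → R) :
    sumOver (l ++ m) F = sumOver l (sumOver m F) := by
  induction l with
  | nil => rfl
  | cons n l ih =>
    funext χ
    simp only [List.cons_append, sumOver, ih]

theorem sumOver_perm {l m : List ℕ} (h : l.Perm m) (F : (ℕ → B) → R) :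
    sumOver l F = sumOver m F := by
  induction h with
  | nil => rfl
  | cons n _ ih => funext χ; simp only [sumOver, ih]
  | swap n m l =>
    funext χ
    simp only [sumOver]
    by_cases h : n = m
    · subst h; simp
    · rw [Finset.sum_comm]
      simp only [Function.update_comm h]
  | trans _ _ ih₁ ih₂ => exact ih₁.trans ih₂

theorem sumOver_map (f : Equiv.Perm ℕ) (l : List ℕ) (F : (ℕ → B) → R) (χ : ℕ → B) :
    sumOver (l.map f) (fun χ => F (χ ∘ f)) χ = sumOver l F (χ ∘ f) := by
  induction l generalizing χ with
  | nil => rfl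
  | cons n l ih =>
    simp only [List.map_cons, sumOver, ih]
    refine Finset.sum_congr rfl fun b _ => ?_
    congr 1
    exact Function.update_comp_eq_of_injective χ f.injective n b

theorem sumOver_congr_left {l : List ℕ} {F : (ℕ → B) → R} {s : Set ℕ}
    (hF : ∀ χ χ' : ℕ → B, (∀ n ∈ s, χ n = χ' n) → F χ = F χ') {χ χ' : ℕ → B}
    (h : ∀ n ∈ s, n ∉ l → χ n = χ' n) : sumOver l F χ = sumOver l F χ' := by
  induction l generalizing χ χ' with
  | nil => exact hF _ _ fun n hn => h n hn (by simp)
  | cons m l ih =>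
    simp only [sumOver]
    refine Finset.sum_congr rfl fun b _ => ih fun n hn hnl => ?_
    by_cases hnm : n = m
    · simp [hnm]
    · rw [Function.update_of_ne hnm, Function.update_of_ne hnm]
      exact h n hn (by simp [hnm, hnl])

theorem sumOver_sub (l : List ℕ) (F G : (ℕ → B) → R) (χ : ℕ → B) :
    sumOver l (fun χ => F χ - G χ) χ = sumOver l F χ - sumOver l G χ := by
  induction l generalizing χ with
  | nil => rfl
  | cons n l ih => simp only [sumOver, ih, Finset.sum_sub_distrib]

theorem sumOver_mul_const (l : List ℕ) (F : (ℕ → B) → R) (r : R) (χ : ℕ → B) :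
    sumOver l (fun χ => F χ * r) χ = sumOver l F χ * r := by
  induction l generalizing χ with
  | nil => rfl
  | cons n l ih => simp only [sumOver, ih, Finset.sum_mul]

theorem sumOver_mul {l : List ℕ} {F : (ℕ → B) → R} (G : (ℕ → B) → R)
    (hF : ∀ χ n b, n ∈ l → F (Function.update χ n b) = F χ) (χ : ℕ → B) :
    sumOver l (fun χ => F χ * G χ) χ = F χ * sumOver l G χ := by
  induction l generalizing χ with
  | nil => rfl
  | cons n l ih =>
    simp only [sumOver, Finset.mul_sum]
    refine Finset.sum_congr rfl fun b _ => ?_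
    rw [ih fun χ m b hm => hF χ m b (by simp [hm]), hF χ n b (by simp)]

end SumOver

/-! ### State sums -/

/-- The data of a state sum: arrows are coloured by the elements of `B`, a vertex contributes
a structure constant `f`, and the heads and tails on the skeleton contribute elements of `R`. The
elements `x` satisfy the commutation relations of the Lie algebra with structure constants `f`, and
act on the commuting elements `φ` as this Lie algebra acts on its dual. -/
structure StateModel (K : Type u) [Field K] (B : Type*) [Fintype B] (R : Type*) [Ring R]
    [Algebra K R] where
  f : B → B → B → K
  x : B → R
  φ : B → R
  antisymm : ∀ a b c, f a b c = -f b a c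
  lie_x : ∀ a b, ∑ c, f a b c • x c = x a * x b - x b * x a
  lie_φ : ∀ a c, ∑ b, f a b c • φ b = φ c * x a - x a * φ c
  φ_comm : ∀ a b, φ a * φ b = φ b * φ a

namespace StateModel

variable {K : Type u} [Field K] {B : Type*} [Fintype B] {R : Type*} [Ring R] [Algebra K R]
  (m : StateModel K B R)

/-- The contribution of a skeleton vertex. -/
def letter (χ : ℕ → B) : Letter → R
  | tail e => m.φ (χ e)
  | head e => m.x (χ e)

/-- The contribution of a piece of the skeleton. -/
def word (χ : ℕ → B) (w : List Letter) : R := (w.map (m.letter χ)).prod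

/-- The contribution of the internal vertices. -/
def verts (χ : ℕ → B) (V : Multiset Vertex) : K :=
  (V.map fun v => m.f (χ v.left) (χ v.right) (χ v.out)).prod

/-- The contribution of a coloured diagram. -/
def weight (D : JWord) (χ : ℕ → B) : R := m.verts χ D.verts • m.word χ D.skel

theorem word_append (χ : ℕ → B) (u v : List Letter) :
    m.word χ (u ++ v) = m.word χ u * m.word χ v := by
  simp [word]

theorem word_cons (χ : ℕ → B) (l : Letter) (v : List Letter) :
    m.word χ (l :: v) = m.letter χ l * m.word χ v := by
  simp [word]

theorem word_nil (χ : ℕ → B) : m.word χ [] = 1 := rfl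

theorem verts_cons (χ : ℕ → B) (v : Vertex) (V : Multiset Vertex) :
    m.verts χ (v ::ₘ V) = m.f (χ v.left) (χ v.right) (χ v.out) * m.verts χ V := by
  simp [verts]

theorem verts_zero (χ : ℕ → B) : m.verts χ 0 = 1 := by simp [verts]

theorem word_congr {χ χ' : ℕ → B} {w : List Letter} (h : ∀ l ∈ w, χ l.name = χ' l.name) :
    m.word χ w = m.word χ' w := by
  unfold word
  congr 1
  refine List.map_congr_left fun l hl => ?_
  have := h l hl
  cases l <;> simp_all [letter]

theorem verts_congr {χ χ' : ℕ → B} {V : Multiset Vertex}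
    (h : ∀ v ∈ V, χ v.left = χ' v.left ∧ χ v.right = χ' v.right ∧ χ v.out = χ' v.out) :
    m.verts χ V = m.verts χ' V := by
  unfold verts
  congr 1
  refine Multiset.map_congr rfl fun v hv => ?_
  rw [(h v hv).1, (h v hv).2.1, (h v hv).2.2]

/-- The contributions depend only on the colours of the names in use. -/
theorem congr_of_starts_ends {D : JWord} {χ χ' : ℕ → B}
    (h : ∀ n, n ∈ D.starts ∨ n ∈ D.ends → χ n = χ' n) :
    m.verts χ D.verts = m.verts χ' D.verts ∧ m.word χ D.skel = m.word χ' D.skel := by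
  refine ⟨m.verts_congr fun v hv => ⟨?_, ?_, ?_⟩, m.word_congr fun l hl => ?_⟩
  · exact h _ (Or.inr (Multiset.mem_add.2 (Or.inl (Multiset.mem_add.2
      (Or.inr (Multiset.mem_map_of_mem _ hv))))))
  · exact h _ (Or.inr (Multiset.mem_add.2 (Or.inr (Multiset.mem_map_of_mem _ hv))))
  · exact h _ (Or.inl (Multiset.mem_add.2 (Or.inr (Multiset.mem_map_of_mem _ hv))))
  · rcases mem_names_iff.1 ⟨l, hl, rfl⟩ with h1 | h1
    · exact h _ (Or.inl (Multiset.mem_add.2 (Or.inl h1)))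
    · exact h _ (Or.inr (Multiset.mem_add.2 (Or.inl (Multiset.mem_add.2 (Or.inl h1)))))

theorem weight_congr {D : JWord} (hD : D.Valid) {χ χ' : ℕ → B}
    (h : ∀ n ∈ D.starts, χ n = χ' n) : m.weight D χ = m.weight D χ' := by
  have := m.congr_of_starts_ends (D := D) (χ := χ) (χ' := χ')
    fun n hn => h n (hn.elim id fun hn => hD.2 ▸ hn)
  rw [weight, weight, this.1, this.2]

theorem weight_rename (f : ℕ → ℕ) (D : JWord) (χ : ℕ → B) :
    m.weight (D.rename f) χ = m.weight D (χ ∘ f) := by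
  unfold weight
  congr 1
  · simp only [verts, JWord.rename, Multiset.map_map]
    rfl
  · simp only [word, JWord.rename, WKnot.rename, List.map_map]
    congr 1
    refine List.map_congr_left fun l _ => ?_
    cases l <;> rfl

theorem weight_update {D : JWord} {e : ℕ} (h1 : e ∉ D.starts) (h2 : e ∉ D.ends) (χ : ℕ → B)
    (b : B) : m.verts (Function.update χ e b) D.verts = m.verts χ D.verts ∧
      m.word (Function.update χ e b) D.skel = m.word χ D.skel := by
  refine m.congr_of_starts_ends fun n hn => Function.update_of_ne ?_ _ _
  rintro rfl
  exact hn.elim h1 h2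

variable [Inhabited B]

/-- The sum of the contributions of all the colourings of the arrows of a diagram. -/
noncomputable def state (D : JWord) : R := sumOver D.starts.toList (m.weight D) fun _ => default

theorem state_eq {D : JWord} (hD : D.Valid) {l : List ℕ} (hl : (l : Multiset ℕ) = D.starts)
    (χ : ℕ → B) : m.state D = sumOver l (m.weight D) χ := by
  have hp : D.starts.toList.Perm l := by
    rw [← Multiset.coe_eq_coe, Multiset.coe_toList, hl]
  rw [state, sumOver_perm hp]
  refine sumOver_congr_left (s := {n | n ∈ D.starts}) (fun χ χ' h => m.weight_congr hD h) ?_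
  intro n hn hnl
  rw [Set.mem_ofPred_eq, ← hl] at hn
  exact absurd hn hnl

theorem state_rename {D : JWord} (hD : D.Valid) (f : Equiv.Perm ℕ) :
    m.state (D.rename f) = m.state D := by
  have hv : (D.rename f).Valid := hD.rename fun m _ n _ h => f.injective h
  rw [m.state_eq hv (l := D.starts.toList.map f) _ fun _ => default,
    m.state_eq hD (Multiset.coe_toList _) ((fun _ => default) ∘ f), ← sumOver_map]
  · congr 1
    funext χ
    exact m.weight_rename f D χ
  · rw [JWord.starts_rename, ← Multiset.map_coe, Multiset.coe_toList]

theorem state_renamed {D : JWord} (hD : D.Valid) {f : ℕ → ℕ} (hE : (D.rename f).Valid) :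
    m.state (D.rename f) = m.state D := by
  have hl : (D.starts.toList.map f).Nodup := by
    rw [← Multiset.coe_nodup, ← Multiset.map_coe, Multiset.coe_toList, ← JWord.starts_rename]
    exact hE.1
  obtain ⟨π, hπ⟩ := exists_perm_map_eq (l := D.starts.toList)
    (by rw [← Multiset.coe_nodup, Multiset.coe_toList]; exact hD.1) hl (by simp)
  rw [← m.state_rename hD π, JWord.rename_congr hD fun n hn => ?_]
  exact ((List.map_inj_left.1 hπ) n (Multiset.mem_toList.2 hn)).symm

/-- The state sum of a diagram without internal vertices is multiplicative. -/
theorem state_append {u v : List Letter} (hu : Valid u) (hv : Valid v)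
    (h : ∀ n ∈ tails u, n ∉ tails v) : m.state ⟨u ++ v, 0⟩ = m.state ⟨u, 0⟩ * m.state ⟨v, 0⟩ := by
  have hs : ∀ w : List Letter, (tails w : Multiset ℕ) = JWord.starts ⟨w, 0⟩ := fun w => by
    simp [JWord.starts]
  rw [m.state_eq (hu.append hv h).toJWord (hs _) fun _ => default,
    m.state_eq hu.toJWord (hs _) fun _ => default, tails_append, sumOver_append, ← sumOver_mul_const]
  congr 1
  funext χ
  rw [m.state_eq hv.toJWord (hs _) χ]
  rw [← sumOver_mul]
  · congr 1
    funext χ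
    simp only [weight, verts_zero, one_smul, word_append]
  · intro χ n b hn
    refine m.weight_congr hu.toJWord fun k hk => ?_
    rw [← hs] at hk
    rw [Function.update_of_ne]
    rintro rfl
    exact h _ hk hn

theorem state_nil : m.state ⟨[], 0⟩ = 1 := by
  rw [m.state_eq (l := []) (Valid.toJWord (w := []) ⟨List.nodup_nil, List.Perm.nil⟩)
    (by simp [JWord.starts])
    fun _ => default]
  simp [sumOver, weight, verts_zero, word_nil]

/-- The state sum of a diagram. -/
noncomputable def diagramState : JacobiDiagram → R :=
  Quotient.lift (fun D : JacobiWord => m.state D.1) (by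
    rintro D E ⟨f, g, h1, h2⟩
    have hE := E.2
    rw [h1] at hE ⊢
    exact (m.state_renamed D.2 hE).symm)

/-- The state sum as a linear map on formal combinations of diagrams. -/
noncomputable def stateDwt : Dwt K →ₗ[K] R := Finsupp.lift R K JacobiDiagram m.diagramState

theorem stateDwt_jdia {D : JWord} (hD : D.Valid) : m.stateDwt (jdia K D) = m.state D := by
  rw [jdia, dif_pos hD, stateDwt, Finsupp.lift_apply, Finsupp.sum_single_index (by simp), one_smul]
  rfl

/-- A relation between diagrams which differ by shrinking the arrow `e` follows from the
corresponding identity of the sum over the colours of `e`. -/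
theorem state_shrink {D D₁ D₂ : JWord} (hD : D.Valid) {e : ℕ} (h1 : D₁.Valid) (h2 : D₂.Valid)
    (hs : D.starts = e ::ₘ D₁.starts) (hs' : D₂.starts = D₁.starts)
    (h : ∀ χ, ∑ b, m.weight D (Function.update χ e b) = m.weight D₁ χ - m.weight D₂ χ) :
    m.state D = m.state D₁ - m.state D₂ := by
  rw [m.state_eq hD (l := D₁.starts.toList ++ [e]) _ fun _ => default,
    m.state_eq h1 (Multiset.coe_toList _) fun _ => default,
    m.state_eq h2 (l := D₁.starts.toList) (by rw [hs', Multiset.coe_toList]) fun _ => default,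
    sumOver_append, ← sumOver_sub]
  · congr 1
    funext χ
    exact h χ
  · rw [hs, ← Multiset.coe_add, Multiset.coe_toList, add_comm, Multiset.coe_singleton,
      Multiset.singleton_add]

theorem stateDwt_rel {y : Dwt K} (h : JRel K y) : m.stateDwt y = 0 := by
  have hnames : ∀ (S₁ S₂ : List Letter) (V : Multiset Vertex) (e : ℕ),
      e ∉ JWord.starts ⟨S₁ ++ S₂, V⟩ → e ∉ JWord.ends ⟨S₁ ++ S₂, V⟩ → ∀ (χ : ℕ → B) (b : B),
      m.verts (Function.update χ e b) V = m.verts χ V ∧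
      m.word (Function.update χ e b) S₁ = m.word χ S₁ ∧
      m.word (Function.update χ e b) S₂ = m.word χ S₂ := by
    intro S₁ S₂ V e h1 h2 χ b
    simp only [JWord.starts, JWord.ends, tails_append, heads_append, Multiset.mem_add,
      Multiset.mem_coe, List.mem_append, not_or] at h1 h2
    refine ⟨(m.weight_update (D := ⟨[], V⟩) ?_ ?_ χ b).1,
      (m.weight_update (D := ⟨S₁, 0⟩) ?_ ?_ χ b).2, (m.weight_update (D := ⟨S₂, 0⟩) ?_ ?_ χ b).2⟩ <;>
      simp_all [JWord.starts, JWord.ends]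
  cases h with
  | tc S₁ S₂ V p q h =>
    have hP : (S₁ ++ [tail p, tail q] ++ S₂).Perm (S₁ ++ [tail q, tail p] ++ S₂) :=
      ((List.Perm.swap _ _ _).append_left S₁).append_right S₂
    have h' := (Awt.valid_perm V hP).1 h
    rw [map_sub, m.stateDwt_jdia h, m.stateDwt_jdia h', sub_eq_zero,
      m.state_eq h (Multiset.coe_toList _) fun _ => default, m.state_eq h' _ fun _ => default]
    · congr 1
      funext χ
      simp only [weight, word_append, word_cons, letter, word_nil, mul_one, m.φ_comm (χ p)]
    · rw [Multiset.coe_toList, JWord.starts, JWord.starts, Multiset.coe_eq_coe.2 (tails_perm hP)]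
  | stu₁ S₁ S₂ V a b c h =>
    have hP : (S₁ ++ [head a, head b] ++ S₂).Perm (S₁ ++ [head b, head a] ++ S₂) :=
      ((List.Perm.swap _ _ _).append_left S₁).append_right S₂
    obtain ⟨hs, he⟩ := starts_ends_stu₁ S₁ S₂ V a b c
    obtain ⟨hc, h1⟩ := (JWord.valid_iff_of_shrink hs he).1 h
    have h2 := (Awt.valid_perm V hP).1 h1
    have hc' := hc
    rw [h1.2] at hc'
    have hk := hnames S₁ S₂ V c (by simp_all [JWord.starts]) (by simp_all [JWord.ends])
    have hca : a ≠ c := by rintro rfl; simp [JWord.ends] at hc'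
    have hcb : b ≠ c := by rintro rfl; simp [JWord.ends] at hc'
    rw [map_sub, map_sub, m.stateDwt_jdia h, m.stateDwt_jdia h1, m.stateDwt_jdia h2, sub_eq_zero]
    refine m.state_shrink h h1 h2 hs ?_ fun χ => ?_
    · rw [JWord.starts, JWord.starts, Multiset.coe_eq_coe.2 (tails_perm hP)]
    · simp only [weight, word_append, word_cons, letter, word_nil, mul_one, verts_cons,
        (hk χ _).1, (hk χ _).2.1, (hk χ _).2.2, Function.update_self, Function.update_of_ne hca,
        Function.update_of_ne hcb]
      rw [← smul_sub, ← sub_mul, ← mul_sub, ← m.lie_x, Finset.mul_sum, Finset.sum_mul,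
        Finset.smul_sum]
      refine Finset.sum_congr rfl fun k _ => ?_
      rw [mul_smul_comm, smul_mul_assoc, smul_smul, mul_comm]
  | stu₂ S₁ S₂ V a b c h =>
    have hP : (S₁ ++ [tail c, head a] ++ S₂).Perm (S₁ ++ [head a, tail c] ++ S₂) :=
      ((List.Perm.swap _ _ _).append_left S₁).append_right S₂
    obtain ⟨hs, he⟩ := starts_ends_stu₂ S₁ S₂ V a b c
    obtain ⟨hb, h1⟩ := (JWord.valid_iff_of_shrink hs he).1 h
    have h2 := (Awt.valid_perm V hP).1 h1
    have hb' := hb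
    rw [h1.2] at hb'
    have hk := hnames S₁ S₂ V b (by simp_all [JWord.starts]) (by simp_all [JWord.ends])
    have hba : a ≠ b := by rintro rfl; simp [JWord.ends] at hb'
    have hbc : c ≠ b := by rintro rfl; simp [JWord.starts] at hb
    rw [map_sub, map_sub, m.stateDwt_jdia h, m.stateDwt_jdia h1, m.stateDwt_jdia h2, sub_eq_zero]
    refine m.state_shrink h h1 h2 hs ?_ fun χ => ?_
    · rw [JWord.starts, JWord.starts, Multiset.coe_eq_coe.2 (tails_perm hP)]
    · simp only [weight, word_append, word_cons, letter, word_nil, mul_one, verts_cons,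
        (hk χ _).1, (hk χ _).2.1, (hk χ _).2.2, Function.update_self, Function.update_of_ne hba,
        Function.update_of_ne hbc]
      rw [← smul_sub, ← sub_mul, ← mul_sub, ← m.lie_φ, Finset.mul_sum, Finset.sum_mul,
        Finset.smul_sum]
      refine Finset.sum_congr rfl fun k _ => ?_
      rw [mul_smul_comm, smul_mul_assoc, smul_smul, mul_comm]
  | stu₂' S₁ S₂ V a b c h =>
    have hP : (S₁ ++ [head b, tail c] ++ S₂).Perm (S₁ ++ [tail c, head b] ++ S₂) :=
      ((List.Perm.swap _ _ _).append_left S₁).append_right S₂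
    obtain ⟨hs, he⟩ := starts_ends_stu₂' S₁ S₂ V a b c
    obtain ⟨ha, h1⟩ := (JWord.valid_iff_of_shrink hs he).1 h
    have h2 := (Awt.valid_perm V hP).1 h1
    have ha' := ha
    rw [h1.2] at ha'
    have hk := hnames S₁ S₂ V a (by simp_all [JWord.starts]) (by simp_all [JWord.ends])
    have hab : b ≠ a := by rintro rfl; simp [JWord.ends] at ha'
    have hac : c ≠ a := by rintro rfl; simp [JWord.starts] at ha
    rw [map_sub, map_sub, m.stateDwt_jdia h, m.stateDwt_jdia h1, m.stateDwt_jdia h2, sub_eq_zero]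
    refine m.state_shrink h h1 h2 hs ?_ fun χ => ?_
    · rw [JWord.starts, JWord.starts, Multiset.coe_eq_coe.2 (tails_perm hP)]
    · simp only [weight, word_append, word_cons, letter, word_nil, mul_one, verts_cons,
        (hk χ _).1, (hk χ _).2.1, (hk χ _).2.2, Function.update_self, Function.update_of_ne hab,
        Function.update_of_ne hac]
      rw [← smul_sub, ← sub_mul, ← mul_sub, ← neg_sub, ← m.lie_φ, mul_neg, neg_mul, Finset.mul_sum,
        Finset.sum_mul, smul_neg, Finset.smul_sum, ← Finset.sum_neg_distrib]
      refine Finset.sum_congr rfl fun k _ => ?_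
      rw [mul_smul_comm, smul_mul_assoc, smul_smul, ← neg_smul, m.antisymm k, neg_mul, mul_comm]

/-- The state sum as a linear map on w-Jacobi diagrams modulo STU and TC. -/
noncomputable def stateAwt : Awt K →ₗ[K] R :=
  Submodule.liftQ _ m.stateDwt (Submodule.span_le.2 fun _ h => m.stateDwt_rel h)

theorem stateAwt_mk {D : JWord} (hD : D.Valid) : m.stateAwt (Awt.mk K D) = m.state D :=
  (Submodule.liftQ_apply _ _ _).trans (m.stateDwt_jdia hD)

/-- The state sum as an algebra homomorphism on arrow diagrams. -/
noncomputable def stateAw : Aw K →ₐ[K] R :=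
  AlgHom.ofLinearMap (m.stateAwt ∘ₗ toJacobi K)
    (by
      have h : Valid [] := ⟨List.nodup_nil, List.Perm.nil⟩
      rw [← Aw.mk_nil, LinearMap.comp_apply, toJacobi_mk, m.stateAwt_mk h.toJWord, m.state_nil])
    (by
      intro x y
      induction x using Aw.induction with
      | hadd x x' hx hx' => rw [add_mul, map_add, hx, hx', map_add, add_mul]
      | hsmul r x hx => rw [smul_mul_assoc, map_smul, hx, map_smul, smul_mul_assoc]
      | hmk u hu =>
        induction y using Aw.induction with
        | hadd x x' hx hx' => rw [mul_add, map_add, hx, hx', map_add, mul_add]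
        | hsmul r x hx => rw [mul_smul_comm, map_smul, hx, map_smul, mul_smul_comm]
        | hmk v hv =>
          have ru : Renamed u (rename (fun n => 2 * n) u) := by
            refine ⟨_, fun n => n / 2, rfl, ?_⟩
            rw [rename_rename]
            exact (rename_eq_self fun a _ => by omega).symm
          have rv : Renamed v (rename (fun n => 2 * n + 1) v) := by
            refine ⟨_, fun n => n / 2, rfl, ?_⟩
            rw [rename_rename]
            exact (rename_eq_self fun a _ => by omega).symm
          have hu' := ru.valid hu
          have hv' := rv.valid hv
          have hd : ∀ n ∈ tails (rename (fun n => 2 * n) u),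
              n ∉ tails (rename (fun n => 2 * n + 1) v) := by
            simp only [tails_rename, List.mem_map]
            rintro _ ⟨a, -, rfl⟩ ⟨b, -, hb⟩
            omega
          rw [Aw.mk_renamed K ru, Aw.mk_renamed K rv, Aw.mk_mul K hu' hv' hd]
          simp only [LinearMap.comp_apply, toJacobi_mk]
          rw [m.stateAwt_mk (hu'.append hv' hd).toJWord, m.stateAwt_mk hu'.toJWord,
            m.stateAwt_mk hv'.toJWord, m.state_append hu' hv' hd])

theorem stateAw_apply (x : Aw K) : m.stateAw x = m.stateAwt (toJacobi K x) := rfl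

end StateModel

/-! ### State sums of wheels -/

/-- The names of the arrows, other than `1`, at the first `j` vertices of a wheel. -/
def wheelNames : ℕ → List ℕ
  | 0 => []
  | j + 1 => wheelNames j ++ [2 * j, 2 * j + 3]

/-- The part of a wheel made of the first `j` spokes. -/
def wheelPart (j : ℕ) : JWord := ⟨((List.range j).map fun i => 2 * i).map tail, wheelVerts j⟩

theorem starts_wheelPart (j : ℕ) : (wheelPart j).starts = wheelNames j := by
  induction j with
  | zero => rfl
  | succ j ih =>
    rw [wheelNames, ← Multiset.coe_add, ← ih]
    simp only [JWord.starts, wheelPart, wheelVerts_succ, List.range_succ, List.map_append,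
      tails_append, ← Multiset.coe_add, Multiset.map_cons, List.map_cons, List.map_nil,
      tails_cons_tail, tails_nil]
    simp only [← Multiset.singleton_add, ← Multiset.cons_coe, Multiset.coe_nil]
    abel

theorem lt_of_mem_wheelPart {j n : ℕ} (h : n ∈ (wheelPart j).starts ∨ n ∈ (wheelPart j).ends) :
    n < 2 * j ∨ n = 2 * j + 1 := by
  simp only [wheelPart, JWord.starts, JWord.ends, tails_map_tail, heads_map_tail] at h
  simp only [wheelVerts, Multiset.mem_add, Multiset.mem_coe, List.mem_map, List.mem_range,
    Multiset.map_coe, List.map_map, Function.comp_apply, List.not_mem_nil, false_or] at h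
  rcases h with (⟨i, hi, rfl⟩ | ⟨i, hi, rfl⟩) | (⟨i, hi, rfl⟩ | ⟨i, hi, rfl⟩) <;> omega

namespace StateModel

variable {K : Type u} [Field K] {B : Type*} [Fintype B] {R : Type*} [Ring R] [Algebra K R]
  (m : StateModel K B R)

/-- The contribution of a vertex of a wheel together with its spoke, as a matrix indexed by the
colours of the incoming and the outgoing arrow of the cycle. -/
def vertexMatrix : Matrix B B R :=
  Matrix.of fun b c => ∑ a, m.f a b c • m.φ a

theorem weight_wheelPart_succ (j : ℕ) (χ : ℕ → B) :
    m.weight (wheelPart (j + 1)) χ = m.f (χ (2 * j)) (χ (2 * j + 1)) (χ (2 * j + 3)) •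
      (m.weight (wheelPart j) χ * m.φ (χ (2 * j))) := by
  simp only [weight, wheelPart, wheelVerts_succ, verts_cons, List.range_succ, List.map_append,
    word_append, List.map_cons, List.map_nil, word_cons, word_nil, letter, mul_one, mul_smul,
    smul_mul_assoc]

theorem weight_wheelPart_congr {j : ℕ} {χ χ' : ℕ → B}
    (h : ∀ n, n < 2 * j ∨ n = 2 * j + 1 → χ n = χ' n) :
    m.weight (wheelPart j) χ = m.weight (wheelPart j) χ' := by
  have := m.congr_of_starts_ends (D := wheelPart j) (χ := χ) (χ' := χ')
    fun n hn => h n (lt_of_mem_wheelPart hn)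
  rw [weight, weight, this.1, this.2]

theorem stateAw_dR [Inhabited B] : m.stateAw (Aw.mk K [tail 0, head 0]) = ∑ b, m.φ b * m.x b := by
  have h : Valid [tail 0, head 0] := ⟨by simp, by simp⟩
  rw [stateAw_apply, toJacobi_mk, m.stateAwt_mk h.toJWord,
    m.state_eq h.toJWord (l := [0]) (by simp [JWord.starts]) fun _ => default]
  simp [sumOver, weight, verts_zero, word_cons, word_nil, letter]

variable [DecidableEq B]

theorem sumOver_wheelPart (j : ℕ) (G : B → B → R) (χ : ℕ → B) :
    sumOver (wheelNames j) (fun χ => m.weight (wheelPart j) χ * G (χ (2 * j + 1)) (χ 1)) χ =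
      ∑ d, (m.vertexMatrix ^ j) (χ 1) d * G d (χ 1) := by
  induction j generalizing G χ with
  | zero =>
    simp [wheelNames, sumOver, wheelPart, wheelVerts, weight, verts_zero, word_nil, Matrix.one_apply]
  | succ j ih =>
    have hstep : sumOver [2 * j, 2 * j + 3]
        (fun χ => m.weight (wheelPart (j + 1)) χ * G (χ (2 * (j + 1) + 1)) (χ 1)) =
        fun χ => m.weight (wheelPart j) χ *
          ∑ d, m.vertexMatrix (χ (2 * j + 1)) d * G d (χ 1) := by
      funext χ
      simp only [sumOver]
      rw [Finset.sum_comm, Finset.mul_sum]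
      refine Finset.sum_congr rfl fun d _ => ?_
      rw [vertexMatrix, Matrix.of_apply, Finset.sum_mul, Finset.mul_sum]
      refine Finset.sum_congr rfl fun a _ => ?_
      have e : 2 * (j + 1) + 1 = 2 * j + 3 := by ring
      rw [e, weight_wheelPart_succ, Function.update_self,
        Function.update_of_ne (show 2 * j ≠ 2 * j + 3 by omega), Function.update_self,
        Function.update_of_ne (show 2 * j + 1 ≠ 2 * j + 3 by omega),
        Function.update_of_ne (show 2 * j + 1 ≠ 2 * j by omega),
        Function.update_of_ne (show 1 ≠ 2 * j + 3 by omega),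
        Function.update_of_ne (show 1 ≠ 2 * j by omega),
        m.weight_wheelPart_congr (χ' := χ)]
      · simp only [smul_mul_assoc, mul_smul_comm, mul_assoc]
      · intro n hn
        rw [Function.update_of_ne (by omega), Function.update_of_ne (by omega)]
    rw [wheelNames, sumOver_append, hstep]
    refine (ih (fun b c => ∑ d, m.vertexMatrix b d * G d c) χ).trans ?_
    simp only [pow_succ, Matrix.mul_apply, Finset.mul_sum, Finset.sum_mul, mul_assoc]
    exact Finset.sum_comm

variable [Inhabited B]

/-- The sum over the colours of the cycle of a wheel is a trace. -/
theorem state_wheelWord (j : ℕ) :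
    m.state (wheelWord (j + 1)) = (m.vertexMatrix ^ (j + 1)).trace := by
  have hw : ∀ χ, m.weight (wheelWord (j + 1)) χ =
      m.f (χ (2 * j)) (χ (2 * j + 1)) (χ 1) • (m.weight (wheelPart j) χ * m.φ (χ (2 * j))) := by
    intro χ
    simp only [wheelWord_succ, weight, wheelPart, verts_cons, word_append, word_cons, word_nil,
      letter, mul_one, mul_smul, smul_mul_assoc]
  have hstep : sumOver [2 * j] (m.weight (wheelWord (j + 1))) =
      fun χ => m.weight (wheelPart j) χ * m.vertexMatrix (χ (2 * j + 1)) (χ 1) := by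
    funext χ
    simp only [sumOver, hw]
    rw [vertexMatrix, Matrix.of_apply, Finset.mul_sum]
    refine Finset.sum_congr rfl fun a _ => ?_
    rw [Function.update_self, Function.update_of_ne (show 2 * j + 1 ≠ 2 * j by omega),
      Function.update_of_ne (show 1 ≠ 2 * j by omega), m.weight_wheelPart_congr (χ' := χ),
      mul_smul_comm]
    intro n hn
    rw [Function.update_of_ne (by omega)]
  rw [m.state_eq (wheelWord_valid _) (l := 1 :: (wheelNames j ++ [2 * j])) _ fun _ => default]
  · rw [sumOver, sumOver_append, hstep]
    simp only [Matrix.trace, Matrix.diag_apply, pow_succ, Matrix.mul_apply]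
    refine Finset.sum_congr rfl fun b _ => ?_
    refine (m.sumOver_wheelPart j (fun d b => m.vertexMatrix d b) _).trans ?_
    rw [Function.update_self]
  · rw [wheelWord_succ, ← Multiset.cons_coe, ← Multiset.coe_add, ← starts_wheelPart, wheelPart]
    simp only [JWord.starts, tails_append, ← Multiset.coe_add, Multiset.map_cons, List.append_nil,
      tails_cons_tail, tails_nil]
    simp only [← Multiset.singleton_add, ← Multiset.cons_coe, Multiset.coe_nil]
    abel

theorem stateAw_wheelSum (k : ℕ+) :
    m.stateAw (wheelSum K (k - 1)) = (m.vertexMatrix ^ (k : ℕ)).trace := by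
  obtain ⟨j, hj⟩ : ∃ j, (k : ℕ) = j + 1 := ⟨k - 1, by have := k.pos; omega⟩
  rw [stateAw_apply, toJacobi_wheelSum, JacobiDiagram.wheel, ← Awt.mk_of_valid (wheelWord_valid k),
    m.stateAwt_mk (wheelWord_valid k), hj, m.state_wheelWord]

end StateModel

/-! ### A state sum that separates the monomials in the generators -/

section Model

variable {K : Type u} [Field K] {ι : Type*}

open MvPolynomial

/-- The derivation `X_k ↦ M k i` for a given index `i`. -/
noncomputable def colDer (M : Matrix ι ι K) (i : ι) :
    Derivation K (MvPolynomial ι K) (MvPolynomial ι K) := mkDerivation K fun k => C (M k i)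

theorem lie_colDer (M : Matrix ι ι K) (i j : ι) : ⁅colDer M i, colDer M j⁆ = 0 := by
  refine MvPolynomial.derivation_ext fun k => ?_
  simp [Derivation.commutator_apply, colDer]

variable [Fintype ι]

/-- The derivation `X_k ↦ ∑ j, M k j X_j`. -/
noncomputable def matDer (M : Matrix ι ι K) :
    Derivation K (MvPolynomial ι K) (MvPolynomial ι K) :=
  mkDerivation K fun k => ∑ j, C (M k j) * X j

theorem derivation_sum_apply (D : ι → Derivation K (MvPolynomial ι K) (MvPolynomial ι K))
    (p : MvPolynomial ι K) : (∑ i, D i) p = ∑ i, D i p := by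
  have h := congrFun (map_sum Derivation.coeFnAddMonoidHom D Finset.univ) p
  rwa [Finset.sum_apply] at h

theorem lie_colDer_matDer (M : Matrix ι ι K) (i : ι) :
    ⁅colDer M i, matDer M⁆ = ∑ j, M j i • colDer M j := by
  refine MvPolynomial.derivation_ext fun k => ?_
  rw [derivation_sum_apply]
  simp only [Derivation.commutator_apply, colDer, matDer, mkDerivation_X, map_sum,
    Derivation.leibniz, derivation_C, smul_eq_mul, mul_zero, add_zero, sub_zero,
    Derivation.coe_smul, Pi.smul_apply]
  refine Finset.sum_congr rfl fun j _ => ?_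
  rw [smul_eq_C_mul, mul_comm]

theorem sum_X_mul_colDer (M : Matrix ι ι K) :
    ∑ i, (X i : MvPolynomial ι K) • colDer M i = matDer M := by
  refine MvPolynomial.derivation_ext fun k => ?_
  rw [derivation_sum_apply]
  simp only [Derivation.coe_smul, Pi.smul_apply, colDer,
    matDer, mkDerivation_X, smul_eq_mul]
  exact Finset.sum_congr rfl fun j _ => mul_comm _ _

/-- The structure constants of the semidirect product of a line, acting by the matrix `M`, with an
abelian Lie algebra. -/
def lineConst (M : Matrix ι ι K) : Option ι → Option ι → Option ι → K
  | none, some i, some j => M j i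
  | some i, none, some j => -M j i
  | _, _, _ => 0

/-- The heads: the line acts by the scalar `t` minus a derivation, the abelian part by derivations
with constant coefficients. -/
noncomputable def lineHead (M : Matrix ι ι K) (t : K) :
    Option ι → Module.End K (MvPolynomial ι K)
  | none => t • 1 - (matDer M).toLinearMap
  | some i => (colDer M i).toLinearMap

/-- The tails: the constant `1` and the multiplications by the variables. -/
noncomputable def lineTail : Option ι → Module.End K (MvPolynomial ι K)
  | none => 1
  | some i => LinearMap.mulLeft K (X i)

/-- The state sum of the semidirect product of a line with an abelian Lie algebra, acting on
polynomial functions. -/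
noncomputable def lineModel (M : Matrix ι ι K) (t : K) :
    StateModel K (Option ι) (Module.End K (MvPolynomial ι K)) where
  f := lineConst M
  x := lineHead M t
  φ := lineTail
  antisymm := by
    rintro (_ | i) (_ | j) (_ | k) <;> simp [lineConst]
  φ_comm := by
    rintro (_ | i) (_ | j)
    · rfl
    · simp [lineTail]
    · simp [lineTail]
    · refine LinearMap.ext fun p => ?_
      simp only [lineTail, Module.End.mul_apply, LinearMap.mulLeft_apply]
      ring
  lie_x := by
    have h1 : ∀ i, ∑ j, M j i • (colDer M j).toLinearMap =
        (colDer M i).toLinearMap * (matDer M).toLinearMap -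
          (matDer M).toLinearMap * (colDer M i).toLinearMap := by
      intro i
      refine LinearMap.ext fun p => ?_
      have := congrArg (fun D => D p) (lie_colDer_matDer M i)
      simp only [derivation_sum_apply, Derivation.commutator_apply] at this
      simpa using this.symm
    rintro (_ | i) (_ | j)
    · simp [lineConst]
    · simp only [Fintype.sum_option, lineConst, zero_smul, zero_add, lineHead, h1, mul_sub, sub_mul,
        smul_mul_assoc, mul_smul_comm, one_mul, mul_one]
      abel
    · simp only [Fintype.sum_option, lineConst, zero_smul, zero_add, lineHead, neg_smul,
        Finset.sum_neg_distrib, h1, mul_sub, sub_mul,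
        smul_mul_assoc, mul_smul_comm, one_mul, mul_one]
      abel
    · simp only [lineConst, zero_smul, Finset.sum_const_zero, lineHead]
      refine LinearMap.ext fun p => ?_
      have := congrArg (fun D => D p) (lie_colDer M i j)
      simpa [Derivation.commutator_apply] using this.symm
  lie_φ := by
    rintro (_ | i) (_ | k)
    · simp [lineConst, lineTail]
    · simp only [Fintype.sum_option, lineConst, zero_smul, zero_add, lineHead, lineTail]
      refine LinearMap.ext fun p => ?_
      simp only [matDer, LinearMap.sum_apply, smul_eq_C_mul, LinearMap.smul_apply,
        LinearMap.mulLeft_apply, LinearMap.sub_apply, Module.End.mul_apply, Module.End.one_apply,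
        Derivation.coeFn_coe, Derivation.leibniz, mkDerivation_X,
        smul_eq_mul, ← mul_assoc (C _), ← Finset.sum_mul]
      ring
    · simp [lineConst, lineTail]
    · simp only [Fintype.sum_option, lineConst, zero_smul, Finset.sum_const_zero, add_zero,
        lineHead, lineTail]
      refine LinearMap.ext fun p => ?_
      simp [colDer, smul_eq_C_mul, mul_comm]

theorem stateAw_lineModel_dR (M : Matrix ι ι K) (t : K) :
    (lineModel M t).stateAw (Aw.mk K [tail 0, head 0]) = t • 1 := by
  rw [StateModel.stateAw_dR, Fintype.sum_option]
  refine LinearMap.ext fun p => ?_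
  have := congrArg (fun D => D p) (sum_X_mul_colDer M)
  simp only [derivation_sum_apply] at this
  simp [lineModel, lineHead, lineTail, ← this]

variable [DecidableEq ι]

theorem trace_vertexMatrix_pow (M : Matrix ι ι K) (t : K) (k : ℕ) :
    ((lineModel M t).vertexMatrix ^ (k + 1)).trace = (M ^ (k + 1)).trace • 1 := by
  -- The column of the line vanishes, and the block of the abelian part is the transpose of `M`.
  set N := (lineModel M t).vertexMatrix with hN
  have h1 : ∀ i j, N (some i) (some j) = M j i • 1 := fun i j => by
    simp [hN, StateModel.vertexMatrix, lineModel, Fintype.sum_option, lineConst, lineTail]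
  have h2 : ∀ b, N b none = 0 := fun b => by
    cases b <;> simp [hN, StateModel.vertexMatrix, lineModel, Fintype.sum_option, lineConst]
  have h3 : ∀ k b, (N ^ (k + 1)) b none = 0 := fun k b => by
    rw [pow_succ, Matrix.mul_apply]
    exact Finset.sum_eq_zero fun d _ => by rw [h2, mul_zero]
  have h4 : ∀ k i j, (N ^ (k + 1)) (some i) (some j) = (M ^ (k + 1)) j i • 1 := by
    intro k
    induction k with
    | zero => simpa using h1
    | succ k ih =>
      intro i j
      rw [pow_succ N, Matrix.mul_apply, Fintype.sum_option, h3, zero_mul, zero_add, pow_succ' M,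
        Matrix.mul_apply, Finset.sum_smul]
      refine Finset.sum_congr rfl fun d _ => ?_
      rw [ih, h1, smul_mul_smul_comm, one_mul, mul_comm]
  rw [Matrix.trace, Fintype.sum_option, Matrix.diag_apply, h3, zero_add, Matrix.trace,
    Finset.sum_smul]
  exact Finset.sum_congr rfl fun i _ => h4 k i i

theorem stateAw_lineModel_wheelSum (M : Matrix ι ι K) (t : K) (k : ℕ+) :
    (lineModel M t).stateAw (wheelSum K (k - 1)) = (M ^ (k : ℕ)).trace • 1 := by
  rw [StateModel.stateAw_wheelSum]
  obtain ⟨j, hj⟩ : ∃ j, (k : ℕ) = j + 1 := ⟨k - 1, by have := k.pos; omega⟩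
  rw [hj, trace_vertexMatrix_pow]

end Model

/-! ### Matrices with prescribed traces of powers -/

section Traces

variable {K : Type u} [Field K]

/-- The weighted cyclic shift: the matrix of the cycle `0 → 1 → ⋯ → n - 1 → 0`, whose last step
has weight `z` and whose other steps have weight `1`. -/
def cycleMatrix (n : ℕ) (z : K) : Matrix (Fin n) (Fin n) K :=
  Matrix.of fun i k => if k.1 = i.1 + 1 then 1 else if k.1 + n = i.1 + 1 then z else 0

theorem cycleMatrix_pow_apply (n : ℕ) (z : K) {j : ℕ} (hj : j ≤ n) (i k : Fin n) :
    (cycleMatrix n z ^ j) i k = if k.1 = i.1 + j then 1 else if k.1 + n = i.1 + j then z else 0 := by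
  induction j generalizing i k with
  | zero =>
    have := k.2
    have := i.2
    rw [pow_zero, Matrix.one_apply]
    simp only [add_zero, Fin.ext_iff, eq_comm (a := i.1)]
    rw [if_neg (show ¬ k.1 + n = i.1 by omega)]
  | succ j ih =>
    have hk := k.2
    have hi := i.2
    rw [pow_succ', Matrix.mul_apply]
    by_cases h : i.1 + 1 < n
    · rw [Finset.sum_eq_single (⟨i.1 + 1, h⟩ : Fin n)]
      · rw [ih (by omega)]
        simp only [cycleMatrix, Matrix.of_apply, if_true, one_mul, add_assoc, add_comm 1 j]
      · intro b _ hb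
        have hb' : b.1 ≠ i.1 + 1 := fun e => hb (Fin.ext e)
        rw [cycleMatrix, Matrix.of_apply, if_neg hb', if_neg (by omega), zero_mul]
      · simp
    · rw [Finset.sum_eq_single (⟨0, by omega⟩ : Fin n)]
      · rw [ih (by omega)]
        simp only [cycleMatrix, Matrix.of_apply]
        rw [if_neg (show ¬ 0 = i.1 + 1 by omega), if_pos (show 0 + n = i.1 + 1 by omega),
          if_neg (show ¬ k.1 + n = 0 + j by omega), if_neg (show ¬ k.1 = i.1 + (j + 1) by omega)]
        split_ifs <;> first | omega | simp
      · intro b _ hb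
        have hb' : b.1 ≠ 0 := fun e => hb (Fin.ext e)
        have := b.2
        rw [cycleMatrix, Matrix.of_apply, if_neg (by omega), if_neg (by omega), zero_mul]
      · simp

theorem trace_cycleMatrix_pow_of_lt {n j : ℕ} (z : K) (h0 : j ≠ 0) (hj : j < n) :
    (cycleMatrix n z ^ j).trace = 0 :=
  Finset.sum_eq_zero fun i _ => by
    rw [Matrix.diag_apply, cycleMatrix_pow_apply n z hj.le,
      if_neg fun h => h0 (by omega), if_neg (by omega)]

theorem trace_cycleMatrix_pow_self (n : ℕ) (z : K) :
    (cycleMatrix n z ^ n).trace = n * z := by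
  refine (Finset.sum_congr rfl fun i _ => ?_ : _ = ∑ _ : Fin n, z).trans (by simp)
  rw [Matrix.diag_apply, cycleMatrix_pow_apply n z le_rfl, if_neg (by omega), if_pos rfl]

/-- Any finite sequence is the sequence of the traces of the first powers of some matrix: a
block `cycleMatrix n z` adjusts the trace of the `n`-th power and no earlier one. -/
theorem exists_trace_pow_eq [CharZero K] (a : ℕ → K) (N : ℕ) :
    ∃ (ι : Type) (_ : Fintype ι) (_ : DecidableEq ι) (M : Matrix ι ι K),
      ∀ j, 1 ≤ j → j ≤ N → (M ^ j).trace = a j := by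
  induction N with
  | zero => exact ⟨Empty, inferInstance, inferInstance, 0, fun j h1 h2 => by omega⟩
  | succ N ih =>
    obtain ⟨ι, _, _, M, hM⟩ := ih
    refine ⟨ι ⊕ Fin (N + 1), inferInstance, inferInstance, Matrix.fromBlocks M 0 0
      (cycleMatrix (N + 1) ((a (N + 1) - (M ^ (N + 1)).trace) / ((N + 1 : ℕ) : K))),
      fun j h1 h2 => ?_⟩
    rw [Matrix.fromBlocks_diagonal_pow, Matrix.trace, Fintype.sum_sum_type]
    change (M ^ j).trace + (cycleMatrix (N + 1) _ ^ j).trace = a j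
    rcases h2.lt_or_eq with h | rfl
    · rw [trace_cycleMatrix_pow_of_lt _ (by omega) h, hM j h1 (by omega), add_zero]
    · rw [trace_cycleMatrix_pow_self, mul_div_cancel₀ _ (Nat.cast_ne_zero.2 (by omega)),
        add_sub_cancel]

end Traces

/-! ### The values of the generators -/

section Generators

variable {K : Type u} [Field K]

/-- The values of the generators in `Aw K`. The `k`-wheel has `k` spokes and is the element
`wheelSum K (k - 1)`. -/
noncomputable def genVal (K : Type u) [Field K] : Gen → Aw K
  | Gen.dL => Aw.of K ArrowDiagram.dL
  | Gen.dR => Aw.of K ArrowDiagram.dR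
  | Gen.w k => wheelSum K (k - 1)

theorem of_dL : Aw.of K ArrowDiagram.dL = Aw.mk K [head 0, tail 0] := (Aw.mk_of_valid K _).symm

theorem of_dR : Aw.of K ArrowDiagram.dR = Aw.mk K [tail 0, head 0] := (Aw.mk_of_valid K _).symm

theorem genVal_w_one : genVal K (Gen.w 1) = genVal K Gen.dL - genVal K Gen.dR := by
  simp only [genVal, of_dL, of_dR]
  exact wheelSum_zero

theorem LTree.length_leaves_pos (X : LTree) : 0 < X.leaves.length := by
  induction X <;> simp_all [LTree.leaves]

theorem mk_mem_grade {w : List Letter} (h : Valid w) : Aw.mk K w ∈ Aw.grade K (tails w).length := by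
  rw [Aw.mk_of_valid K h]
  exact Submodule.subset_span ⟨_, rfl, rfl⟩

theorem ev_mem_grade {s : List Letter} (h : Valid s) {x : WordAlg K} (hx : x ∈ permSpan K s) :
    ev x ∈ Aw.grade K (tails s).length := by
  refine (Submodule.span_le (p := (Aw.grade K (tails s).length).comap ev)).2 ?_ hx
  rintro _ ⟨w, hw, rfl⟩
  rw [SetLike.mem_coe, Submodule.mem_comap, ev_wd, ← (tails_perm hw).length_eq]
  exact mk_mem_grade (h.of_perm hw.symm)

theorem one_mem_grade : (1 : Aw K) ∈ Aw.grade K 0 := by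
  have h := mk_mem_grade (K := K) (w := []) ⟨List.nodup_nil, List.Perm.nil⟩
  rwa [Aw.mk_nil] at h

theorem degree_mul (D E : ArrowDiagram) : (D * E).degree = D.degree + E.degree := by
  induction D using ArrowDiagram.ind with | _ u hu
  induction E using ArrowDiagram.ind with | _ v hv
  rw [ArrowDiagram.mk_mul_mk]
  change (tails (ArrowDiagram.juxtapose u v)).length = (tails u).length + (tails v).length
  simp [ArrowDiagram.juxtapose]

theorem mul_mem_grade {m n : ℕ} {x y : Aw K} (hx : x ∈ Aw.grade K m) (hy : y ∈ Aw.grade K n) :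
    x * y ∈ Aw.grade K (m + n) := by
  have h : Aw.grade K m * Aw.grade K n ≤ Aw.grade K (m + n) := by
    rw [Aw.grade, Aw.grade, Submodule.span_mul_span, Submodule.span_le]
    rintro _ ⟨_, ⟨D, rfl, rfl⟩, _, ⟨E, rfl, rfl⟩, rfl⟩
    refine Submodule.subset_span ⟨D * E, degree_mul D E, ?_⟩
    simp only [Aw.of, map_mul]
  exact h (Submodule.mul_mem_mul hx hy)

theorem iSup_grade : ⨆ n, Aw.grade K n = ⊤ := by
  refine top_le_iff.1 fun x _ => ?_
  induction x using Aw.induction with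
  | hmk w =>
    by_cases h : Valid w
    · exact Submodule.mem_iSup_of_mem _ (mk_mem_grade h)
    · rw [Aw.mk_of_not_valid h]
      exact zero_mem _
  | hadd x y hx hy => exact add_mem (hx trivial) (hy trivial)
  | hsmul c x hx => exact Submodule.smul_mem _ c (hx trivial)

theorem genVal_mem_grade (g : Gen) : genVal K g ∈ Aw.grade K g.deg := by
  cases g with
  | dL => exact Submodule.subset_span ⟨_, rfl, rfl⟩
  | dR => exact Submodule.subset_span ⟨_, rfl, rfl⟩
  | w k =>
    have h := ev_mem_grade (valid_wheelLetters (nodup_cons_spokes _))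
      (wheelElt_mem_permSpan (K := K) (spokes (k - 1)) 1)
    have hk := k.pos
    rwa [tails_wheelLetters, List.length_append, length_spokes, List.length_singleton,
      Nat.sub_add_cancel hk] at h

theorem comul_genVal (g : Gen) :
    Coalgebra.comul (R := K) (genVal K g) = genVal K g ⊗ₜ[K] 1 + 1 ⊗ₜ[K] genVal K g := by
  cases g with
  | dL =>
    simp only [genVal, of_dL]
    exact comul_single ⟨by simp, by simp⟩ (a := 0) rfl
  | dR =>
    simp only [genVal, of_dR]
    exact comul_single ⟨by simp, by simp⟩ (a := 0) rfl
  | w k => exact comul_wheelSum _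

theorem counit_genVal (g : Gen) : Coalgebra.counit (R := K) (genVal K g) = 0 := by
  cases g with
  | dL =>
    simp only [genVal, of_dL]
    rw [← ev_wd]
    exact counit_ev (by simp) (wd_mem_permSpan _)
  | dR =>
    simp only [genVal, of_dR]
    rw [← ev_wd]
    exact counit_ev (by simp) (wd_mem_permSpan _)
  | w k => exact counit_wheelSum _

variable [CharZero K]

theorem genVal_mem_center (g : Gen) : genVal K g ∈ Subalgebra.center K (Aw K) := by
  cases g with
  | dL => simpa only [genVal, of_dL] using mk_dL_mem_center
  | dR => simpa only [genVal, of_dR] using mk_dR_mem_center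
  | w k => exact wheelSum_mem_center _

/-- The values of the generators, as elements of a commutative algebra. -/
noncomputable def genCenter (K : Type u) [Field K] [CharZero K] (g : Gen) :
    Subalgebra.center K (Aw K) := ⟨genVal K g, genVal_mem_center g⟩

/-! ### Polynomials in the generators span each degree -/

variable {σ : Type} (v : σ → Gen)

/-- The value in `Aw K` of a polynomial whose variables stand for generators. -/
noncomputable def genEval : MvPolynomial σ K →ₐ[K] Aw K :=
  (Subalgebra.center K (Aw K)).val.comp (MvPolynomial.aeval fun s => genCenter K (v s))

@[simp] theorem genEval_X (s : σ) : genEval v (MvPolynomial.X s) = genVal K (v s) := by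
  simp [genEval, genCenter]

theorem genEval_mem_grade {n : ℕ} {p : MvPolynomial σ K}
    (hp : p ∈ MvPolynomial.weightedHomogeneousSubmodule K (fun s => (v s).deg) n) :
    genEval v p ∈ Aw.grade K n := by
  have hmon : ∀ d : σ →₀ ℕ, genEval v (MvPolynomial.monomial d (1 : K)) ∈
      Aw.grade K (Finsupp.weight (fun s => (v s).deg) d) := by
    intro d
    induction d using Finsupp.induction_linear with
    | zero =>
      rw [map_zero]
      refine (congrArg (· ∈ Aw.grade K 0) (map_one (genEval (K := K) v))).mpr one_mem_grade
    | add d e hd he =>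
      rw [← mul_one (1 : K), ← MvPolynomial.monomial_mul, map_mul, map_add]
      exact mul_mem_grade hd he
    | single s k =>
      rw [← MvPolynomial.X_pow_eq_monomial, map_pow, genEval_X, Finsupp.weight_single]
      induction k with
      | zero => simpa using one_mem_grade
      | succ k ih =>
        rw [pow_succ, succ_nsmul]
        exact mul_mem_grade ih (genVal_mem_grade _)
  rw [p.as_sum, map_sum]
  refine sum_mem fun d hd => ?_
  have h : Finsupp.weight (fun s => (v s).deg) d = n := hp (MvPolynomial.mem_support_iff.1 hd)
  rw [← mul_one (p.coeff d), ← smul_eq_mul, ← MvPolynomial.smul_monomial, map_smul, ← h]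
  exact Submodule.smul_mem _ _ (hmon d)

/-- Polynomials of degree `n` in the generators represent exactly the combinations of diagrams
with `n` arrows: a tree with one leaf gives `D_L` or `D_R`, and a larger tree gives a multiple of a wheel. As
`w_1 = D_L - D_R`, the generator `w_1` can be dispensed with. -/
theorem map_genEval_eq_grade (hv : ∀ g, g ≠ Gen.w 1 → ∃ s, v s = g) (n : ℕ) :
    (MvPolynomial.weightedHomogeneousSubmodule K (fun s => (v s).deg) n).map
      (genEval v).toLinearMap = Aw.grade K n := by
  set G : ℕ → Submodule K (Aw K) := fun n =>
    (MvPolynomial.weightedHomogeneousSubmodule K (fun s => (v s).deg) n).map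
      (genEval v).toLinearMap with hGdef
  have hgen : ∀ g, g ≠ Gen.w 1 → genVal K g ∈ G g.deg := by
    intro g hg
    obtain ⟨s, rfl⟩ := hv g hg
    exact ⟨MvPolynomial.X s, MvPolynomial.isWeightedHomogeneous_X _ _ _, genEval_X v s⟩
  have h1 : 1 ∈ G 0 := ⟨1, MvPolynomial.isWeightedHomogeneous_one _ _, map_one (genEval v)⟩
  have hmul : ∀ m n, ∀ x ∈ G m, ∀ y ∈ G n, x * y ∈ G (m + n) := by
    rintro m n _ ⟨p, hp, rfl⟩ _ ⟨q, hq, rfl⟩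
    exact ⟨p * q, MvPolynomial.IsWeightedHomogeneous.mul hp hq, map_mul (genEval v) _ _⟩
  have hone : ∀ (A B : List ℕ) (X : LTree),
      Valid (TreeWord.letters (A.map Sum.inl ++ Sum.inr X :: B.map Sum.inl)) →
      ev (TreeWord.eval K (A.map Sum.inl ++ Sum.inr X :: B.map Sum.inl)) ∈ G X.leaves.length := by
    intro A B X hval
    have hAB : (A ++ B).Perm X.leaves := by simpa using hval.2
    have hX : X.leaves.Nodup := hAB.nodup_iff.1 (by simpa using hval.1)
    have heval : TreeWord.eval K (A.map Sum.inl ++ Sum.inr X :: B.map Sum.inl) =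
        tls K A * X.eval K * tls K B := by
      rw [TreeWord.eval_append, TreeWord.eval_cons, TreeWord.eval_tails, TreeWord.eval_tails,
        Sum.elim_inr, mul_assoc]
    rw [heval]
    cases X with
    | leaf c =>
      rcases List.append_eq_singleton_iff.1 (List.perm_singleton.1 hAB) with ⟨rfl, rfl⟩ | ⟨rfl, rfl⟩
      · have h := hgen Gen.dL (by simp)
        have hc : Renamed [head 0, tail 0] [head c, tail c] := ⟨fun _ => c, fun _ => 0, rfl, rfl⟩
        rw [genVal, of_dL, Aw.mk_renamed K hc, ← ev_wd] at h
        convert h using 2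
        · rfl
        · simp [LTree.eval, ← wd_append]
      · have h := hgen Gen.dR (by simp)
        have hc : Renamed [tail 0, head 0] [tail c, head c] := ⟨fun _ => c, fun _ => 0, rfl, rfl⟩
        rw [genVal, of_dR, Aw.mk_renamed K hc, ← ev_wd] at h
        convert h using 2
        · rfl
        · simp [LTree.eval, ← wd_append]
    | node l r =>
      have h2 : 2 ≤ (LTree.node l r).leaves.length := by
        have hl := l.length_leaves_pos
        have hr := r.length_leaves_pos
        rw [LTree.leaves, List.length_append]
        omega
      refine ev_single_tree_mem h2 (fun cs b hcs => ?_) A B hAB hX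
      have hlen : cs.length + 1 = (LTree.node l r).leaves.length := hcs.length_eq
      rw [ev_wheelElt (hcs.nodup_iff.2 hX), ← hlen]
      refine hgen (Gen.w cs.length.succPNat) fun h => ?_
      have h1 : cs.length + 1 = 1 := congrArg PNat.val (Gen.w.inj h)
      omega
  refine le_antisymm ?_ ?_
  · rintro _ ⟨p, hp, rfl⟩
    exact genEval_mem_grade v hp
  · rw [Aw.grade, Submodule.span_le]
    rintro _ ⟨D, hD, rfl⟩
    induction D using ArrowDiagram.ind with | _ w hw
    have h := TreeWord.ev_mem_of_single_tree h1 hmul hone _ (TreeWord.ofWord w) rfl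
      (by rwa [TreeWord.letters_ofWord])
    rw [TreeWord.letters_ofWord, TreeWord.eval_ofWord, ev_wd, Aw.mk_of_valid K hw] at h
    have hD' : (tails w).length = n := hD
    rwa [hD'] at h

end Generators

/-! ### Elimination of `w_1` -/

/-- The generators other than `w_1`. -/
abbrev FreeGen : Type := {g : Gen // g ≠ Gen.w 1}

theorem ncard_freeGen_deg_one : {g : FreeGen | g.1.deg = 1}.ncard = 2 := by
  have h : {g : FreeGen | g.1.deg = 1} = {⟨Gen.dL, by simp⟩, ⟨Gen.dR, by simp⟩} := by
    ext ⟨g, hg⟩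
    cases g with
    | dL => simp [Gen.deg]
    | dR => simp [Gen.deg]
    | w k => simpa [Gen.deg] using fun e : k = 1 => hg (congrArg Gen.w e)
  rw [h, Set.ncard_pair (by simp)]

theorem ncard_freeGen_deg {n : ℕ} (hn : 2 ≤ n) : {g : FreeGen | g.1.deg = n}.ncard = 1 := by
  have h : {g : FreeGen | g.1.deg = n} = {⟨Gen.w ⟨n, by omega⟩, fun e => by
      have h1 : n = 1 := congrArg PNat.val (Gen.w.inj e)
      omega⟩} := by
    ext ⟨g, hg⟩
    cases g with
    | dL => simp [Gen.deg]; omega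
    | dR => simp [Gen.deg]; omega
    | w k =>
      rw [Set.mem_singleton_iff, Subtype.mk_eq_mk]
      exact ⟨fun e => congrArg Gen.w (PNat.eq e), fun e => congrArg PNat.val (Gen.w.inj e)⟩
  rw [h, Set.ncard_singleton]

section Independence

variable {K : Type u} [Field K]

/-- The homomorphism that takes each variable to the generator of the same name. -/
noncomputable def freeToWheelPoly (K : Type u) [Field K] :
    MvPolynomial FreeGen K →ₐ[K] WheelPoly K :=
  MvPolynomial.aeval fun g => WheelPoly.gen K g.1

/-- The relation `w_1 = D_L - D_R` expresses the missing generator. -/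
theorem freeToWheelPoly_surjective : Function.Surjective (freeToWheelPoly K) := by
  rw [← AlgHom.range_eq_top, ← top_le_iff]
  rintro x -
  obtain ⟨p, rfl⟩ : ∃ p, WheelPoly.proj K p = x := Ideal.Quotient.mk_surjective x
  have hgen : ∀ g, g ≠ Gen.w 1 → WheelPoly.gen K g ∈ (freeToWheelPoly K).range := fun g hg =>
    ⟨MvPolynomial.X ⟨g, hg⟩, by simp [freeToWheelPoly]⟩
  induction p using MvPolynomial.induction_on with
  | C c =>
    exact ⟨MvPolynomial.C c, (AlgHom.commutes _ c).trans (AlgHom.commutes _ c).symm⟩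
  | add p q hp hq =>
    rw [map_add]
    exact add_mem hp hq
  | mul_X p g hp =>
    rw [map_mul]
    refine mul_mem hp ?_
    change WheelPoly.gen K g ∈ _
    by_cases hg : g = Gen.w 1
    · rw [hg, WheelPoly.gen_w_one]
      exact sub_mem (hgen _ (by simp)) (hgen _ (by simp))
    · exact hgen g hg

/-! ### Independence of the generators -/

/-- The value of the state sum of `lineModel M t` at a generator. -/
noncomputable def lineValue {ι : Type} [Fintype ι] [DecidableEq ι] (M : Matrix ι ι K) (t : K) :
    Gen → K
  | Gen.dL => t + M.trace
  | Gen.dR => t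
  | Gen.w k => (M ^ (k : ℕ)).trace

theorem stateAw_lineModel_genVal {ι : Type} [Fintype ι] [DecidableEq ι] (M : Matrix ι ι K) (t : K)
    (g : Gen) : (lineModel M t).stateAw (genVal K g) = lineValue M t g • 1 := by
  cases g with
  | dL =>
    have h := stateAw_lineModel_wheelSum M t 1
    rw [show ((1 : ℕ+) : ℕ) - 1 = 0 from rfl, wheelSum_zero, map_sub, stateAw_lineModel_dR,
      sub_eq_iff_eq_add, PNat.one_coe, pow_one] at h
    rw [genVal, of_dL, h, lineValue, add_smul, add_comm]
  | dR => rw [genVal, of_dR, stateAw_lineModel_dR, lineValue]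
  | w k => exact stateAw_lineModel_wheelSum M t k

variable [CharZero K]

/-- Every assignment of values to finitely many of the generators other than `w_1` comes from a
matrix `M` and a scalar `t`. -/
theorem exists_lineValue_eq (y : FreeGen → K) (s : Finset FreeGen) :
    ∃ (ι : Type) (_ : Fintype ι) (_ : DecidableEq ι) (M : Matrix ι ι K) (t : K),
      ∀ g ∈ s, lineValue M t g.1 = y g := by
  set t : K := y ⟨Gen.dR, by simp⟩ with ht
  -- The trace of `M` itself is the value of `w_1`, which is the difference of those of `D_L` and `D_R`.
  set a : ℕ → K := fun j =>
    if h : 1 < j then y ⟨Gen.w ⟨j, by omega⟩, fun e => by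
      have := congrArg PNat.val (Gen.w.inj e); simp at this; omega⟩
    else y ⟨Gen.dL, by simp⟩ - t with ha
  obtain ⟨ι, i1, i2, M, hM⟩ := exists_trace_pow_eq a (s.sup (fun g => g.1.deg) + 1)
  refine ⟨ι, i1, i2, M, t, ?_⟩
  rintro ⟨g, hg⟩ hgs
  cases g with
  | dL =>
    have h := hM 1 le_rfl (by omega)
    rw [pow_one] at h
    simp [lineValue, h, ha]
  | dR => rfl
  | w k =>
    have hk : (k : ℕ) ≤ s.sup fun g => g.1.deg := Finset.le_sup (f := fun g : FreeGen => g.1.deg) hgs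
    have hk1 : (k : ℕ) ≠ 1 := fun h => hg (congrArg Gen.w (PNat.eq h))
    have hk0 := k.pos
    rw [lineValue, hM k hk0 (by omega), ha]
    exact dif_pos (by omega)

/-- The state sums of all the models `lineModel M t` separate polynomials in the generators. -/
theorem eq_zero_of_stateAw_genEval (p : MvPolynomial FreeGen K)
    (h : ∀ (ι : Type) (_ : Fintype ι) (M : Matrix ι ι K) (t : K),
      (lineModel M t).stateAw (genEval Subtype.val p) = 0) : p = 0 := by
  refine MvPolynomial.funext fun y => ?_
  obtain ⟨ι, _, _, M, t, hy⟩ := exists_lineValue_eq y p.vars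
  have h1 : (lineModel M t).stateAw (genEval Subtype.val p) =
      algebraMap K _ (MvPolynomial.eval y p) := by
    have hle : MvPolynomial.supported K (p.vars : Set FreeGen) ≤
        AlgHom.equalizer ((lineModel M t).stateAw.comp (genEval Subtype.val))
          ((Algebra.ofId K (Module.End K (MvPolynomial ι K))).comp (MvPolynomial.aeval y)) := by
      refine Algebra.adjoin_le ?_
      rintro _ ⟨g, hg, rfl⟩
      rw [SetLike.mem_coe, AlgHom.mem_equalizer, AlgHom.comp_apply, AlgHom.comp_apply, genEval_X,
        MvPolynomial.aeval_X, stateAw_lineModel_genVal, hy g hg, Algebra.ofId_apply,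
        Algebra.algebraMap_eq_smul_one]
    exact hle (MvPolynomial.mem_supported_vars p)
  rw [h, eq_comm, FaithfulSMul.algebraMap_eq_zero_iff] at h1
  rw [h1, map_zero]

theorem genEval_injective :
    Function.Injective (genEval (K := K) (Subtype.val : FreeGen → Gen)) := by
  refine (injective_iff_map_eq_zero _).2 fun p hp => eq_zero_of_stateAw_genEval p fun ι _ M t => ?_
  rw [hp, map_zero]

theorem map_genEval_freeGen (n : ℕ) :
    (MvPolynomial.weightedHomogeneousSubmodule K (fun g : FreeGen => g.1.deg) n).map
      (genEval (K := K) (Subtype.val : FreeGen → Gen)).toLinearMap = Aw.grade K n :=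
  map_genEval_eq_grade _ (fun g hg => ⟨⟨g, hg⟩, rfl⟩) n

theorem genEval_surjective :
    Function.Surjective (genEval (K := K) (Subtype.val : FreeGen → Gen)) := by
  have h : LinearMap.range (genEval (K := K) (Subtype.val : FreeGen → Gen)).toLinearMap = ⊤ := by
    rw [← top_le_iff, ← iSup_grade, iSup_le_iff]
    intro n
    rw [← map_genEval_freeGen]
    exact LinearMap.map_le_range
  exact LinearMap.range_eq_top.1 h

/-- Polynomials in the generators other than `w_1` form the algebra of arrow diagrams. -/
noncomputable def freeEquiv (K : Type u) [Field K] [CharZero K] :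
    MvPolynomial FreeGen K ≃ₐ[K] Aw K :=
  AlgEquiv.ofBijective (genEval Subtype.val) ⟨genEval_injective, genEval_surjective⟩

/-- The state sums are defined on w-Jacobi diagrams as well, so the elements of the kernel of
`toJacobi` are killed by all of them. -/
theorem toJacobi_injective : Function.Injective (toJacobi K) := by
  refine (injective_iff_map_eq_zero _).2 fun x hx => ?_
  obtain ⟨p, rfl⟩ := genEval_surjective x
  rw [eq_zero_of_stateAw_genEval p fun ι _ M t => ?_, map_zero]
  rw [StateModel.stateAw_apply, hx, map_zero]

/-- Arrow diagrams and w-Jacobi diagrams span the same space. -/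
noncomputable def jacobiEquiv (K : Type u) [Field K] [CharZero K] : Aw K ≃ₗ[K] Awt K :=
  LinearEquiv.ofBijective (toJacobi K) ⟨toJacobi_injective, toJacobi_surjective⟩

/-! ### The isomorphism of bialgebras -/

/-- The homomorphism that takes the generators to the diagrams of the same name. -/
noncomputable def wheelPolyHom (K : Type u) [Field K] [CharZero K] : WheelPoly K →ₐ[K] Aw K :=
  (Subalgebra.center K (Aw K)).val.comp
    (WheelPoly.lift K (genCenter K) (Subtype.ext genVal_w_one))

@[simp] theorem wheelPolyHom_gen (g : Gen) : wheelPolyHom K (WheelPoly.gen K g) = genVal K g := by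
  rw [wheelPolyHom, AlgHom.comp_apply, WheelPoly.lift_gen]
  rfl

theorem wheelPolyHom_comp_proj : (wheelPolyHom K).comp (WheelPoly.proj K) = genEval id :=
  MvPolynomial.algHom_ext fun g => (wheelPolyHom_gen g).trans (genEval_X id g).symm

theorem wheelPolyHom_comp_free :
    (wheelPolyHom K).comp (freeToWheelPoly K) = genEval Subtype.val := by
  refine MvPolynomial.algHom_ext fun g => ?_
  rw [AlgHom.comp_apply, freeToWheelPoly, MvPolynomial.aeval_X, wheelPolyHom_gen, genEval_X]

theorem wheelPolyHom_bijective : Function.Bijective (wheelPolyHom K) := by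
  have h : wheelPolyHom K ∘ freeToWheelPoly K = freeEquiv K :=
    congrArg DFunLike.coe wheelPolyHom_comp_free
  have hb : Function.Bijective (wheelPolyHom K ∘ freeToWheelPoly K) := h ▸ (freeEquiv K).bijective
  refine ⟨?_, hb.2.of_comp⟩
  exact hb.1.of_comp_right freeToWheelPoly_surjective

/-- The isomorphism from the bialgebra of polynomials to the bialgebra of arrow diagrams. -/
noncomputable def wheelPolyEquiv (K : Type u) [Field K] [CharZero K] : WheelPoly K ≃ₐc[K] Aw K :=
  BialgEquiv.ofAlgEquiv (AlgEquiv.ofBijective (wheelPolyHom K) wheelPolyHom_bijective)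
    (WheelPoly.algHom_ext K fun g => by
      change Coalgebra.counit (R := K) (wheelPolyHom K (WheelPoly.gen K g)) =
        WheelPoly.counitHom K (WheelPoly.gen K g)
      rw [wheelPolyHom_gen, counit_genVal, WheelPoly.counitHom_gen])
    (WheelPoly.algHom_ext K fun g => by
      change Algebra.TensorProduct.map (wheelPolyHom K) (wheelPolyHom K)
        (WheelPoly.comulHom K (WheelPoly.gen K g)) =
        Coalgebra.comul (R := K) (wheelPolyHom K (WheelPoly.gen K g))
      rw [wheelPolyHom_gen, comul_genVal, WheelPoly.comulHom_gen]
      simp)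

theorem wheelPolyEquiv_gen (g : Gen) : wheelPolyEquiv K (WheelPoly.gen K g) = genVal K g :=
  wheelPolyHom_gen g

theorem map_wheelPolyEquiv_grade (n : ℕ) :
    (WheelPoly.grade K n).map (wheelPolyEquiv K : WheelPoly K →ₗ[K] Aw K) = Aw.grade K n := by
  rw [← map_genEval_eq_grade (K := K) id (fun g _ => ⟨g, rfl⟩) n, ← wheelPolyHom_comp_proj,
    AlgHom.comp_toLinearMap, Submodule.map_comp]
  rfl

end Independence

end WKnot

theorem mainTheorem3 (K : Type*) [Field K] [CharZero K] :
    ∃ ι : WKnot.Aw K ≃ₗ[K] WKnot.Awt K,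
      (∀ D : WKnot.ArrowDiagram, ι (WKnot.Aw.of K D) = WKnot.Awt.of K D.toJacobi) ∧
      ∃ Φ : WKnot.WheelPoly K ≃ₐc[K] WKnot.Aw K,
        Φ (WKnot.WheelPoly.gen K WKnot.Gen.dL) = WKnot.Aw.of K WKnot.ArrowDiagram.dL ∧
        Φ (WKnot.WheelPoly.gen K WKnot.Gen.dR) = WKnot.Aw.of K WKnot.ArrowDiagram.dR ∧
        (∀ k : ℕ+, ι (Φ (WKnot.WheelPoly.gen K (WKnot.Gen.w k))) = WKnot.Awt.of K (WKnot.JacobiDiagram.wheel k)) ∧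
        (∀ n : ℕ, (WKnot.WheelPoly.grade K n).map (Φ : WKnot.WheelPoly K →ₗ[K] WKnot.Aw K) = WKnot.Aw.grade K n) ∧
        ∃ Ψ : MvPolynomial {g : WKnot.Gen // g ≠ WKnot.Gen.w 1} K ≃ₐ[K] WKnot.Aw K,
          (∀ g, Ψ (MvPolynomial.X g) = Φ (WKnot.WheelPoly.gen K g.1)) ∧
          (∀ n : ℕ,
            (MvPolynomial.weightedHomogeneousSubmodule K
                (fun g : {g : WKnot.Gen // g ≠ WKnot.Gen.w 1} => g.1.deg) n).map
              (Ψ : MvPolynomial {g : WKnot.Gen // g ≠ WKnot.Gen.w 1} K →ₗ[K] WKnot.Aw K) = WKnot.Aw.grade K n) ∧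
          {g : {g : WKnot.Gen // g ≠ WKnot.Gen.w 1} | g.1.deg = 1}.ncard = 2 ∧
          ∀ n : ℕ, 2 ≤ n → {g : {g : WKnot.Gen // g ≠ WKnot.Gen.w 1} | g.1.deg = n}.ncard = 1 := by
  refine ⟨WKnot.jacobiEquiv K, WKnot.toJacobi_of, WKnot.wheelPolyEquiv K,
    WKnot.wheelPolyEquiv_gen _, WKnot.wheelPolyEquiv_gen _, fun k => ?_,
    WKnot.map_wheelPolyEquiv_grade, WKnot.freeEquiv K, fun g => ?_, WKnot.map_genEval_freeGen,
    WKnot.ncard_freeGen_deg_one, fun n hn => WKnot.ncard_freeGen_deg hn⟩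
  · rw [WKnot.wheelPolyEquiv_gen]
    exact WKnot.toJacobi_wheelSum k
  · rw [WKnot.wheelPolyEquiv_gen]
    exact WKnot.genEval_X _ g
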